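/- Let $n\in\mathbb N$ and let $\Omega\subset\mathbb R^n$ be a domain (open, connected, non-empty) with smooth boundary such that $\partial\Omega$ has exactly two connected components. Assume that $\Omega$ is invariant under scaling at large distances: there is $R_0\ge 1$ such that, with $\Omega_S:=\Omega\cap S(0,R_0)$ and $B(0,R_0)$ the open ball, $$\Omega\setminus B(0,R_0)=\{\lambda p : p\in\Omega_S,\ \lambda\ge 1\}.$$ Let $x:\overline\Omega\to\mathbb R$ be a smooth defining function for $\partial\Omega$ (that is, $x>0$ on $\Omega$, and $x=0$, $dx\neq 0$ on $\partial\Omega$) such that $x(\lambda p)=\lambda x(p)$ whenever $\lambda\ge1$ and $p,\lambda p\in\Omega\setminus B(0,R_0)$. Let $r$ be a positive function, smooth on $\overline\Omega$ and bounded away from zero, with $r(p)=|p|$ on $\Omega\setminus B(0,R_0)$. Let $g$ be a Riemannian metric on $\mathbb R^n$ with components of class $W^{1,\infty}_{\mathrm{loc}}$ (i.e. locally Lipschitz) which approaches the Euclidean metric at infinity, $g_{ij}(p)\to\delta_{ij}$ as $|p|\to\infty$ (with no decay rate imposed), and whose first derivatives satisfy $\partial_k g_{ij}=o(1/|p|)$.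 Let $\nabla$, $|\cdot|$ and $d\mu_g$ denote the Levi-Civita covariant derivative, the pointwise tensor norm and the Riemannian measure of $g$. Let $\sigma,\mu\in\mathbb R$ satisfy $\sigma\neq-\tfrac12$ and $\sigma+\mu+\tfrac n2\neq0$. Consider tensor fields of an arbitrary fixed type $(k,l)$, and let $\mathring H$ be the completion of the space of $C^2$ tensor fields of this type compactly supported in $\Omega$ with respect to the norm $$\|u\|_{\mathring H}^2=\int_\Omega x^{2\sigma}r^{2\mu}|u|^2\,d\mu_g+\int_\Omega x^{2\sigma+2}r^{2\mu}|\nabla u|^2\,d\mu_g .$$ The maps $u\mapsto u$ and $u\mapsto\nabla u$ extend by continuity to $\mathring H$, with values in the $L^2$ spaces of tensor fields with weights $x^{2\sigma}r^{2\mu}\,d\mu_g$ and $x^{2\sigma+2}r^{2\mu}\,d\mu_g$ respectively. Let $X\subset\mathring H$ be a closed linear subspace transversal to the space of parallel fields, in the sense that $X\cap\{u\in\mathring H:\nabla u=0\}=\{0\}$. Then there exists a constant $C$ such that for all $u\in X$ $$\int_\Omega x^{2\sigma}r^{2\mu}|u|^2\,d\mu_g\le C\int_\Omega x^{2\sigma+2}r^{2\mu}|\nabla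 u|^2\,d\mu_g .$$ -/

import Mathlib

open Set Filter Topology MeasureTheory Bornology
open scoped Matrix ContDiff

namespace WeightedPoincare

noncomputable section

/-- `ℝⁿ` with its Euclidean norm. -/
abbrev Eucl (n : ℕ) : Type := EuclideanSpace ℝ (Fin n)

/-! ### Domains which are scale-invariant at large distances -/

/-- `Ω` has smooth boundary: near each boundary point, `Ω` is the positivity set of a smooth
function whose differential does not vanish at that point. -/
def HasSmoothBoundary {n : ℕ} (Ω : Set (Eucl n)) : Prop :=
  ∀ p ∈ frontier Ω, ∃ U : Set (Eucl n), IsOpen U ∧ p ∈ U ∧ ∃ f : Eucl n → ℝ,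
    ContDiffOn ℝ ∞ f U ∧ f p = 0 ∧ fderiv ℝ f p ≠ 0 ∧ Ω ∩ U = {q ∈ U | 0 < f q}

/-- `x` is a smooth defining function for `∂Ω` on `closure Ω`. -/
structure IsDefiningFunction {n : ℕ} (Ω : Set (Eucl n)) (x : Eucl n → ℝ) : Prop where
  smooth : ContDiffOn ℝ ∞ x (closure Ω)
  pos : ∀ p ∈ Ω, 0 < x p
  eq_zero : ∀ p ∈ frontier Ω, x p = 0
  fderiv_ne_zero : ∀ p ∈ frontier Ω, fderivWithin ℝ x (closure Ω) p ≠ 0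

/-- A domain `Ω ⊆ ℝⁿ` with smooth boundary, invariant under scaling at large distances, together
with a defining function `x` of `∂Ω` which is homogeneous of degree one at large distances, and a
smooth positive function `r`, bounded away from zero, which equals `|p|` at large distances. -/
structure ScaleInvariantDomain (n : ℕ) where
  /-- the domain `Ω` -/
  Ω : Set (Eucl n)
  isOpen : IsOpen Ω
  isConnected : IsConnected Ω
  smoothBoundary : HasSmoothBoundary Ω
  /-- `∂Ω` has exactly two connected components -/
  boundary_components : Nat.card (ConnectedComponents (frontier Ω)) = 2
  /-- the radius beyond which `Ω` is a cone -/
  R₀ : ℝ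
  one_le_R₀ : 1 ≤ R₀
  scaling : Ω \ Metric.ball 0 R₀ =
    {q | ∃ t : ℝ, 1 ≤ t ∧ ∃ p ∈ Ω ∩ Metric.sphere 0 R₀, q = t • p}
  /-- the defining function of the boundary -/
  x : Eucl n → ℝ
  isDefining : IsDefiningFunction Ω x
  x_homogeneous : ∀ (t : ℝ) (p : Eucl n), 1 ≤ t → p ∈ Ω \ Metric.ball 0 R₀ →
    t • p ∈ Ω \ Metric.ball 0 R₀ → x (t • p) = t * x p
  /-- the radial function -/
  r : Eucl n → ℝ
  r_smooth : ContDiffOn ℝ ∞ r (closure Ω)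
  r_bounded_below : ∃ c : ℝ, 0 < c ∧ ∀ p ∈ Ω, c ≤ r p
  r_eq_norm : ∀ p ∈ Ω \ Metric.ball 0 R₀, r p = ‖p‖

/-! ### Asymptotically Euclidean metrics, tensor fields, covariant derivative -/

/-- The coordinate partial derivative `∂ᵢ f`. -/
def pderiv {n : ℕ} (i : Fin n) (f : Eucl n → ℝ) (p : Eucl n) : ℝ :=
  fderiv ℝ f p (EuclideanSpace.single i 1)

/-- A Riemannian metric `g_{ij}` on `ℝⁿ` with locally Lipschitz (that is, `W^{1,∞}_loc`)
components, which tends to the Euclidean metric at infinity, with no decay rate imposed, and whose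
first derivatives are `o(1/|p|)`. By Rademacher's theorem the derivatives exist almost
everywhere. -/
structure AEMetric (n : ℕ) where
  /-- the matrix of components `g_{ij}` at a point -/
  g : Eucl n → Matrix (Fin n) (Fin n) ℝ
  posDef : ∀ p, (g p).PosDef
  locallyLipschitz : ∀ i j, LocallyLipschitz fun p => g p i j
  tendsto_euclidean : ∀ i j,
    Tendsto (fun p => g p i j) (cobounded (Eucl n)) (𝓝 ((1 : Matrix (Fin n) (Fin n) ℝ) i j))
  deriv_isLittleO : ∀ i j k,
    (fun p => pderiv k (fun q => g q i j) p) =o[cobounded (Eucl n)] fun p => ‖p‖⁻¹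

/-- Multi-indices of a tensor with `k` upper and `l` lower indices. -/
abbrev TIdx (n k l : ℕ) : Type := (Fin k → Fin n) × (Fin l → Fin n)

/-- Tensors on `ℝⁿ` with `k` upper and `l` lower indices, through their components. -/
abbrev Tensor (n k l : ℕ) : Type := TIdx n k l → ℝ

/-- Tensor fields of type `(k, l)`. -/
abbrev TensorField (n k l : ℕ) : Type := Eucl n → Tensor n k l

namespace AEMetric

variable {n : ℕ} (G : AEMetric n)

/-- Christoffel symbols `Γᵃᵢⱼ = ½ gᵃᶜ (∂ᵢ g_{jc} + ∂ⱼ g_{ic} - ∂_c g_{ij})`. -/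
def christoffel (a i j : Fin n) (p : Eucl n) : ℝ :=
  (1 / 2) * ∑ c, (G.g p)⁻¹ a c * (pderiv i (fun q => G.g q j c) p +
    pderiv j (fun q => G.g q i c) p - pderiv c (fun q => G.g q i j) p)

/-- The covariant derivative of a tensor field; the new lower index, the first one, is the
direction of differentiation. -/
def nabla {k l : ℕ} (u : TensorField n k l) : TensorField n k (l + 1) := fun p I =>
  pderiv (I.2 0) (fun q => u q (I.1, Fin.tail I.2)) p
    + ∑ s, ∑ c, G.christoffel (I.1 s) (I.2 0) c p * u p (Function.update I.1 s c, Fin.tail I.2)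
    - ∑ t, ∑ c, G.christoffel c (I.2 0) (Fin.tail I.2 t) p *
        u p (I.1, Function.update (Fin.tail I.2) t c)

/-- The matrix, on multi-indices, of the scalar product which `g` induces on tensors. -/
def gram (k l : ℕ) (p : Eucl n) : Matrix (TIdx n k l) (TIdx n k l) ℝ := fun I J =>
  (∏ s, G.g p (I.1 s) (J.1 s)) * ∏ t, (G.g p)⁻¹ (I.2 t) (J.2 t)

/-- The scalar product of tensors at `p` induced by `g`. -/
def tensorInner {k l : ℕ} (p : Eucl n) (S T : Tensor n k l) : ℝ :=
  ∑ I, ∑ J, G.gram k l p I J * S I * T J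

end AEMetric

/-! ### Positivity of the scalar product of tensors -/

theorem posSemidef_mul {ι : Type*} [Finite ι] {A B : Matrix ι ι ℝ} (hA : A.PosSemidef)
    (hB : B.PosSemidef) : Matrix.PosSemidef (fun i j => A i j * B i j : Matrix ι ι ℝ) := by
  have := Fintype.ofFinite ι
  exact (hA.kronecker hB).submatrix fun i : ι => (i, i)

theorem posSemidef_prod {ι κ : Type*} [Finite ι] (s : Finset κ) (A : κ → Matrix ι ι ℝ)
    (hA : ∀ k, (A k).PosSemidef) :
    Matrix.PosSemidef (fun i j => ∏ k ∈ s, A k i j : Matrix ι ι ℝ) := by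
  classical
  have := Fintype.ofFinite ι
  induction s using Finset.induction_on with
  | empty =>
    have h := Matrix.posSemidef_vecMulVec_self_star (fun _ : ι => (1 : ℝ))
    have e : (fun i j => ∏ k ∈ (∅ : Finset κ), A k i j : Matrix ι ι ℝ) =
        Matrix.vecMulVec (fun _ : ι => (1 : ℝ)) (star fun _ : ι => (1 : ℝ)) := by
      ext i j
      simp [Matrix.vecMulVec_apply]
    rw [e]
    exact h
  | insert a s ha ih =>
    simp only [Finset.prod_insert ha]
    exact posSemidef_mul (hA a) ih

namespace AEMetric

variable {n : ℕ} (G : AEMetric n)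

theorem gram_posSemidef (k l : ℕ) (p : Eucl n) : (G.gram k l p).PosSemidef :=
  posSemidef_mul
    (posSemidef_prod Finset.univ
      (fun s : Fin k => (G.g p).submatrix (fun I : TIdx n k l => I.1 s) fun J => J.1 s)
      fun _ => (G.posDef p).posSemidef.submatrix _)
    (posSemidef_prod Finset.univ
      (fun t : Fin l => (G.g p)⁻¹.submatrix (fun I : TIdx n k l => I.2 t) fun J => J.2 t)
      fun _ => (G.posDef p).posSemidef.inv.submatrix _)

variable {k l : ℕ}

theorem tensorInner_self_nonneg (p : Eucl n) (S : Tensor n k l) : 0 ≤ G.tensorInner p S S := by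
  have h := (G.gram_posSemidef k l p).dotProduct_mulVec_nonneg S
  refine h.trans_eq ?_
  simp only [tensorInner, dotProduct, Matrix.mulVec, Finset.mul_sum]
  refine Finset.sum_congr rfl fun I _ => Finset.sum_congr rfl fun J _ => ?_
  simp
  ring

theorem tensorInner_comm (p : Eucl n) (S T : Tensor n k l) :
    G.tensorInner p S T = G.tensorInner p T S := by
  simp only [tensorInner]
  rw [Finset.sum_comm]
  refine Finset.sum_congr rfl fun I _ => Finset.sum_congr rfl fun J _ => ?_
  have h := (G.gram_posSemidef k l p).isHermitian.apply I J
  simp only [star_trivial] at h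
  rw [h]
  ring

theorem tensorInner_add_left (p : Eucl n) (S S' T : Tensor n k l) :
    G.tensorInner p (S + S') T = G.tensorInner p S T + G.tensorInner p S' T := by
  simp only [tensorInner, Pi.add_apply, mul_add, add_mul, Finset.sum_add_distrib]

theorem tensorInner_smul_left (p : Eucl n) (c : ℝ) (S T : Tensor n k l) :
    G.tensorInner p (c • S) T = c * G.tensorInner p S T := by
  simp only [tensorInner, Pi.smul_apply, smul_eq_mul, Finset.mul_sum]
  refine Finset.sum_congr rfl fun I _ => Finset.sum_congr rfl fun J _ => ?_
  ring

theorem two_mul_abs_tensorInner_le (p : Eucl n) (S T : Tensor n k l) :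
    2 * |G.tensorInner p S T| ≤ G.tensorInner p S S + G.tensorInner p T T := by
  have h1 := G.tensorInner_self_nonneg p (S + T)
  have h2 := G.tensorInner_self_nonneg p (S + (-1 : ℝ) • T)
  simp only [G.tensorInner_add_left, G.tensorInner_smul_left, G.tensorInner_comm p _ (S + _)]
    at h1 h2
  rw [G.tensorInner_comm p T S] at h1 h2
  rcases abs_cases (G.tensorInner p S T) with h | h <;> linarith

end AEMetric

/-! ### Locally bounded measurable functions -/

/-- Measurable on `Ω` and bounded near each point of `Ω`. -/
def Tame {n : ℕ} (Ω : Set (Eucl n)) (f : Eucl n → ℝ) : Prop :=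
  AEStronglyMeasurable f (volume.restrict Ω) ∧ ∀ p ∈ Ω, ∃ C : ℝ, ∀ᶠ q in 𝓝 p, |f q| ≤ C

namespace Tame

variable {n : ℕ} {Ω : Set (Eucl n)} {f h : Eucl n → ℝ}

theorem add (hf : Tame Ω f) (hh : Tame Ω h) : Tame Ω fun p => f p + h p := by
  refine ⟨hf.1.add hh.1, fun p hp => ?_⟩
  obtain ⟨C, hC⟩ := hf.2 p hp
  obtain ⟨C', hC'⟩ := hh.2 p hp
  refine ⟨C + C', ?_⟩
  filter_upwards [hC, hC'] with q h1 h2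
  exact (abs_add_le _ _).trans (add_le_add h1 h2)

theorem mul (hf : Tame Ω f) (hh : Tame Ω h) : Tame Ω fun p => f p * h p := by
  refine ⟨hf.1.mul hh.1, fun p hp => ?_⟩
  obtain ⟨C, hC⟩ := hf.2 p hp
  obtain ⟨C', hC'⟩ := hh.2 p hp
  refine ⟨C * C', ?_⟩
  filter_upwards [hC, hC'] with q h1 h2
  rw [abs_mul]
  exact mul_le_mul h1 h2 (abs_nonneg _) ((abs_nonneg _).trans h1)

theorem const (c : ℝ) : Tame Ω fun _ => c :=
  ⟨aestronglyMeasurable_const, fun _ _ => ⟨|c|, Eventually.of_forall fun _ => le_rfl⟩⟩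

theorem sub (hf : Tame Ω f) (hh : Tame Ω h) : Tame Ω fun p => f p - h p := by
  have := hf.add ((const (-1)).mul hh)
  simpa [sub_eq_add_neg] using this

theorem sum {ι : Type*} (s : Finset ι) {F : ι → Eucl n → ℝ} (hF : ∀ i, Tame Ω (F i)) :
    Tame Ω fun p => ∑ i ∈ s, F i p := by
  classical
  induction s using Finset.induction_on with
  | empty => simpa using const 0
  | insert a s ha ih =>
    simp only [Finset.sum_insert ha]
    exact (hF a).add ih

theorem prod {ι : Type*} (s : Finset ι) {F : ι → Eucl n → ℝ} (hF : ∀ i, Tame Ω (F i)) :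
    Tame Ω fun p => ∏ i ∈ s, F i p := by
  classical
  induction s using Finset.induction_on with
  | empty => simpa using const 1
  | insert a s ha ih =>
    simp only [Finset.prod_insert ha]
    exact (hF a).mul ih

theorem of_continuousOn (hΩ : IsOpen Ω) (hf : ContinuousOn f Ω) : Tame Ω f := by
  refine ⟨hf.aestronglyMeasurable hΩ.measurableSet, fun p hp => ⟨|f p| + 1, ?_⟩⟩
  have h1 : ContinuousAt (fun q => |f q|) p := (hf.continuousAt (hΩ.mem_nhds hp)).abs
  exact (h1.eventually (gt_mem_nhds (lt_add_one _))).mono fun q hq => le_of_lt hq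

theorem of_continuous (hΩ : IsOpen Ω) (hf : Continuous f) : Tame Ω f :=
  of_continuousOn hΩ hf.continuousOn

theorem pderiv_of_lipschitz (hf : LocallyLipschitz f) (i : Fin n) : Tame Ω (pderiv i f) := by
  refine ⟨(measurable_fderiv_apply_const ℝ f _).aestronglyMeasurable, fun p _ => ?_⟩
  obtain ⟨K, t, ht, hK⟩ := hf p
  refine ⟨K, ?_⟩
  filter_upwards [eventually_mem_nhds_iff.2 ht] with q hq
  have h1 := norm_fderiv_le_of_lipschitzOn ℝ hq hK
  have h2 := (fderiv ℝ f q).le_opNorm (EuclideanSpace.single i (1 : ℝ))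
  have h3 : ‖EuclideanSpace.single i (1 : ℝ)‖ = 1 := by simp
  rw [h3, mul_one] at h2
  exact h2.trans h1

theorem integrableOn {K : Set (Eucl n)} (hf : Tame Ω f) (hK : IsCompact K) (hKΩ : K ⊆ Ω)
    (h0 : ∀ p, p ∉ K → f p = 0) : IntegrableOn f Ω := by
  have hb : ∃ C : ℝ, ∀ q ∈ K, |f q| ≤ C := by
    refine hK.induction_on (p := fun s => ∃ C : ℝ, ∀ q ∈ s, |f q| ≤ C) ⟨0, by simp⟩
      (fun s t hst ⟨C, hC⟩ => ⟨C, fun q hq => hC q (hst hq)⟩)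
      (fun s t ⟨C, hC⟩ ⟨C', hC'⟩ => ⟨max C C', ?_⟩) fun p hp => ?_
    · rintro q (hq | hq)
      · exact (hC q hq).trans (le_max_left _ _)
      · exact (hC' q hq).trans (le_max_right _ _)
    · obtain ⟨C, hC⟩ := hf.2 p (hKΩ hp)
      exact ⟨_, mem_nhdsWithin_of_mem_nhds hC, C, fun q hq => hq⟩
  obtain ⟨C, hC⟩ := hb
  refine (integrableOn_iff_integrable_of_support_subset fun p hp => ?_).1
    (Measure.integrableOn_of_bounded (s := K) (M := C) ?_ hf.1 ?_)
  · by_contra hpK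
    exact hp (h0 p hpK)
  · exact ((Measure.restrict_apply_le _ _).trans_lt hK.measure_lt_top).ne
  · exact (ae_restrict_iff' hK.measurableSet).2 (Eventually.of_forall hC)

end Tame

namespace AEMetric

variable {n : ℕ} (G : AEMetric n) {Ω : Set (Eucl n)}

theorem continuous_g : Continuous G.g :=
  continuous_matrix fun i j => (G.locallyLipschitz i j).continuous

theorem continuous_inv : Continuous fun p => (G.g p)⁻¹ := by
  simp only [Matrix.inv_def, Ring.inverse_eq_inv']
  exact (G.continuous_g.matrix_det.inv₀ fun p => (G.posDef p).det_pos.ne').smul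
    G.continuous_g.matrix_adjugate

theorem tame_inv (hΩ : IsOpen Ω) (i j : Fin n) : Tame Ω fun p => (G.g p)⁻¹ i j :=
  .of_continuous hΩ (G.continuous_inv.matrix_elem i j)

theorem tame_christoffel (hΩ : IsOpen Ω) (a i j : Fin n) : Tame Ω (G.christoffel a i j) :=
  (Tame.const (1 / 2)).mul <| .sum _ fun c => (G.tame_inv hΩ a c).mul <|
    ((Tame.pderiv_of_lipschitz (G.locallyLipschitz j c) i).add
      (Tame.pderiv_of_lipschitz (G.locallyLipschitz i c) j)).sub
      (Tame.pderiv_of_lipschitz (G.locallyLipschitz i j) c)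

theorem tame_gram (hΩ : IsOpen Ω) (k l : ℕ) (I J : TIdx n k l) :
    Tame Ω fun p => G.gram k l p I J :=
  (Tame.prod _ fun s => Tame.of_continuous hΩ (G.continuous_g.matrix_elem (I.1 s) (J.1 s))).mul
    (Tame.prod _ fun t => G.tame_inv hΩ (I.2 t) (J.2 t))

theorem tame_tensorInner (hΩ : IsOpen Ω) {k l : ℕ} {u v : TensorField n k l}
    (hu : ∀ I, Tame Ω fun p => u p I) (hv : ∀ I, Tame Ω fun p => v p I) :
    Tame Ω fun p => G.tensorInner p (u p) (v p) :=
  .sum _ fun I => .sum _ fun J => ((G.tame_gram hΩ k l I J).mul (hu I)).mul (hv J)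

end AEMetric

/-! ### Weighted `L²` spaces -/

section L2

variable {n : ℕ} (D : ScaleInvariantDomain n) (G : AEMetric n) (k l : ℕ) (a b : ℝ)

/-- The density of `x^{2a} r^{2b} dμ_g` with respect to Lebesgue measure, where
`dμ_g = √(det g) dp` is the Riemannian measure. -/
def weight (p : Eucl n) : ℝ :=
  D.x p ^ (2 * a) * D.r p ^ (2 * b) * √(G.g p).det

theorem ScaleInvariantDomain.r_pos {p : Eucl n} (hp : p ∈ D.Ω) : 0 < D.r p := by
  obtain ⟨c, hc, h⟩ := D.r_bounded_below
  exact hc.trans_le (h p hp)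

theorem weight_nonneg {p : Eucl n} (hp : p ∈ D.Ω) : 0 ≤ weight D G a b p :=
  mul_nonneg (mul_nonneg (Real.rpow_nonneg (D.isDefining.pos p hp).le _)
    (Real.rpow_nonneg (D.r_pos hp).le _)) (Real.sqrt_nonneg _)

theorem tame_weight : Tame D.Ω (weight D G a b) := by
  refine .of_continuousOn D.isOpen ((ContinuousOn.mul ?_ ?_).mul ?_)
  · exact (D.isDefining.smooth.continuousOn.mono subset_closure).rpow_const
      fun p hp => Or.inl (D.isDefining.pos p hp).ne'
  · exact (D.r_smooth.continuousOn.mono subset_closure).rpow_const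
      fun p hp => Or.inl (D.r_pos hp).ne'
  · exact G.continuous_g.matrix_det.sqrt.continuousOn

/-- Measurable tensor fields `u` on `Ω` with finite `∫_Ω x^{2a} r^{2b} |u|²_g dμ_g`. -/
def IsL2 {k l : ℕ} (a b : ℝ) (u : TensorField n k l) : Prop :=
  (∀ I, AEStronglyMeasurable (fun p => u p I) (volume.restrict D.Ω)) ∧
    IntegrableOn (fun p => weight D G a b p * G.tensorInner p (u p) (u p)) D.Ω

variable {D G k l a b}

theorem measurable_pairing {u v : TensorField n k l}
    (hu : ∀ I, AEStronglyMeasurable (fun p => u p I) (volume.restrict D.Ω))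
    (hv : ∀ I, AEStronglyMeasurable (fun p => v p I) (volume.restrict D.Ω)) :
    AEStronglyMeasurable (fun p => weight D G a b p * G.tensorInner p (u p) (v p))
      (volume.restrict D.Ω) := by
  refine (tame_weight D G a b).1.mul ?_
  simp only [AEMetric.tensorInner]
  refine Finset.aestronglyMeasurable_fun_sum _ fun I _ =>
    Finset.aestronglyMeasurable_fun_sum _ fun J _ => ?_
  exact ((G.tame_gram D.isOpen k l I J).1.mul (hu I)).mul (hv J)

theorem IsL2.integrableOn {u v : TensorField n k l} (hu : IsL2 D G a b u) (hv : IsL2 D G a b v) :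
    IntegrableOn (fun p => weight D G a b p * G.tensorInner p (u p) (v p)) D.Ω := by
  refine Integrable.mono' (hu.2.add hv.2) (measurable_pairing hu.1 hv.1) ?_
  refine (ae_restrict_iff' D.isOpen.measurableSet).2 (Eventually.of_forall fun p hp => ?_)
  have hw := weight_nonneg D G a b hp
  rw [Real.norm_eq_abs, abs_mul, abs_of_nonneg hw, Pi.add_apply, ← mul_add]
  refine mul_le_mul_of_nonneg_left ?_ hw
  have := G.two_mul_abs_tensorInner_le p (u p) (v p)
  linarith [abs_nonneg (G.tensorInner p (u p) (v p))]

theorem IsL2.smul {u : TensorField n k l} (c : ℝ) (hu : IsL2 D G a b u) :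
    IsL2 D G a b (c • u) := by
  refine ⟨fun I => (hu.1 I).const_mul c, ?_⟩
  refine (hu.2.const_mul (c * c)).congr (Eventually.of_forall fun p => ?_)
  simp only [Pi.smul_apply, G.tensorInner_smul_left, G.tensorInner_comm p (u p) (c • u p)]
  ring

theorem IsL2.add {u v : TensorField n k l} (hu : IsL2 D G a b u) (hv : IsL2 D G a b v) :
    IsL2 D G a b (u + v) := by
  refine ⟨fun I => (hu.1 I).add (hv.1 I), ?_⟩
  refine ((hu.2.add hv.2).add ((hu.integrableOn hv).const_mul 2)).congr
    (Eventually.of_forall fun p => ?_)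
  simp only [Pi.add_apply, G.tensorInner_add_left, G.tensorInner_comm p _ (u p + v p)]
  rw [G.tensorInner_comm p (v p) (u p)]
  ring

theorem IsL2.zero : IsL2 D G a b (0 : TensorField n k l) := by
  refine ⟨fun I => aestronglyMeasurable_const, ?_⟩
  simp [AEMetric.tensorInner]

theorem IsL2.of_tame {u : TensorField n k l} {K : Set (Eucl n)} (hK : IsCompact K)
    (hKΩ : K ⊆ D.Ω) (h0 : ∀ p, p ∉ K → u p = 0) (hu : ∀ I, Tame D.Ω fun p => u p I) :
    IsL2 D G a b u := by
  refine ⟨fun I => (hu I).1, ?_⟩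
  refine ((tame_weight D G a b).mul (G.tame_tensorInner D.isOpen hu hu)).integrableOn hK hKΩ
    fun p hp => ?_
  simp [h0 p hp, AEMetric.tensorInner]

variable (D G k l a b)

/-- The space of tensor fields of type `(k, l)` on `Ω`, square integrable with respect to
`x^{2a} r^{2b} dμ_g`, before identification of fields which agree almost everywhere. -/
def preL2 : Submodule ℝ (TensorField n k l) where
  carrier := {u | IsL2 D G a b u}
  add_mem' hu hv := IsL2.add hu hv
  zero_mem' := IsL2.zero
  smul_mem' c _ hu := IsL2.smul c hu

/-- `preL2`, as a type carrying its scalar product `∫_Ω x^{2a} r^{2b} ⟨u, v⟩_g dμ_g`. -/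
def PreL2 : Type := preL2 D G k l a b

instance : AddCommGroup (PreL2 D G k l a b) := inferInstanceAs (AddCommGroup (preL2 D G k l a b))
instance : Module ℝ (PreL2 D G k l a b) := inferInstanceAs (Module ℝ (preL2 D G k l a b))

instance : PreInnerProductSpace.Core ℝ (PreL2 D G k l a b) where
  inner u v := ∫ p in D.Ω, weight D G a b p * G.tensorInner p (u.1 p) (v.1 p)
  conj_inner_symm u v := by
    simp only [conj_trivial, G.tensorInner_comm _ (v.1 _) (u.1 _)]
  re_inner_nonneg u := setIntegral_nonneg D.isOpen.measurableSet fun p hp =>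
    mul_nonneg (weight_nonneg D G a b hp) (G.tensorInner_self_nonneg p _)
  add_left u v w := by
    rw [← integral_add (u.2.integrableOn w.2) (v.2.integrableOn w.2)]
    refine integral_congr_ae (Eventually.of_forall fun p => ?_)
    exact (congrArg _ (G.tensorInner_add_left p (u.1 p) (v.1 p) (w.1 p))).trans (mul_add _ _ _)
  smul_left u v c := by
    rw [conj_trivial, ← integral_const_mul]
    refine integral_congr_ae (Eventually.of_forall fun p => ?_)
    exact (congrArg _ (G.tensorInner_smul_left p c (u.1 p) (v.1 p))).trans (mul_left_comm _ _ _)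

instance : SeminormedAddCommGroup (PreL2 D G k l a b) :=
  InnerProductSpace.Core.toSeminormedAddCommGroup (𝕜 := ℝ)

instance : InnerProductSpace ℝ (PreL2 D G k l a b) := .ofCore _

theorem PreL2.norm_sq_eq (u : PreL2 D G k l a b) :
    ‖u‖ ^ 2 = ∫ p in D.Ω, weight D G a b p * G.tensorInner p (u.1 p) (u.1 p) :=
  (real_inner_self_eq_norm_sq u).symm

/-- The Hilbert space `L²(Ω, x^{2a} r^{2b} dμ_g)` of tensor fields of type `(k, l)`. -/
abbrev L2 : Type := UniformSpace.Completion (PreL2 D G k l a b)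

end L2

/-! ### The completed weighted space -/

section H

variable {n : ℕ} (D : ScaleInvariantDomain n) (G : AEMetric n) (k l : ℕ) (σ μ : ℝ)

/-- The `C²` tensor fields of type `(k, l)` which are compactly supported in `Ω`. -/
def testFields : Submodule ℝ (TensorField n k l) where
  carrier := {u | ContDiff ℝ 2 u ∧ HasCompactSupport u ∧ tsupport u ⊆ D.Ω}
  add_mem' {u v} hu hv := by
    have h : tsupport (u + v) ⊆ tsupport u ∪ tsupport v := tsupport_add u v
    exact ⟨hu.1.add hv.1, hu.2.1.add hv.2.1, h.trans (union_subset hu.2.2 hv.2.2)⟩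
  zero_mem' := by
    refine ⟨contDiff_const, HasCompactSupport.zero, ?_⟩
    rw [tsupport_eq_empty_iff.2 rfl]
    exact empty_subset _
  smul_mem' c u hu := by
    have h : tsupport (c • u) ⊆ tsupport u :=
      closure_mono (Function.support_const_smul_subset c u)
    exact ⟨hu.1.const_smul c, hu.2.1.mono' (subset_closure.trans h), h.trans hu.2.2⟩

variable {D G k l}

theorem contDiff_component {u : TensorField n k l} (hu : u ∈ testFields D k l) (I : TIdx n k l) :
    ContDiff ℝ 2 fun p => u p I :=
  contDiff_pi.1 hu.1 I

theorem isL2_of_mem {u : TensorField n k l} (hu : u ∈ testFields D k l) (a b : ℝ) :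
    IsL2 D G a b u :=
  .of_tame hu.2.1 hu.2.2 (fun _ hp => image_eq_zero_of_notMem_tsupport hp)
    fun I => .of_continuous D.isOpen (contDiff_component hu I).continuous

theorem isL2_nabla_of_mem {u : TensorField n k l} (hu : u ∈ testFields D k l) (a b : ℝ) :
    IsL2 D G a b (G.nabla u) := by
  have hc : ∀ I, Tame D.Ω fun p => u p I := fun I =>
    .of_continuous D.isOpen (contDiff_component hu I).continuous
  refine .of_tame hu.2.1 hu.2.2 (fun p hp => ?_) fun I => ?_
  · have h0 : u =ᶠ[𝓝 p] 0 := notMem_tsupport_iff_eventuallyEq.1 hp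
    have h1 : ∀ i I, pderiv i (fun q => u q I) p = 0 := fun i I => by
      have : (fun q => u q I) =ᶠ[𝓝 p] fun _ => 0 := h0.mono fun q hq => by simp [hq]
      simp [pderiv, this.fderiv_eq]
    funext I
    simp [AEMetric.nabla, h1, h0.eq_of_nhds]
  · refine ((Tame.of_continuous D.isOpen ?_).add (.sum _ fun s => .sum _ fun c =>
      (G.tame_christoffel D.isOpen _ _ _).mul (hc _))).sub (.sum _ fun t => .sum _ fun c =>
      (G.tame_christoffel D.isOpen _ _ _).mul (hc _))
    exact ((contDiff_component hu _).continuous_fderiv (by norm_num)).clm_apply continuous_const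

theorem pderiv_add {f h : Eucl n → ℝ} (hf : ContDiff ℝ 2 f) (hh : ContDiff ℝ 2 h) (i : Fin n)
    (p : Eucl n) : pderiv i (fun q => f q + h q) p = pderiv i f p + pderiv i h p := by
  have := fderiv_fun_add (hf.differentiable (by norm_num) p) (hh.differentiable (by norm_num) p)
  simp [pderiv, this]

theorem pderiv_const_mul {f : Eucl n → ℝ} (hf : ContDiff ℝ 2 f) (c : ℝ) (i : Fin n)
    (p : Eucl n) : pderiv i (fun q => c * f q) p = c * pderiv i f p := by
  have := fderiv_const_mul (hf.differentiable (by norm_num) p) c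
  simp [pderiv, this]

variable (D G k l)

/-- `testFields`, as a type carrying the norm
`‖u‖² = ∫_Ω x^{2σ} r^{2μ} |u|² dμ_g + ∫_Ω x^{2σ+2} r^{2μ} |∇u|² dμ_g`, see `TestField.norm_sq_eq`. -/
def TestField {n : ℕ} (D : ScaleInvariantDomain n) (_G : AEMetric n) (k l : ℕ) (_σ _μ : ℝ) :
    Type :=
  testFields D k l

instance : AddCommGroup (TestField D G k l σ μ) := inferInstanceAs (AddCommGroup (testFields D k l))
instance : Module ℝ (TestField D G k l σ μ) := inferInstanceAs (Module ℝ (testFields D k l))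

/-- `u ↦ (u, ∇u)`, from test fields to the product of the spaces with the weights
`x^{2σ} r^{2μ}` and `x^{2σ+2} r^{2μ}`. -/
def graphMap : TestField D G k l σ μ →ₗ[ℝ]
    WithLp 2 (PreL2 D G k l σ μ × PreL2 D G k (l + 1) (σ + 1) μ) where
  toFun u := WithLp.toLp 2 (⟨u.1, isL2_of_mem u.2 _ _⟩, ⟨G.nabla u.1, isL2_nabla_of_mem u.2 _ _⟩)
  map_add' u v := by
    refine congrArg (WithLp.toLp 2) (Prod.ext rfl (Subtype.ext ?_))
    funext p I
    have h := pderiv_add (contDiff_component u.2 (I.1, Fin.tail I.2))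
      (contDiff_component v.2 (I.1, Fin.tail I.2)) (I.2 0) p
    change G.nabla (u.1 + v.1) p I = G.nabla u.1 p I + G.nabla v.1 p I
    simp only [AEMetric.nabla, Pi.add_apply, mul_add, Finset.sum_add_distrib, h]
    ring
  map_smul' c u := by
    refine congrArg (WithLp.toLp 2) (Prod.ext rfl (Subtype.ext ?_))
    funext p I
    have h := pderiv_const_mul (contDiff_component u.2 (I.1, Fin.tail I.2)) c (I.2 0) p
    change G.nabla (c • u.1) p I = c * G.nabla u.1 p I
    simp only [AEMetric.nabla, Pi.smul_apply, smul_eq_mul, h, mul_left_comm _ c,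
      ← Finset.mul_sum, mul_add, mul_sub]

instance : SeminormedAddCommGroup (TestField D G k l σ μ) :=
  SeminormedAddCommGroup.induced _ _ (graphMap D G k l σ μ)

instance : NormedSpace ℝ (TestField D G k l σ μ) :=
  NormedSpace.induced ℝ _ _ (graphMap D G k l σ μ)

theorem TestField.norm_sq_eq (u : TestField D G k l σ μ) :
    ‖u‖ ^ 2 = (∫ p in D.Ω, weight D G σ μ p * G.tensorInner p (u.1 p) (u.1 p)) +
      ∫ p in D.Ω, weight D G (σ + 1) μ p *
        G.tensorInner p (G.nabla u.1 p) (G.nabla u.1 p) := by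
  have h := WithLp.prod_norm_sq_eq_of_L2 (graphMap D G k l σ μ u)
  rw [PreL2.norm_sq_eq, PreL2.norm_sq_eq] at h
  exact h

/-- The completion of the `C²` compactly supported tensor fields of type `(k, l)` in `Ω` with
respect to the norm `‖u‖² = ∫_Ω x^{2σ} r^{2μ} |u|² + ∫_Ω x^{2σ+2} r^{2μ} |∇u|²`. -/
abbrev H : Type := UniformSpace.Completion (TestField D G k l σ μ)

/-- The map `H → L²(Ω, x^{2σ} r^{2μ} dμ_g)` which extends `u ↦ u` by continuity. -/
def toL2 : H D G k l σ μ →L[ℝ] L2 D G k l σ μ :=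
  ContinuousLinearMap.completion <| LinearMap.mkContinuous
    ((WithLp.fstₗ 2 ℝ _ _).comp (graphMap D G k l σ μ)) 1 fun u => by
      rw [one_mul]; exact WithLp.norm_fst_le _ _

/-- The covariant derivative `∇ : H → L²(Ω, x^{2σ+2} r^{2μ} dμ_g)`, which extends `u ↦ ∇u` by
continuity. -/
def nablaH : H D G k l σ μ →L[ℝ] L2 D G k (l + 1) (σ + 1) μ :=
  ContinuousLinearMap.completion <| LinearMap.mkContinuous
    ((WithLp.sndₗ 2 ℝ _ _).comp (graphMap D G k l σ μ)) 1 fun u => by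
      rw [one_mul]; exact WithLp.norm_snd_le _ _

/-- The space of parallel fields, `{u ∈ H : ∇u = 0}`. -/
def parallelFields : Submodule ℝ (H D G k l σ μ) :=
  LinearMap.ker (nablaH D G k l σ μ).toLinearMap

end H

end

end WeightedPoincare

namespace WeightedPoincare

/-! ### Geometry of scale-invariant domains -/

/-! The inequality follows from an a priori estimate with a finite-rank error: for every `u` in the
completion, `‖u‖²` in the weighted `L²` norm is at most `C (‖∇u‖² + ‖L u‖²)`, where `L` takes values
in a finite-dimensional space (`exists_finite_rank_estimate`). Then `u ↦ (∇u, L u)` is bounded below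
on the complete space `H`. If the inequality failed on `X`, unit vectors of `X` with `∇u → 0` would
exist; along a subsequence `L u` converges, so the vectors themselves converge, to a parallel unit
vector of the closed subspace `X`. Transversality forbids this (`exists_bound_of_finite_rank`).

The a priori estimate rests on a Hardy inequality for scalar functions, applied to each component.
One needs a vector field `V` of size `O(x · x^{2σ} r^{2μ})` whose Euclidean divergence is at least
`c x^{2σ} r^{2μ}` outside a compact subset of `Ω`; integrating `f² div V` by parts and using Young's
inequality gives the estimate up to an integral of `f²` over that compact set (`hardy_inequality`).
Here `V` combines `x^{2σ+1} r^{2μ} ∇x`, whose divergence has leading term `(2σ+1) x^{2σ} r^{2μ}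
|∇x|²` near the boundary, with a radial field, whose divergence at infinity is `(2σ+2μ+n) x^{2σ+1}
r^{2μ-1}` by Euler's identity. The two conditions on `σ` and `μ` say that these coefficients do not
vanish (`exists_hardyField`). Homogeneity reduces all uniform bounds at infinity to compactness.

To return from partial to covariant derivatives, note that `g` is uniformly equivalent to the
Euclidean metric, and that `x² |Γ|²` is arbitrarily small outside compact subsets of `Ω`: near the
boundary at bounded distance because `x` is small and `Γ` is bounded, at infinity because `x =
O(|p|)` and `Γ = o(1/|p|)` (`exists_core_christoffel_le`). The Christoffel terms are thus absorbed,
up to another compact remainder (`exists_local_estimate`).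

Compact remainders are treated by a quantitative form of Rellich's theorem: on balls of small radius
a function is close to its mean, with an error that is a small multiple of its Dirichlet energy. So
`∫_K f²` is at most `ε` times the energy plus a multiple of the squares of finitely many integrals
over balls (`exists_finset_integral_sq_le`, `exists_functionals`). These integrals are the
components of `L`. -/

theorem span_setOf_pos_eq_top {E : Type*} [NormedAddCommGroup E] [NormedSpace ℝ E]
    {L : E →L[ℝ] ℝ} (hL : L ≠ 0) : Submodule.span ℝ {v | 0 < L v} = ⊤ := by
  obtain ⟨v, hv⟩ : ∃ v, 0 < L v := by
    obtain ⟨v, hv⟩ := DFunLike.ne_iff.1 hL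
    rcases lt_or_gt_of_ne hv with h | h
    · exact ⟨-v, by simpa using h⟩
    · exact ⟨v, h⟩
  refine Submodule.eq_top_iff'.2 fun w => ?_
  -- The coefficient is chosen so that `L` takes the value `1` on this vector; `w` is then a
  -- difference of two elements of the span.
  have h1 : w + ((1 - L w) / L v) • v ∈ Submodule.span ℝ {v | 0 < L v} := by
    refine Submodule.subset_span ?_
    simp [hv.ne']
  have h2 := Submodule.smul_mem _ ((1 - L w) / L v)
    (Submodule.subset_span (R := ℝ) (s := {v | 0 < L v}) hv)
  simpa using Submodule.sub_mem _ h1 h2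

/-- At a boundary point every direction in which the local defining function `f` increases enters
`Ω`, hence is tangent to the closure, and these directions form an open half-space, which spans.
This makes derivatives within the closure well behaved, so that derivatives of `x` and `r` extend
continuously to the boundary. -/
theorem HasSmoothBoundary.uniqueDiffOn_closure {n : ℕ} {Ω : Set (Eucl n)} (hΩ : IsOpen Ω)
    (h : HasSmoothBoundary Ω) : UniqueDiffOn ℝ (closure Ω) := by
  intro p hp
  by_cases hpΩ : p ∈ Ω
  · exact (hΩ.uniqueDiffWithinAt (𝕜 := ℝ) hpΩ).mono subset_closure
  obtain ⟨U, hU, hpU, f, hf, hfp, hf', hΩU⟩ := h p (by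
    rw [hΩ.frontier_eq]; exact ⟨hp, hpΩ⟩)
  refine ⟨?_, subset_closure hp⟩
  have hsub : {v | 0 < fderiv ℝ f p v} ⊆ tangentConeAt ℝ (closure Ω) p := by
    intro v hv
    refine mem_tangentConeAt_of_add_smul_mem (l := 𝓝[>] (0 : ℝ)) (c := id)
      (nhdsWithin_mono _ fun t ht => ne_of_gt ht) ?_
    have hd : DifferentiableAt ℝ f p :=
      (hf.differentiableOn (by simp)).differentiableAt (hU.mem_nhds hpU)
    have hline : HasDerivAt (fun t : ℝ => f (p + t • v)) (fderiv ℝ f p v) 0 := by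
      have hl : HasDerivAt (fun t : ℝ => p + t • v) v 0 := by
        simpa using ((hasDerivAt_id (0 : ℝ)).smul_const v).const_add p
      have hd' : HasFDerivAt f (fderiv ℝ f p) (p + (0 : ℝ) • v) := by
        simpa using hd.hasFDerivAt
      exact hd'.comp_hasDerivAt (0 : ℝ) hl
    have hpos : ∀ᶠ t in 𝓝[>] (0 : ℝ), 0 < f (p + t • v) := by
      have h1 := hasDerivAt_iff_tendsto_slope.1 hline
      have h2 := (h1.mono_left (nhdsWithin_mono _ fun t (ht : t ∈ Ioi (0 : ℝ)) =>
        ne_of_gt ht)).eventually (lt_mem_nhds hv)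
      filter_upwards [h2, self_mem_nhdsWithin] with t ht ht0
      have ht0' : (0 : ℝ) < t := ht0
      rw [slope_def_field] at ht
      simp only [zero_smul, add_zero, hfp, sub_zero] at ht
      exact (div_pos_iff_of_pos_right ht0').1 ht
    have hmem : ∀ᶠ t in 𝓝[>] (0 : ℝ), p + t • v ∈ U := by
      have hc : ContinuousAt (fun t : ℝ => p + t • v) 0 := by fun_prop
      exact (hc.eventually (hU.mem_nhds (by simpa using hpU))).filter_mono nhdsWithin_le_nhds
    filter_upwards [hpos, hmem] with t h1 h2
    have : p + t • v ∈ Ω ∩ U := by rw [hΩU]; exact ⟨h2, h1⟩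
    exact subset_closure this.1
  have htop := (span_setOf_pos_eq_top hf').symm.le.trans (Submodule.span_mono (R := ℝ) hsub)
  rw [top_le_iff.1 htop]
  exact dense_univ

/-- The factor `c` is left free because the functions of interest have degree one (`c = t`) while
their first derivatives have degree zero (`c = 1`). -/
theorem pderiv_smul_of_eventually {n : ℕ} {f : Eucl n → ℝ} {t c : ℝ} {p : Eucl n}
    (h : ∀ᶠ q in 𝓝 p, f (t • q) = c * f q) (i : Fin n) :
    t * pderiv i f (t • p) = c * pderiv i f p := by
  have h1 : (fun q => f (t • q)) =ᶠ[𝓝 p] fun q => c • f q := h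
  have h2 := congrArg (fun L => L (EuclideanSpace.single i (1 : ℝ))) (h1.fderiv_eq (𝕜 := ℝ))
  have h3 := congrArg (fun L => L (EuclideanSpace.single i (1 : ℝ)))
    (fderiv_comp_smul (𝕜 := ℝ) (f := f) (x := p) t)
  have h4 := congrArg (fun L => L (EuclideanSpace.single i (1 : ℝ)))
    (congrFun (fderiv_const_smul_field (𝕜 := ℝ) (f := f) c) p)
  simp only [smul_apply, smul_eq_mul] at h3 h4
  exact h3.symm.trans (h2.trans h4)

theorem sum_mul_apply_single {n : ℕ} (L : Eucl n →L[ℝ] ℝ) (v : Eucl n) :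
    ∑ i, v i * L (EuclideanSpace.single i 1) = L v := by
  conv_rhs => rw [← (EuclideanSpace.basisFun (Fin n) ℝ).sum_repr v]
  simp [map_sum]

/-- Euler's identity for positively homogeneous functions of degree one. -/
theorem euler_identity {n : ℕ} {f : Eucl n → ℝ} {p : Eucl n} (hf : DifferentiableAt ℝ f p)
    (h : ∀ t : ℝ, 1 ≤ t → f (t • p) = t * f p) : ∑ i, p i * pderiv i f p = f p := by
  rw [show ∑ i, p i * pderiv i f p = fderiv ℝ f p p from sum_mul_apply_single _ _]
  have hl : HasDerivAt (fun t : ℝ => t • p) p 1 := by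
    simpa using (hasDerivAt_id (1 : ℝ)).smul_const p
  have hf' : HasFDerivAt f (fderiv ℝ f p) ((1 : ℝ) • p) := by simpa using hf.hasFDerivAt
  have h1 : HasDerivWithinAt (fun t : ℝ => f (t • p)) (fderiv ℝ f p p) (Ici 1) 1 :=
    (hf'.comp_hasDerivAt (1 : ℝ) hl).hasDerivWithinAt
  have h2 : HasDerivWithinAt (fun t : ℝ => f (t • p)) (f p) (Ici 1) 1 := by
    have h3 : HasDerivWithinAt (fun t : ℝ => t * f p) (f p) (Ici 1) 1 := by
      simpa using ((hasDerivAt_id (1 : ℝ)).mul_const (f p)).hasDerivWithinAt (s := Ici 1)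
    exact h3.congr (fun t ht => h t ht) (h 1 le_rfl)
  -- Homogeneity is known only for `t ≥ 1`, so one-sided derivatives at `1` are compared.
  exact (uniqueDiffOn_Ici (1 : ℝ) 1 self_mem_Ici).eq_deriv _ h1 h2

/-! ### Homogeneity at large distances -/

namespace ScaleInvariantDomain

variable {n : ℕ} (D : ScaleInvariantDomain n)

theorem R₀_pos : 0 < D.R₀ := zero_lt_one.trans_le D.one_le_R₀

theorem smul_mem {p : Eucl n} (hp : p ∈ D.Ω) (hpR : D.R₀ ≤ ‖p‖) {t : ℝ} (ht : 1 ≤ t) :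
    t • p ∈ D.Ω \ Metric.ball 0 D.R₀ := by
  have h : p ∈ D.Ω \ Metric.ball 0 D.R₀ := ⟨hp, by simpa using hpR⟩
  rw [D.scaling] at h ⊢
  obtain ⟨s, hs, q, hq, rfl⟩ := h
  exact ⟨t * s, one_le_mul_of_one_le_of_one_le ht hs, q, hq, by rw [smul_smul]⟩

theorem x_smul {p : Eucl n} (hp : p ∈ D.Ω) (hpR : D.R₀ ≤ ‖p‖) {t : ℝ} (ht : 1 ≤ t) :
    D.x (t • p) = t * D.x p :=
  D.x_homogeneous t p ht ⟨hp, by simpa using hpR⟩ (D.smul_mem hp hpR ht)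

theorem r_eq {p : Eucl n} (hp : p ∈ D.Ω) (hpR : D.R₀ ≤ ‖p‖) : D.r p = ‖p‖ :=
  D.r_eq_norm p ⟨hp, by simpa using hpR⟩

theorem r_smul {p : Eucl n} (hp : p ∈ D.Ω) (hpR : D.R₀ ≤ ‖p‖) {t : ℝ} (ht : 1 ≤ t) :
    D.r (t • p) = t * D.r p := by
  rw [D.r_eq hp hpR, D.r_eq_norm _ (D.smul_mem hp hpR ht), norm_smul, Real.norm_eq_abs,
    abs_of_pos (zero_lt_one.trans_le ht)]

/-- The reference sphere has radius `2 R₀` rather than `R₀` so that `q` lies in the open region `‖q‖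
> R₀`, where homogeneity holds in a neighbourhood and can be differentiated. -/
theorem exists_scale {p : Eucl n} (hp : p ∈ D.Ω) (hpR : 2 * D.R₀ < ‖p‖) :
    ∃ t : ℝ, 1 ≤ t ∧ ∃ q ∈ D.Ω, ‖q‖ = 2 * D.R₀ ∧ p = t • q := by
  have hR := D.R₀_pos
  have h : p ∈ D.Ω \ Metric.ball 0 D.R₀ := ⟨hp, by simp; linarith⟩
  rw [D.scaling] at h
  obtain ⟨s, hs, q, ⟨hqΩ, hq⟩, rfl⟩ := h
  have hqn : ‖q‖ = D.R₀ := by simpa using hq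
  rw [norm_smul, hqn, Real.norm_eq_abs, abs_of_pos (by linarith)] at hpR
  have hs2 : 2 < s := lt_of_mul_lt_mul_right hpR hR.le
  refine ⟨s / 2, by linarith, (2 : ℝ) • q, (D.smul_mem hqΩ hqn.ge one_le_two).1, ?_, ?_⟩
  · rw [norm_smul, hqn]; simp
  · rw [smul_smul]; congr 1; ring

/-- The part of the domain at distance greater than `R₀`, where everything is homogeneous. -/
theorem eventually_far {p : Eucl n} (hp : p ∈ D.Ω) (hpR : D.R₀ < ‖p‖) :
    ∀ᶠ q in 𝓝 p, q ∈ D.Ω ∧ D.R₀ < ‖q‖ :=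
  (D.isOpen.eventually_mem hp).and (continuous_norm.continuousAt.eventually (lt_mem_nhds hpR))

theorem pderiv_x_smul {p : Eucl n} (hp : p ∈ D.Ω) (hpR : D.R₀ < ‖p‖) {t : ℝ} (ht : 1 ≤ t)
    (i : Fin n) : pderiv i D.x (t • p) = pderiv i D.x p :=
  mul_left_cancel₀ (zero_lt_one.trans_le ht).ne' <| pderiv_smul_of_eventually
    ((D.eventually_far hp hpR).mono fun _ hq => D.x_smul hq.1 hq.2.le ht) i

theorem pderiv_r_smul {p : Eucl n} (hp : p ∈ D.Ω) (hpR : D.R₀ < ‖p‖) {t : ℝ} (ht : 1 ≤ t)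
    (i : Fin n) : pderiv i D.r (t • p) = pderiv i D.r p :=
  mul_left_cancel₀ (zero_lt_one.trans_le ht).ne' <| pderiv_smul_of_eventually
    ((D.eventually_far hp hpR).mono fun _ hq => D.r_smul hq.1 hq.2.le ht) i

theorem pderiv_pderiv_x_smul {p : Eucl n} (hp : p ∈ D.Ω) (hpR : D.R₀ < ‖p‖) {t : ℝ}
    (ht : 1 ≤ t) (i j : Fin n) :
    t * pderiv j (pderiv i D.x) (t • p) = pderiv j (pderiv i D.x) p := by
  have := pderiv_smul_of_eventually (f := pderiv i D.x) (c := 1) (t := t) (p := p)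
    ((D.eventually_far hp hpR).mono fun _ hq => by
      rw [D.pderiv_x_smul hq.1 hq.2 ht, one_mul]) j
  rwa [one_mul] at this

/-! ### Derivatives up to the boundary, and bounds by compactness -/

theorem uniqueDiffOn : UniqueDiffOn ℝ (closure D.Ω) :=
  D.smoothBoundary.uniqueDiffOn_closure D.isOpen

theorem closure_mem_nhds {p : Eucl n} (hp : p ∈ D.Ω) : closure D.Ω ∈ 𝓝 p :=
  mem_of_superset (D.isOpen.mem_nhds hp) subset_closure

theorem pderiv_eq_within {f : Eucl n → ℝ} {p : Eucl n} (hp : p ∈ D.Ω) (i : Fin n) :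
    pderiv i f p = fderivWithin ℝ f (closure D.Ω) p (EuclideanSpace.single i 1) := by
  rw [fderivWithin_of_mem_nhds (D.closure_mem_nhds hp)]
  rfl

theorem contDiffOn_pderivWithin {f : Eucl n → ℝ} (hf : ContDiffOn ℝ ∞ f (closure D.Ω))
    (i : Fin n) :
    ContDiffOn ℝ ∞ (fun p => fderivWithin ℝ f (closure D.Ω) p (EuclideanSpace.single i 1))
      (closure D.Ω) :=
  (hf.fderivWithin D.uniqueDiffOn (by simp)).clm_apply contDiffOn_const

theorem pderiv_pderiv_eq_within {f : Eucl n → ℝ} {p : Eucl n} (hp : p ∈ D.Ω) (i j : Fin n) :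
    pderiv j (pderiv i f) p = fderivWithin ℝ
      (fun p => fderivWithin ℝ f (closure D.Ω) p (EuclideanSpace.single i 1))
      (closure D.Ω) p (EuclideanSpace.single j 1) := by
  rw [← D.pderiv_eq_within hp]
  have : pderiv i f =ᶠ[𝓝 p]
      fun p => fderivWithin ℝ f (closure D.Ω) p (EuclideanSpace.single i 1) :=
    (D.isOpen.eventually_mem hp).mono fun q hq => D.pderiv_eq_within hq i
  rw [pderiv, pderiv, this.fderiv_eq]

theorem contDiffOn_x : ContDiffOn ℝ ∞ D.x D.Ω := D.isDefining.smooth.mono subset_closure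

theorem contDiffOn_r : ContDiffOn ℝ ∞ D.r D.Ω := D.r_smooth.mono subset_closure

theorem exists_le_r_closure : ∃ c : ℝ, 0 < c ∧ ∀ p ∈ closure D.Ω, c ≤ D.r p := by
  obtain ⟨c, hc, h⟩ := D.r_bounded_below
  refine ⟨c, hc, fun p hp => ?_⟩
  have h1 : D.r p ∈ closure (D.r '' D.Ω) :=
    D.r_smooth.continuousOn.image_closure (mem_image_of_mem _ hp)
  exact closure_minimal (by rintro _ ⟨q, hq, rfl⟩; exact h q hq) isClosed_Ici h1

theorem r_pos_closure {p : Eucl n} (hp : p ∈ closure D.Ω) : 0 < D.r p := by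
  obtain ⟨c, hc, h⟩ := D.exists_le_r_closure
  exact hc.trans_le (h p hp)

theorem isCompact_near (ρ : ℝ) : IsCompact (closure D.Ω ∩ Metric.closedBall 0 ρ) :=
  (isCompact_closedBall _ _).inter_left isClosed_closure

/-- Values of a scale-invariant function are attained near the origin. -/
theorem exists_near {F : Eucl n → ℝ}
    (hF : ∀ p ∈ D.Ω, D.R₀ < ‖p‖ → ∀ t : ℝ, 1 ≤ t → F (t • p) = F p) {p : Eucl n}
    (hp : p ∈ D.Ω) : ∃ q ∈ D.Ω ∩ Metric.closedBall 0 (2 * D.R₀), F p = F q := by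
  have hR := D.R₀_pos
  rcases le_or_gt ‖p‖ (2 * D.R₀) with h | h
  · exact ⟨p, ⟨hp, by simpa using h⟩, rfl⟩
  · obtain ⟨t, ht, q, hq, hqn, rfl⟩ := D.exists_scale hp h
    exact ⟨q, ⟨hq, by simp [hqn]⟩, hF q hq (by linarith) t ht⟩

/-- A function of degree zero takes all its values within distance `2 R₀` of the origin, where the
closure of `Ω` is compact. The function `F'` supplies the continuous extension to the boundary, in
practice a derivative within the closure, while `F` is the honest derivative in `Ω`. -/
theorem exists_bound {F F' : Eucl n → ℝ} (hF' : ContinuousOn F' (closure D.Ω))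
    (hFF' : ∀ p ∈ D.Ω, F p = F' p)
    (hF : ∀ p ∈ D.Ω, D.R₀ < ‖p‖ → ∀ t : ℝ, 1 ≤ t → F (t • p) = F p) :
    ∃ C : ℝ, 0 ≤ C ∧ ∀ p ∈ D.Ω, |F p| ≤ C := by
  obtain ⟨C, hC⟩ := (D.isCompact_near (2 * D.R₀)).exists_bound_of_continuousOn
    (hF'.mono inter_subset_left)
  refine ⟨max C 0, le_max_right _ _, fun p hp => ?_⟩
  obtain ⟨q, hq, hpq⟩ := D.exists_near hF hp
  rw [hpq, hFF' q hq.1]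
  exact (hC q ⟨subset_closure hq.1, hq.2⟩).trans (le_max_left _ _)

theorem exists_lower_bound {F F' : Eucl n → ℝ} (hF' : ContinuousOn F' (closure D.Ω))
    (hFF' : ∀ p ∈ D.Ω, F p = F' p) (hpos : ∀ p ∈ closure D.Ω, 0 < F' p)
    (hF : ∀ p ∈ D.Ω, D.R₀ < ‖p‖ → ∀ t : ℝ, 1 ≤ t → F (t • p) = F p) :
    ∃ c : ℝ, 0 < c ∧ ∀ p ∈ D.Ω, c ≤ F p := by
  obtain ⟨C, hC⟩ := (D.isCompact_near (2 * D.R₀)).exists_bound_of_continuousOn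
    ((hF'.inv₀ fun p hp => (hpos p hp).ne').mono inter_subset_left)
  refine ⟨(max C 1)⁻¹, by positivity, fun p hp => ?_⟩
  obtain ⟨q, hq, hpq⟩ := D.exists_near hF hp
  have h := hpos q (subset_closure hq.1)
  have h1 := (le_abs_self _).trans (hC q ⟨subset_closure hq.1, hq.2⟩)
  rw [hpq, hFF' q hq.1]
  exact inv_le_of_inv_le₀ h (h1.trans (le_max_left _ _))

theorem pderiv_x_bounded (i : Fin n) : ∃ C : ℝ, 0 ≤ C ∧ ∀ p ∈ D.Ω, |pderiv i D.x p| ≤ C :=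
  D.exists_bound (D.contDiffOn_pderivWithin D.isDefining.smooth i).continuousOn
    (fun _ hp => D.pderiv_eq_within hp i) fun _ hp hpR _ ht => D.pderiv_x_smul hp hpR ht i

theorem pderiv_r_bounded (i : Fin n) : ∃ C : ℝ, 0 ≤ C ∧ ∀ p ∈ D.Ω, |pderiv i D.r p| ≤ C :=
  D.exists_bound (D.contDiffOn_pderivWithin D.r_smooth i).continuousOn
    (fun _ hp => D.pderiv_eq_within hp i) fun _ hp hpR _ ht => D.pderiv_r_smul hp hpR ht i

/-- Second derivatives of `x` have degree `-1` at large distances, and `r` restores degree zero. -/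
theorem r_mul_pderiv_pderiv_x_bounded (i j : Fin n) :
    ∃ C : ℝ, 0 ≤ C ∧ ∀ p ∈ D.Ω, |D.r p * pderiv j (pderiv i D.x) p| ≤ C := by
  refine D.exists_bound (D.r_smooth.continuousOn.mul (D.contDiffOn_pderivWithin
    (D.contDiffOn_pderivWithin D.isDefining.smooth i) j).continuousOn)
    (fun p hp => ?_) fun p hp hpR t ht => ?_
  · rw [D.pderiv_pderiv_eq_within hp i j]
    rfl
  · rw [← D.pderiv_pderiv_x_smul hp hpR ht, D.r_smul hp hpR.le ht]
    ring

theorem continuousOn_x_div_r : ContinuousOn (fun p => D.x p / D.r p) (closure D.Ω) :=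
  D.isDefining.smooth.continuousOn.div D.r_smooth.continuousOn
    fun _ hp => (D.r_pos_closure hp).ne'

theorem x_div_r_smul {p : Eucl n} (hp : p ∈ D.Ω) (hpR : D.R₀ < ‖p‖) {t : ℝ} (ht : 1 ≤ t) :
    D.x (t • p) / D.r (t • p) = D.x p / D.r p := by
  rw [D.x_smul hp hpR.le ht, D.r_smul hp hpR.le ht,
    mul_div_mul_left _ _ (zero_lt_one.trans_le ht).ne']

theorem x_div_r_bounded : ∃ C : ℝ, 0 ≤ C ∧ ∀ p ∈ D.Ω, |D.x p / D.r p| ≤ C :=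
  D.exists_bound D.continuousOn_x_div_r (fun _ _ => rfl)
    fun _ hp hpR _ ht => D.x_div_r_smul hp hpR ht

theorem x_div_r_pos {p : Eucl n} (hp : p ∈ D.Ω) : 0 < D.x p / D.r p :=
  div_pos (D.isDefining.pos p hp) (D.r_pos hp)

/-- On the boundary `dx ≠ 0`, inside `x / r > 0`, so the sum is positive on the whole closure; both
terms have degree zero. In particular `|∇x|²` is bounded below wherever `x / r` is small, uniformly
up to infinity. -/
theorem exists_le_sum_sq_add :
    ∃ c : ℝ, 0 < c ∧ ∀ p ∈ D.Ω, c ≤ ∑ i, pderiv i D.x p ^ 2 + D.x p / D.r p := by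
  refine D.exists_lower_bound (F' := fun p => ∑ i, (fderivWithin ℝ D.x (closure D.Ω) p
    (EuclideanSpace.single i 1)) ^ 2 + D.x p / D.r p)
    (.add (continuousOn_finsetSum Finset.univ fun i _ =>
      ContinuousOn.pow (D.contDiffOn_pderivWithin D.isDefining.smooth i).continuousOn 2)
      D.continuousOn_x_div_r) (fun p hp => ?_) (fun p hp => ?_) fun p hp hpR t ht => ?_
  · simp only [D.pderiv_eq_within hp]
  · by_cases hpΩ : p ∈ D.Ω
    · exact add_pos_of_nonneg_of_pos (Finset.sum_nonneg fun i _ => sq_nonneg _)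
        (D.x_div_r_pos hpΩ)
    have hfr : p ∈ frontier D.Ω := by rw [D.isOpen.frontier_eq]; exact ⟨hp, hpΩ⟩
    rw [D.isDefining.eq_zero p hfr, zero_div, add_zero]
    refine (Finset.sum_nonneg fun i _ => sq_nonneg _).lt_of_ne' fun h0 => ?_
    refine D.isDefining.fderiv_ne_zero p hfr (ContinuousLinearMap.ext fun v => ?_)
    rw [Finset.sum_eq_zero_iff_of_nonneg fun i _ => sq_nonneg _] at h0
    rw [← sum_mul_apply_single]
    refine Finset.sum_eq_zero fun i hi => ?_
    rw [pow_eq_zero_iff two_ne_zero |>.1 (h0 i hi), mul_zero]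
  · simp only [D.pderiv_x_smul hp hpR ht, D.x_div_r_smul hp hpR ht]

theorem sum_mul_pderiv_x {p : Eucl n} (hp : p ∈ D.Ω) (hpR : D.R₀ ≤ ‖p‖) :
    ∑ i, p i * pderiv i D.x p = D.x p :=
  euler_identity ((D.contDiffOn_x.differentiableOn (by simp)).differentiableAt
    (D.isOpen.mem_nhds hp)) fun _ ht => D.x_smul hp hpR ht

theorem sum_mul_pderiv_r {p : Eucl n} (hp : p ∈ D.Ω) (hpR : D.R₀ ≤ ‖p‖) :
    ∑ i, p i * pderiv i D.r p = D.r p :=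
  euler_identity ((D.contDiffOn_r.differentiableOn (by simp)).differentiableAt
    (D.isOpen.mem_nhds hp)) fun _ ht => D.r_smul hp hpR ht

/-- The part of `Ω` at bounded distance from the origin, and away from the boundary. -/
def core (ρ δ : ℝ) : Set (Eucl n) := {p ∈ D.Ω | ‖p‖ ≤ ρ ∧ δ ≤ D.x p / D.r p}

theorem core_subset (ρ δ : ℝ) : D.core ρ δ ⊆ D.Ω := fun _ hp => hp.1

/-- Since `x / r` is continuous on the closure and vanishes on the boundary, the condition `δ ≤ x /
r` with `δ > 0` keeps the set away from the boundary, and it is closed in `ℝⁿ`. -/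
theorem isCompact_core (ρ : ℝ) {δ : ℝ} (hδ : 0 < δ) : IsCompact (D.core ρ δ) := by
  have h : D.core ρ δ = (closure D.Ω ∩ (fun p => D.x p / D.r p) ⁻¹' Ici δ) ∩
      Metric.closedBall 0 ρ := by
    ext p
    simp only [core, mem_ofPred_eq, mem_inter_iff, mem_preimage, mem_Ici,
      mem_closedBall_zero_iff]
    refine ⟨fun h => ⟨⟨subset_closure h.1, h.2.2⟩, h.2.1⟩, fun h => ⟨?_, h.2, h.1.2⟩⟩
    by_contra hpΩ
    have hfr : p ∈ frontier D.Ω := by rw [D.isOpen.frontier_eq]; exact ⟨h.1.1, hpΩ⟩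
    have h2 := h.1.2
    rw [D.isDefining.eq_zero p hfr, zero_div] at h2
    linarith
  rw [h]
  exact (isCompact_closedBall _ _).inter_left
    (D.continuousOn_x_div_r.preimage_isClosed_of_isClosed isClosed_closure isClosed_Ici)

end ScaleInvariantDomain

/-! ### A vector field whose divergence controls the weight -/

theorem hasDerivAt_pderiv {n : ℕ} {f : Eucl n → ℝ} {p : Eucl n} (hf : DifferentiableAt ℝ f p)
    (i : Fin n) : HasDerivAt (fun t : ℝ => f (p + t • EuclideanSpace.single i (1 : ℝ)))
      (pderiv i f p) 0 := by
  have hl : HasDerivAt (fun t : ℝ => p + t • EuclideanSpace.single i (1 : ℝ))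
      (EuclideanSpace.single i 1) 0 := by
    simpa using ((hasDerivAt_id (0 : ℝ)).smul_const (EuclideanSpace.single i (1 : ℝ))).const_add p
  have hf' : HasFDerivAt f (fderiv ℝ f p) (p + (0 : ℝ) • EuclideanSpace.single i (1 : ℝ)) := by
    simpa using hf.hasFDerivAt
  exact hf'.comp_hasDerivAt (0 : ℝ) hl

theorem differentiableAt_coord {n : ℕ} (i : Fin n) (p : Eucl n) :
    DifferentiableAt ℝ (fun q : Eucl n => q i) p := by fun_prop

theorem pderiv_coord {n : ℕ} (i : Fin n) (p : Eucl n) :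
    pderiv i (fun q : Eucl n => q i) p = 1 := by
  have h1 := hasDerivAt_pderiv (differentiableAt_coord i p) i
  have h2 : HasDerivAt (fun t : ℝ => (p + t • EuclideanSpace.single i (1 : ℝ)) i) 1 0 := by
    simpa using (hasDerivAt_id (0 : ℝ)).const_add (p i)
  exact h1.unique h2

namespace ScaleInvariantDomain

variable {n : ℕ} (D : ScaleInvariantDomain n)

/-- The weight `x^{2a} r^{2b}`. -/
noncomputable def powWeight (a b : ℝ) (p : Eucl n) : ℝ := D.x p ^ (2 * a) * D.r p ^ (2 * b)

theorem powWeight_pos (a b : ℝ) {p : Eucl n} (hp : p ∈ D.Ω) : 0 < D.powWeight a b p :=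
  mul_pos (Real.rpow_pos_of_pos (D.isDefining.pos p hp) _) (Real.rpow_pos_of_pos (D.r_pos hp) _)

theorem powWeight_add_one (a b : ℝ) {p : Eucl n} (hp : p ∈ D.Ω) :
    D.powWeight (a + 1) b p = D.x p ^ 2 * D.powWeight a b p := by
  have hx := D.isDefining.pos p hp
  rw [powWeight, powWeight, mul_add, mul_one, Real.rpow_add hx, Real.rpow_two]
  ring

theorem continuousOn_powWeight (a b : ℝ) : ContinuousOn (D.powWeight a b) D.Ω :=
  (D.contDiffOn_x.continuousOn.rpow_const fun p hp => Or.inl (D.isDefining.pos p hp).ne').mul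
    (D.contDiffOn_r.continuousOn.rpow_const fun _ hp => Or.inl (D.r_pos hp).ne')

/-- A smooth radial function, `0` near the origin and `1` at large distances. -/
noncomputable def cutoff (p : Eucl n) : ℝ := Real.smoothTransition (‖p‖ ^ 2 / D.R₀ ^ 2 - 1)

theorem contDiff_cutoff : ContDiff ℝ ∞ D.cutoff :=
  Real.smoothTransition.contDiff.comp
    (((contDiff_norm_sq ℝ).div_const _).sub contDiff_const)

theorem cutoff_nonneg (p : Eucl n) : 0 ≤ D.cutoff p := Real.smoothTransition.nonneg _

theorem cutoff_le_one (p : Eucl n) : D.cutoff p ≤ 1 := Real.smoothTransition.le_one _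

theorem cutoff_eq_zero {p : Eucl n} (hp : ‖p‖ ≤ D.R₀) : D.cutoff p = 0 := by
  refine Real.smoothTransition.zero_of_nonpos ?_
  rw [sub_nonpos, div_le_one (by have := D.R₀_pos; positivity)]
  gcongr

theorem cutoff_eq_one {p : Eucl n} (hp : 2 * D.R₀ ≤ ‖p‖) : D.cutoff p = 1 := by
  have hR := D.R₀_pos
  refine Real.smoothTransition.one_of_one_le ?_
  rw [le_sub_iff_add_le, le_div_iff₀ (by positivity)]
  nlinarith

theorem pderiv_cutoff_eq_zero {p : Eucl n} (hp : 2 * D.R₀ < ‖p‖) (i : Fin n) :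
    pderiv i D.cutoff p = 0 := by
  have h : D.cutoff =ᶠ[𝓝 p] fun _ => 1 :=
    (continuous_norm.continuousAt.eventually (lt_mem_nhds hp)).mono
      fun q hq => D.cutoff_eq_one hq.le
  rw [pderiv, h.fderiv_eq]
  simp

theorem sum_mul_pderiv_cutoff_bounded :
    ∃ C : ℝ, 0 ≤ C ∧ ∀ p, |∑ i, p i * pderiv i D.cutoff p| ≤ C := by
  have hc : Continuous fun p : Eucl n => ∑ i, p i * pderiv i D.cutoff p := by
    refine continuous_finsetSum _ fun i _ => Continuous.mul (by fun_prop) ?_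
    exact (D.contDiff_cutoff.continuous_fderiv (by simp)).clm_apply continuous_const
  obtain ⟨C, hC⟩ := (isCompact_closedBall (0 : Eucl n) (2 * D.R₀)).exists_bound_of_continuousOn
    hc.continuousOn
  refine ⟨max C 0, le_max_right _ _, fun p => ?_⟩
  rcases le_or_gt ‖p‖ (2 * D.R₀) with h | h
  · exact (hC p (by simpa using h)).trans (le_max_left _ _)
  · simp [D.pderiv_cutoff_eq_zero h]

/-- The cutoff vanishes where Euler's identity is not available, so the product holds on all of `Ω`.
-/
theorem cutoff_mul_sum_x {p : Eucl n} (hp : p ∈ D.Ω) :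
    D.cutoff p * ∑ i, p i * pderiv i D.x p = D.cutoff p * D.x p := by
  rcases le_or_gt ‖p‖ D.R₀ with h | h
  · rw [D.cutoff_eq_zero h, zero_mul, zero_mul]
  · rw [D.sum_mul_pderiv_x hp h.le]

theorem cutoff_mul_sum_r {p : Eucl n} (hp : p ∈ D.Ω) :
    D.cutoff p * ∑ i, p i * pderiv i D.r p = D.cutoff p * D.r p := by
  rcases le_or_gt ‖p‖ D.R₀ with h | h
  · rw [D.cutoff_eq_zero h, zero_mul, zero_mul]
  · rw [D.sum_mul_pderiv_r hp h.le]

theorem cutoff_mul_abs_le {p : Eucl n} (hp : p ∈ D.Ω) (i : Fin n) :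
    D.cutoff p * |p i| ≤ D.r p := by
  rcases le_or_gt ‖p‖ D.R₀ with h | h
  · rw [D.cutoff_eq_zero h, zero_mul]
    exact (D.r_pos hp).le
  · rw [D.r_eq hp h.le]
    calc D.cutoff p * |p i| ≤ 1 * ‖p‖ :=
          mul_le_mul (D.cutoff_le_one p) (PiLp.norm_apply_le p i) (abs_nonneg _) zero_le_one
      _ = ‖p‖ := one_mul _

/-- A combination of a multiple of the gradient of `x` and of the radial vector field. -/
noncomputable def hardyField (σ μ α β : ℝ) (i : Fin n) (p : Eucl n) : ℝ :=
  α * (D.x p ^ (2 * σ + 1) * D.r p ^ (2 * μ) * pderiv i D.x p) +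
    β * (D.cutoff p * (D.x p ^ (2 * σ + 1) * D.r p ^ (2 * μ - 1) * p i))

theorem contDiffOn_pderiv_x (i : Fin n) : ContDiffOn ℝ ∞ (pderiv i D.x) D.Ω :=
  (D.contDiffOn_x.fderiv_of_isOpen D.isOpen (m := ∞) (by simp)).clm_apply contDiffOn_const

theorem contDiffOn_hardyField (σ μ α β : ℝ) (i : Fin n) :
    ContDiffOn ℝ ∞ (D.hardyField σ μ α β i) D.Ω := by
  have hx : ∀ a : ℝ, ContDiffOn ℝ ∞ (fun p => D.x p ^ a) D.Ω := fun a =>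
    D.contDiffOn_x.rpow_const_of_ne fun p hp => (D.isDefining.pos p hp).ne'
  have hr : ∀ a : ℝ, ContDiffOn ℝ ∞ (fun p => D.r p ^ a) D.Ω := fun a =>
    D.contDiffOn_r.rpow_const_of_ne fun p hp => (D.r_pos hp).ne'
  have hi : ContDiffOn ℝ ∞ (fun p : Eucl n => p i) D.Ω := by fun_prop
  exact (contDiffOn_const.mul (((hx _).mul (hr _)).mul (D.contDiffOn_pderiv_x i))).add
    (contDiffOn_const.mul (D.contDiff_cutoff.contDiffOn.mul (((hx _).mul (hr _)).mul hi)))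

/-- The weight is factored out and the rest is arranged in scale-invariant quantities and in the
products `cutoff · pᵢ ∂ᵢ`, to which Euler's identity applies after summation. -/
theorem pderiv_hardyField (σ μ α β : ℝ) (i : Fin n) {p : Eucl n} (hp : p ∈ D.Ω) :
    pderiv i (D.hardyField σ μ α β i) p = D.powWeight σ μ p *
      (α * ((2 * σ + 1) * pderiv i D.x p ^ 2 + D.x p / D.r p *
        (2 * μ * (pderiv i D.r p * pderiv i D.x p) + D.r p * pderiv i (pderiv i D.x) p)) +
      β * (D.x p / D.r p * (p i * pderiv i D.cutoff p) +
        ((2 * σ + 1) / D.r p * (D.cutoff p * (p i * pderiv i D.x p)) +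
        (2 * μ - 1) * (D.x p / D.r p ^ 2) * (D.cutoff p * (p i * pderiv i D.r p)) +
        D.cutoff p * (D.x p / D.r p)))) := by
  have hx := D.isDefining.pos p hp
  have hr := D.r_pos hp
  have hda : ∀ {f : Eucl n → ℝ}, ContDiffOn ℝ ∞ f D.Ω → DifferentiableAt ℝ f p := fun hf =>
    (hf.differentiableOn (by simp)).differentiableAt (D.isOpen.mem_nhds hp)
  have h0 := hasDerivAt_pderiv (hda (D.contDiffOn_hardyField σ μ α β i)) i
  have h1 := hasDerivAt_pderiv (hda D.contDiffOn_x) i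
  have h2 := hasDerivAt_pderiv (hda D.contDiffOn_r) i
  have h3 := hasDerivAt_pderiv (hda (D.contDiffOn_pderiv_x i)) i
  have h4 := hasDerivAt_pderiv (hda D.contDiff_cutoff.contDiffOn) i
  have h5 := hasDerivAt_pderiv (differentiableAt_coord i p) i
  rw [pderiv_coord] at h5
  have e0 : p + (0 : ℝ) • EuclideanSpace.single i (1 : ℝ) = p := by simp
  have hx0 : D.x (p + (0 : ℝ) • EuclideanSpace.single i (1 : ℝ)) ≠ 0 := by rw [e0]; exact hx.ne'
  have hr0 : D.r (p + (0 : ℝ) • EuclideanSpace.single i (1 : ℝ)) ≠ 0 := by rw [e0]; exact hr.ne'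
  have hxa := h1.rpow_const (p := 2 * σ + 1) (Or.inl hx0)
  have hra := h2.rpow_const (p := 2 * μ) (Or.inl hr0)
  have hrb := h2.rpow_const (p := 2 * μ - 1) (Or.inl hr0)
  have h6 := (((hxa.mul hra).mul h3).const_mul α).add
    ((h4.mul ((hxa.mul hrb).mul h5)).const_mul β)
  have h7 := h0.unique h6
  simp only [Pi.mul_apply, e0] at h7
  rw [h7, powWeight]
  have ex : D.x p ^ (2 * σ + 1) = D.x p ^ (2 * σ) * D.x p := by
    rw [Real.rpow_add hx, Real.rpow_one]
  have er : D.r p ^ (2 * μ - 1) = D.r p ^ (2 * μ) / D.r p := Real.rpow_sub_one hr.ne' _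
  have er2 : D.r p ^ (2 * μ - 1 - 1) = D.r p ^ (2 * μ) / D.r p / D.r p := by
    rw [Real.rpow_sub_one hr.ne', er]
  rw [add_sub_cancel_right, er2, er, ex]
  field_simp
  ring

/-- Euler's identity for `x` and for `r`, and the divergence of the position vector, contribute
`(2σ+1) + (2μ-1) + n`; this is the coefficient `2σ + 2μ + n` of the cutoff. -/
theorem sum_pderiv_hardyField (σ μ α β : ℝ) {p : Eucl n} (hp : p ∈ D.Ω) :
    ∑ i, pderiv i (D.hardyField σ μ α β i) p = D.powWeight σ μ p *
      (α * (2 * σ + 1) * ∑ i, pderiv i D.x p ^ 2 + D.x p / D.r p *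
        (α * (2 * μ * ∑ i, pderiv i D.r p * pderiv i D.x p +
            ∑ i, D.r p * pderiv i (pderiv i D.x) p) +
          β * (∑ i, p i * pderiv i D.cutoff p + (2 * σ + 2 * μ + n) * D.cutoff p))) := by
  have hr := D.r_pos hp
  simp only [D.pderiv_hardyField σ μ α β _ hp, ← Finset.mul_sum, Finset.sum_add_distrib,
    D.cutoff_mul_sum_x hp, D.cutoff_mul_sum_r hp, Finset.sum_const, Finset.card_univ,
    Fintype.card_fin, nsmul_eq_mul]
  field_simp
  ring

/-- The bound `x · x^{2σ} r^{2μ}` is the geometric mean of the weights with exponents `σ` and `σ +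
1`, which is what Young's inequality needs for the cross term `f ∂f V`. -/
theorem abs_hardyField_le (σ μ α β : ℝ) (i : Fin n) {C : ℝ} {p : Eucl n} (hp : p ∈ D.Ω)
    (hC : |pderiv i D.x p| ≤ C) :
    |D.hardyField σ μ α β i p| ≤ (|α| * C + |β|) * (D.x p * D.powWeight σ μ p) := by
  have hx := D.isDefining.pos p hp
  have hr := D.r_pos hp
  have hw := D.powWeight_pos σ μ hp
  have e : D.hardyField σ μ α β i p = D.x p * D.powWeight σ μ p *
      (α * pderiv i D.x p + β * (D.cutoff p * p i / D.r p)) := by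
    rw [hardyField, powWeight, Real.rpow_add hx, Real.rpow_one, Real.rpow_sub_one hr.ne']
    field_simp
  rw [e, abs_mul, abs_of_pos (mul_pos hx hw), mul_comm]
  refine mul_le_mul_of_nonneg_right ((abs_add_le _ _).trans (add_le_add ?_ ?_))
    (mul_pos hx hw).le
  · rw [abs_mul]
    gcongr
  · rw [abs_mul, abs_div, abs_of_pos hr, abs_mul, abs_of_nonneg (D.cutoff_nonneg p)]
    exact mul_le_of_le_one_right (abs_nonneg _)
      ((div_le_one hr).2 (D.cutoff_mul_abs_le hp i))

/-- Take `α = 2σ+1`, so that the boundary term has the positive coefficient `(2σ+1)²`. The remaining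
terms carry a factor `x / r`: near the boundary it makes them negligible, and at infinity the radial
part, taken large with the sign of `2σ+2μ+n`, outweighs them. -/
theorem exists_hardyField {σ μ : ℝ} (hσ : σ ≠ -1 / 2) (hσμ : σ + μ + (n : ℝ) / 2 ≠ 0) :
    ∃ α β c ρ δ : ℝ, 0 < c ∧ 0 < δ ∧ ∀ p ∈ D.Ω, p ∉ D.core ρ δ →
      c * D.powWeight σ μ p ≤ ∑ i, pderiv i (D.hardyField σ μ α β i) p := by
  choose Cx hCx0 hCx using D.pderiv_x_bounded
  choose Cr hCr0 hCr using D.pderiv_r_bounded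
  choose Cxx hCxx0 hCxx using fun i => D.r_mul_pderiv_pderiv_x_bounded i i
  obtain ⟨Cd, hCd0, hCd⟩ := D.sum_mul_pderiv_cutoff_bounded
  obtain ⟨c, hc, hclow⟩ := D.exists_le_sum_sq_add
  set a : ℝ := 2 * σ + 1 with ha
  set κ : ℝ := 2 * σ + 2 * μ + n with hκ
  have ha0 : 0 < a ^ 2 := by
    refine sq_pos_of_ne_zero fun h => hσ ?_
    rw [ha] at h; linarith
  have hκ0 : 0 < κ ^ 2 := by
    refine sq_pos_of_ne_zero fun h => hσμ ?_
    rw [hκ] at h; linarith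
  let E : Eucl n → ℝ := fun p => a * (2 * μ * ∑ i, pderiv i D.r p * pderiv i D.x p +
    ∑ i, D.r p * pderiv i (pderiv i D.x) p)
  obtain ⟨C₁, hC₁0, hC₁⟩ : ∃ C₁ : ℝ, 0 ≤ C₁ ∧ ∀ p ∈ D.Ω, |E p| ≤ C₁ := by
    refine ⟨|a| * (|2 * μ| * ∑ i, Cr i * Cx i + ∑ i, Cxx i), ?_, fun p hp => ?_⟩
    · exact mul_nonneg (abs_nonneg _) (add_nonneg (mul_nonneg (abs_nonneg _)
        (Finset.sum_nonneg fun i _ => mul_nonneg (hCr0 i) (hCx0 i)))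
        (Finset.sum_nonneg fun i _ => hCxx0 i))
    · simp only [E]
      rw [abs_mul]
      refine mul_le_mul_of_nonneg_left ((abs_add_le _ _).trans (add_le_add ?_ ?_))
        (abs_nonneg _)
      · rw [abs_mul]
        refine mul_le_mul_of_nonneg_left ((Finset.abs_sum_le_sum_abs _ _).trans
          (Finset.sum_le_sum fun i _ => ?_)) (abs_nonneg _)
        rw [abs_mul]
        exact mul_le_mul (hCr i p hp) (hCx i p hp) (abs_nonneg _) (hCr0 i)
      · exact (Finset.abs_sum_le_sum_abs _ _).trans
          (Finset.sum_le_sum fun i _ => hCxx i p hp)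
  -- Chosen so that at infinity the radial term `B κ² = C₁ + a²` beats the error `|E| ≤ C₁` and
  -- leaves `a² x / r`, which complements `a² |∇x|²` in `exists_le_sum_sq_add`.
  set B : ℝ := (C₁ + a ^ 2) / κ ^ 2 with hB
  have hB0 : 0 ≤ B := by positivity
  set M : ℝ := C₁ + |B * κ| * (Cd + |κ|) with hM
  have hM0 : 0 ≤ M := by positivity
  have hden : 0 < a ^ 2 + M := by positivity
  -- Below the threshold for `s = x / r` one has `(a² + M) s < a² c / 2`, so `a² y - M s ≥ a² (c -
  -- s) - M s` still exceeds `a² c / 2`.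
  refine ⟨a, B * κ, a ^ 2 * c / 2, 2 * D.R₀, a ^ 2 * c / (2 * (a ^ 2 + M)), by positivity,
    by positivity, fun p hp hpc => ?_⟩
  rw [D.sum_pderiv_hardyField σ μ _ _ hp, mul_comm _ (D.powWeight σ μ p)]
  refine mul_le_mul_of_nonneg_left ?_ (D.powWeight_pos σ μ hp).le
  have hs := D.x_div_r_pos hp
  set s : ℝ := D.x p / D.r p with hs_def
  set y : ℝ := ∑ i, pderiv i D.x p ^ 2 with hy
  set d : ℝ := ∑ i, p i * pderiv i D.cutoff p with hd
  have hlow : c ≤ y + s := hclow p hp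
  have hE := abs_le.1 (hC₁ p hp)
  change a ^ 2 * c / 2 ≤ a * a * y + s * (E p + B * κ * (d + κ * D.cutoff p))
  -- Outside the core a point is either near the boundary at bounded distance, or so far that the
  -- cutoff is constant.
  rcases le_or_gt ‖p‖ (2 * D.R₀) with h | h
  · have hs' : s < a ^ 2 * c / (2 * (a ^ 2 + M)) := by
      by_contra hcon
      exact hpc ⟨hp, h, not_lt.1 hcon⟩
    rw [lt_div_iff₀ (by positivity)] at hs'
    have h1 : |E p + B * κ * (d + κ * D.cutoff p)| ≤ M := by
      refine (abs_add_le _ _).trans (add_le_add (hC₁ p hp) ?_)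
      rw [abs_mul]
      refine mul_le_mul_of_nonneg_left ((abs_add_le _ _).trans (add_le_add (hCd p) ?_))
        (abs_nonneg _)
      rw [abs_mul, abs_of_nonneg (D.cutoff_nonneg p)]
      exact mul_le_of_le_one_right (abs_nonneg _) (D.cutoff_le_one p)
    have h2 := mul_le_mul_of_nonneg_left (abs_le.1 h1).1 hs.le
    nlinarith
  · have h1 : d = 0 := Finset.sum_eq_zero fun i _ => by
      rw [D.pderiv_cutoff_eq_zero h, mul_zero]
    have h2 : B * κ ^ 2 = C₁ + a ^ 2 := div_mul_cancel₀ _ hκ0.ne'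
    rw [h1, D.cutoff_eq_one h.le]
    have h3 : E p + B * κ * (0 + κ * 1) = E p + (C₁ + a ^ 2) := by rw [← h2]; ring
    rw [h3]
    have h4 : s * a ^ 2 ≤ s * (E p + (C₁ + a ^ 2)) :=
      mul_le_mul_of_nonneg_left (by linarith) hs.le
    nlinarith

end ScaleInvariantDomain

/-! ### The scalar weighted inequality -/

/-- `C²` functions compactly supported in `Ω`. -/
structure IsTest {n : ℕ} (Ω : Set (Eucl n)) (f : Eucl n → ℝ) : Prop where
  contDiff : ContDiff ℝ 2 f
  hasCompactSupport : HasCompactSupport f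
  tsupport_subset : tsupport f ⊆ Ω

namespace IsTest

variable {n : ℕ} {Ω : Set (Eucl n)} {f : Eucl n → ℝ}

theorem continuous_pderiv (hf : IsTest Ω f) (i : Fin n) : Continuous (pderiv i f) :=
  (hf.contDiff.continuous_fderiv (by simp)).clm_apply continuous_const

theorem eq_zero {p : Eucl n} (hp : p ∉ tsupport f) : f p = 0 :=
  image_eq_zero_of_notMem_tsupport hp

theorem pderiv_eq_zero (i : Fin n) {p : Eucl n} (hp : p ∉ tsupport f) : pderiv i f p = 0 := by
  have h : f =ᶠ[𝓝 p] fun _ => 0 := notMem_tsupport_iff_eventuallyEq.1 hp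
  rw [pderiv, h.fderiv_eq]
  simp

theorem integrableOn (hf : IsTest Ω f) {h : Eucl n → ℝ} (hh : Tame Ω h)
    (h0 : ∀ p, p ∉ tsupport f → h p = 0) : IntegrableOn h Ω :=
  hh.integrableOn hf.hasCompactSupport hf.tsupport_subset h0

theorem integrable (hf : IsTest Ω f) {h : Eucl n → ℝ} (hh : Tame Ω h)
    (h0 : ∀ p, p ∉ tsupport f → h p = 0) : Integrable h :=
  (integrableOn_iff_integrable_of_support_subset fun p hp => hf.tsupport_subset <| by
    by_contra hpK
    exact hp (h0 p hpK)).1 (hf.integrableOn hh h0)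

theorem tame (hΩ : IsOpen Ω) (hf : IsTest Ω f) : Tame Ω f :=
  .of_continuous hΩ hf.contDiff.continuous

theorem tame_pderiv (hΩ : IsOpen Ω) (hf : IsTest Ω f) (i : Fin n) : Tame Ω (pderiv i f) :=
  .of_continuous hΩ (hf.continuous_pderiv i)

theorem integrableOn_sq (hΩ : IsOpen Ω) (hf : IsTest Ω f) {w : Eucl n → ℝ} (hw : Tame Ω w) :
    IntegrableOn (fun p => w p * f p ^ 2) Ω := by
  simp only [pow_two]
  exact hf.integrableOn (hw.mul ((hf.tame hΩ).mul (hf.tame hΩ))) fun p hp => by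
    simp [eq_zero hp]

theorem integrableOn_pderiv_sq (hΩ : IsOpen Ω) (hf : IsTest Ω f) {w : Eucl n → ℝ}
    (hw : Tame Ω w) (i : Fin n) : IntegrableOn (fun p => w p * pderiv i f p ^ 2) Ω := by
  simp only [pow_two]
  exact hf.integrableOn (hw.mul ((hf.tame_pderiv hΩ i).mul (hf.tame_pderiv hΩ i))) fun p hp => by
    simp [pderiv_eq_zero i hp]

/-- Integration by parts on all of `ℝⁿ`: `f²` has compact support in `Ω`, so the values of `V`
outside `Ω` are irrelevant. -/
theorem integral_sq_mul_pderiv (hΩ : IsOpen Ω) (hf : IsTest Ω f) {V : Eucl n → ℝ}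
    (hV : ContDiffOn ℝ ∞ V Ω) (i : Fin n) :
    ∫ p in Ω, f p ^ 2 * pderiv i V p = ∫ p in Ω, -(2 * (f p * pderiv i f p)) * V p := by
  have hVt : Tame Ω V := .of_continuousOn hΩ hV.continuousOn
  have hV't : Tame Ω (pderiv i V) := .of_continuousOn hΩ <|
    (hV.fderiv_of_isOpen hΩ (m := 0) (by simp)).continuousOn.clm_apply continuousOn_const
  have hft := hf.tame hΩ
  have hdf : Differentiable ℝ f := hf.contDiff.differentiable (by simp)
  have hd : ∀ p, fderiv ℝ (fun q => f q * f q) p (EuclideanSpace.single i 1) =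
      2 * (f p * pderiv i f p) := fun p => by
    rw [fderiv_fun_mul (hdf p) (hdf p)]
    simp [pderiv]
    ring
  have key := integral_mul_fderiv_eq_neg_fderiv_mul_of_integrable (μ := volume)
    (f := fun q => f q * f q) (g := V) (v := EuclideanSpace.single i (1 : ℝ)) ?_ ?_ ?_ ?_ ?_
  · rw [setIntegral_eq_integral_of_forall_compl_eq_zero,
      setIntegral_eq_integral_of_forall_compl_eq_zero]
    · simp only [pow_two]
      refine key.trans ?_
      rw [← integral_neg]
      refine integral_congr_ae (Eventually.of_forall fun p => ?_)
      simp only [hd]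
      ring
    · intro p hp
      simp [eq_zero fun h => hp (hf.tsupport_subset h)]
    · intro p hp
      simp [eq_zero fun h => hp (hf.tsupport_subset h)]
  · simp only [hd]
    exact hf.integrable (((Tame.const 2).mul (hft.mul (hf.tame_pderiv hΩ i))).mul hVt)
      fun p hp => by simp [eq_zero hp]
  · exact hf.integrable ((hft.mul hft).mul hV't) fun p hp => by simp [eq_zero hp]
  · exact hf.integrable ((hft.mul hft).mul hVt) fun p hp => by simp [eq_zero hp]
  · exact fun p _ => (hdf p).mul (hdf p)
  · intro p hp
    have hp' : p ∈ tsupport f := tsupport_mul_subset_left hp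
    exact (hV.differentiableOn (by simp)).differentiableAt
      (hΩ.mem_nhds (hf.tsupport_subset hp'))

end IsTest

namespace ScaleInvariantDomain

variable {n : ℕ} (D : ScaleInvariantDomain n)

theorem tame_powWeight (a b : ℝ) : Tame D.Ω (D.powWeight a b) :=
  .of_continuousOn D.isOpen (D.continuousOn_powWeight a b)

/-- A weighted Hardy inequality for functions, up to an integral over a compact set. -/
theorem hardy_inequality {σ μ : ℝ} (hσ : σ ≠ -1 / 2) (hσμ : σ + μ + (n : ℝ) / 2 ≠ 0) :
    ∃ C : ℝ, 0 ≤ C ∧ ∃ K ⊆ D.Ω, IsCompact K ∧ ∀ f, IsTest D.Ω f →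
      ∫ p in D.Ω, D.powWeight σ μ p * f p ^ 2 ≤
        C * (∑ i, (∫ p in D.Ω, D.powWeight (σ + 1) μ p * pderiv i f p ^ 2) +
          ∫ p in K, f p ^ 2) := by
  obtain ⟨α, β, c, ρ, δ, hc, hδ, hdiv⟩ := D.exists_hardyField hσ hσμ
  choose Cx _ hCx using D.pderiv_x_bounded
  have hKc : IsCompact (D.core ρ δ) := D.isCompact_core ρ hδ
  have hKm : MeasurableSet (D.core ρ δ) := hKc.measurableSet
  have hKΩ := D.core_subset ρ δ
  set V := D.hardyField σ μ α β with hV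
  have hVs : ∀ i, ContDiffOn ℝ ∞ (V i) D.Ω := D.contDiffOn_hardyField σ μ α β
  have hV'c : ∀ i, ContinuousOn (pderiv i (V i)) D.Ω := fun i =>
    ((hVs i).fderiv_of_isOpen D.isOpen (m := 0) (by simp)).continuousOn.clm_apply
      continuousOn_const
  -- On the core the lower bound on the divergence may fail; `M` bounds the defect and produces the
  -- compact remainder.
  obtain ⟨M, hM⟩ := hKc.exists_bound_of_continuousOn
    (f := fun p => c * D.powWeight σ μ p - ∑ i, pderiv i (V i) p)
    ((continuousOn_const.mul (D.continuousOn_powWeight σ μ)).sub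
      (continuousOn_finsetSum _ fun i _ => hV'c i) |>.mono hKΩ)
  -- Each of the `n` coordinate directions costs `ε I₀`, in total at most `c / 2 · I₀`; the `+ 1`
  -- covers `n = 0`.
  set ε : ℝ := c / (2 * (n + 1)) with hε
  have hε0 : 0 < ε := by positivity
  set A : Fin n → ℝ := fun i => |α| * Cx i + |β| with hA
  set A' : ℝ := ∑ i, A i ^ 2 / ε with hA'
  have hAA' : ∀ i, A i ^ 2 / ε ≤ A' := fun i =>
    Finset.single_le_sum (f := fun i => A i ^ 2 / ε) (fun i _ => by positivity)
      (Finset.mem_univ i)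
  have hA'0 : 0 ≤ A' := Finset.sum_nonneg fun i _ => by positivity
  refine ⟨2 / c * max A' |M|, by positivity, _, hKΩ, hKc, fun f hf => ?_⟩
  have hW := D.tame_powWeight σ μ
  have hW' := D.tame_powWeight (σ + 1) μ
  have hft := hf.tame D.isOpen
  set I₀ : ℝ := ∫ p in D.Ω, D.powWeight σ μ p * f p ^ 2 with hI₀
  set J : Fin n → ℝ := fun i => ∫ p in D.Ω, D.powWeight (σ + 1) μ p * pderiv i f p ^ 2 with hJ
  set I₁ : ℝ := ∫ p in D.core ρ δ, f p ^ 2 with hI₁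
  have hI₁0 : 0 ≤ I₁ := integral_nonneg fun p => sq_nonneg _
  have hJ0 : ∀ i, 0 ≤ J i := fun i => setIntegral_nonneg D.isOpen.measurableSet fun p hp =>
    mul_nonneg (D.powWeight_pos _ _ hp).le (sq_nonneg _)
  have hI₀int := hf.integrableOn_sq D.isOpen hW
  have hJint := hf.integrableOn_pderiv_sq D.isOpen hW'
  have hind : IntegrableOn ((D.core ρ δ).indicator fun p => f p ^ 2) D.Ω := by
    have := hf.integrableOn_sq D.isOpen (Tame.const 1)
    simp only [one_mul] at this
    exact this.indicator hKm
  have hI₁eq : ∫ p in D.Ω, (D.core ρ δ).indicator (fun p => f p ^ 2) p = I₁ := by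
    rw [setIntegral_indicator hKm, inter_eq_self_of_subset_right hKΩ]
  have hdint : ∀ i, IntegrableOn (fun p => f p ^ 2 * pderiv i (V i) p) D.Ω := fun i => by
    have := hf.integrableOn_sq D.isOpen (Tame.of_continuousOn D.isOpen (hV'c i))
    simpa only [mul_comm] using this
  have h1 : c * I₀ ≤ ∑ i, (∫ p in D.Ω, f p ^ 2 * pderiv i (V i) p) + |M| * I₁ := by
    rw [← integral_finsetSum _ fun i _ => hdint i, ← hI₁eq, ← integral_const_mul,
      ← integral_const_mul, ← integral_add (integrable_finsetSum _ fun i _ => hdint i)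
      (hind.const_mul _)]
    refine setIntegral_mono_on (hI₀int.const_mul c)
      ((integrable_finsetSum _ fun i _ => hdint i).add (hind.const_mul _))
      D.isOpen.measurableSet fun p hp => ?_
    rw [← Finset.mul_sum]
    have hf0 := sq_nonneg (f p)
    by_cases hpK : p ∈ D.core ρ δ
    · rw [indicator_of_mem hpK]
      have := (le_abs_self _).trans ((hM p hpK).trans (le_abs_self M))
      nlinarith
    · rw [indicator_of_notMem hpK, mul_zero, add_zero]
      have := hdiv p hp hpK
      nlinarith
  have h2 : ∀ i, ∫ p in D.Ω, f p ^ 2 * pderiv i (V i) p ≤ ε * I₀ + A' * J i := fun i => by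
    rw [hf.integral_sq_mul_pderiv D.isOpen (hVs i) i, ← integral_const_mul, ← integral_const_mul,
      ← integral_add (hI₀int.const_mul _) ((hJint i).const_mul _)]
    refine setIntegral_mono_on ?_ ((hI₀int.const_mul _).add ((hJint i).const_mul _))
      D.isOpen.measurableSet fun p hp => ?_
    · have : Tame D.Ω fun p => -2 * (f p * pderiv i f p) * V i p :=
        ((Tame.const (-2)).mul (hft.mul (hf.tame_pderiv D.isOpen i))).mul
          (.of_continuousOn D.isOpen (hVs i).continuousOn)
      simpa only [neg_mul] using hf.integrableOn this fun p hp => by simp [IsTest.eq_zero hp]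
    · have hVb := D.abs_hardyField_le σ μ α β i hp (hCx i p hp)
      have hw := D.powWeight_pos σ μ hp
      have hx := D.isDefining.pos p hp
      rw [D.powWeight_add_one σ μ hp]
      have h3 : -(2 * (f p * pderiv i f p)) * V i p ≤
          2 * (|f p| * |pderiv i f p|) * (A i * (D.x p * D.powWeight σ μ p)) := by
        refine (le_abs_self _).trans ?_
        rw [abs_mul, abs_neg, abs_mul, abs_mul, abs_two]
        exact mul_le_mul_of_nonneg_left hVb (by positivity)
      -- Young's inequality, obtained by expanding the square in `h5`.
      have h4 : 2 * (|f p| * |pderiv i f p|) * (A i * D.x p) ≤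
          ε * f p ^ 2 + A i ^ 2 / ε * (D.x p ^ 2 * pderiv i f p ^ 2) := by
        have h5 : 0 ≤ (ε * |f p| - A i * D.x p * |pderiv i f p|) ^ 2 / ε := by positivity
        have h6 : (ε * |f p| - A i * D.x p * |pderiv i f p|) ^ 2 / ε = ε * |f p| ^ 2 +
            A i ^ 2 / ε * (D.x p ^ 2 * |pderiv i f p| ^ 2) -
            2 * (|f p| * |pderiv i f p|) * (A i * D.x p) := by
          field_simp
          ring
        rw [h6, sq_abs, sq_abs] at h5
        linarith
      have h7 : A i ^ 2 / ε * (D.x p ^ 2 * pderiv i f p ^ 2) ≤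
          A' * (D.x p ^ 2 * pderiv i f p ^ 2) :=
        mul_le_mul_of_nonneg_right (hAA' i) (by positivity)
      have h8 := mul_le_mul_of_nonneg_right (h4.trans (add_le_add_right h7 _)) hw.le
      linarith
  have h3 : ∑ i, (∫ p in D.Ω, f p ^ 2 * pderiv i (V i) p) ≤ c / 2 * I₀ + A' * ∑ i, J i := by
    refine (Finset.sum_le_sum fun i _ => h2 i).trans ?_
    rw [Finset.sum_add_distrib, ← Finset.mul_sum _ _ A', Finset.sum_const, Finset.card_univ,
      Fintype.card_fin, nsmul_eq_mul, ← mul_assoc]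
    gcongr
    · exact setIntegral_nonneg D.isOpen.measurableSet fun p hp =>
        mul_nonneg (D.powWeight_pos _ _ hp).le (sq_nonneg _)
    · have h9 : (n : ℝ) * (c / (2 * (n + 1))) ≤ c / 2 := by
        rw [mul_div_assoc', div_le_div_iff₀ (by positivity) two_pos]
        nlinarith
      linarith
  have hJs : 0 ≤ ∑ i, J i := Finset.sum_nonneg fun i _ => hJ0 i
  have h4 : c / 2 * I₀ ≤ max A' |M| * (∑ i, J i + I₁) := by
    have h5 := mul_le_mul_of_nonneg_right (le_max_left A' |M|) hJs
    have h6 := mul_le_mul_of_nonneg_right (le_max_right A' |M|) hI₁0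
    linarith
  have h5 := mul_le_mul_of_nonneg_left h4 (by positivity : 0 ≤ 2 / c)
  rw [← mul_assoc, ← mul_assoc] at h5
  rwa [show 2 / c * (c / 2) = 1 by field_simp, one_mul] at h5

end ScaleInvariantDomain

/-! ### Uniform control of the metric -/

theorem abs_sum_sum_mul_le {ι : Type*} [Fintype ι] {B : ι → ι → ℝ} {M : ℝ}
    (hB : ∀ i j, |B i j| ≤ M) (v : ι → ℝ) :
    |∑ i, ∑ j, B i j * v i * v j| ≤ M * Fintype.card ι * ∑ i, v i ^ 2 := by
  have h1 : ∀ i j, |B i j * v i * v j| ≤ M / 2 * v i ^ 2 + M / 2 * v j ^ 2 := fun i j => by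
    rw [abs_mul, abs_mul, mul_assoc]
    have h2 : |v i| * |v j| ≤ (v i ^ 2 + v j ^ 2) / 2 := by
      nlinarith [sq_nonneg (|v i| - |v j|), sq_abs (v i), sq_abs (v j)]
    have h3 := mul_le_mul (hB i j) h2 (by positivity) ((abs_nonneg _).trans (hB i j))
    linarith
  calc |∑ i, ∑ j, B i j * v i * v j| ≤ ∑ i, ∑ j, |B i j * v i * v j| :=
        (Finset.abs_sum_le_sum_abs _ _).trans
          (Finset.sum_le_sum fun i _ => Finset.abs_sum_le_sum_abs _ _)
    _ ≤ ∑ i, ∑ j, (M / 2 * v i ^ 2 + M / 2 * v j ^ 2) :=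
        Finset.sum_le_sum fun i _ => Finset.sum_le_sum fun j _ => h1 i j
    _ = M * Fintype.card ι * ∑ i, v i ^ 2 := by
        simp only [Finset.sum_add_distrib, Finset.sum_const, Finset.card_univ, nsmul_eq_mul,
          ← Finset.mul_sum]
        ring

theorem dotProduct_mulVec_eq {ι : Type*} [Fintype ι] (A : Matrix ι ι ℝ) (v : ι → ℝ) :
    v ⬝ᵥ A *ᵥ v = ∑ i, ∑ j, A i j * v i * v j := by
  simp only [dotProduct, Matrix.mulVec, Finset.mul_sum]
  exact Finset.sum_congr rfl fun i _ => Finset.sum_congr rfl fun j _ => by ring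

/-- A bound on the entries of `A⁻¹` bounds its quadratic form by `N - 1`, hence `A` from below by
`N⁻¹`. The passage to the inverse needs no eigenvalues: it is the positivity of `A` at a single
well-chosen vector. -/
theorem posSemidef_sub_smul_one {ι : Type*} [Fintype ι] [DecidableEq ι] {A : Matrix ι ι ℝ}
    (hA : A.PosDef) {M : ℝ} (hM : 0 ≤ M) (hAM : ∀ i j, |A⁻¹ i j| ≤ M) :
    (A - (M * Fintype.card ι + 1)⁻¹ • (1 : Matrix ι ι ℝ)).PosSemidef := by
  have hN : 0 < M * Fintype.card ι + 1 := by positivity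
  set N : ℝ := M * Fintype.card ι + 1 with hN_def
  refine .of_dotProduct_mulVec_nonneg (hA.1.sub ?_) fun v => ?_
  · rw [Matrix.IsHermitian, Matrix.conjTranspose_smul, Matrix.conjTranspose_one, star_trivial]
  simp only [star_trivial, Matrix.sub_mulVec, Matrix.smul_mulVec, Matrix.one_mulVec,
    dotProduct_sub, dotProduct_smul, smul_eq_mul]
  set u := A⁻¹ *ᵥ v with hu
  have hAu : A *ᵥ u = v := by
    rw [hu, Matrix.mulVec_mulVec, Matrix.mul_nonsing_inv _ hA.det_pos.ne'.isUnit,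
      Matrix.one_mulVec]
  have hsymm : u ⬝ᵥ A *ᵥ v = v ⬝ᵥ v := by
    have hT : Aᵀ = A := by simpa [Matrix.IsHermitian] using hA.1
    rw [Matrix.dotProduct_mulVec, ← Matrix.mulVec_transpose, hT, hAu]
  -- With `u = A⁻¹ v` this expands to `v·Av - 2 N⁻¹ v·v + N⁻² u·v ≥ 0`, and `u·v ≤ N v·v`.
  have h1 := hA.posSemidef.dotProduct_mulVec_nonneg (v - N⁻¹ • u)
  simp only [star_trivial, Matrix.mulVec_sub, Matrix.mulVec_smul, hAu, dotProduct_sub,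
    sub_dotProduct, dotProduct_smul, smul_dotProduct, smul_eq_mul, hsymm] at h1
  have h2 : u ⬝ᵥ v ≤ (N - 1) * (v ⬝ᵥ v) := by
    rw [dotProduct_comm, hu, dotProduct_mulVec_eq]
    refine ((le_abs_self _).trans (abs_sum_sum_mul_le hAM v)).trans (le_of_eq ?_)
    simp [hN_def, dotProduct, pow_two]
  have h3 : 0 ≤ v ⬝ᵥ v := by
    simp only [dotProduct]
    exact Finset.sum_nonneg fun i _ => mul_self_nonneg _
  have h4 : N⁻¹ * (N⁻¹ * (u ⬝ᵥ v)) ≤ N⁻¹ * (v ⬝ᵥ v) := by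
    refine mul_le_mul_of_nonneg_left ?_ (by positivity)
    rw [inv_mul_le_iff₀ hN]
    nlinarith
  linarith

/-- Entrywise products are monotone for the Loewner order on positive semidefinite matrices: write
`AA' - BB' = A(A' - B') + (A - B)B'` and use the Schur product theorem for both terms. -/
theorem posSemidef_mul_sub_mul {ι : Type*} [Finite ι] {A A' B B' : Matrix ι ι ℝ}
    (hB : B.PosSemidef) (hB' : B'.PosSemidef) (hA : (A - B).PosSemidef)
    (hA' : (A' - B').PosSemidef) :
    Matrix.PosSemidef (fun i j => A i j * A' i j - B i j * B' i j : Matrix ι ι ℝ) := by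
  have h1 : A.PosSemidef := by simpa using hA.add hB
  have e : (fun i j => A i j * A' i j - B i j * B' i j : Matrix ι ι ℝ) =
      (fun i j => A i j * (A' - B') i j : Matrix ι ι ℝ) +
      (fun i j => (A - B) i j * B' i j : Matrix ι ι ℝ) := by
    funext i j
    change _ = A i j * (A' i j - B' i j) + (A i j - B i j) * B' i j
    ring
  rw [e]
  exact (posSemidef_mul h1 hA').add (posSemidef_mul hA hB')

theorem posSemidef_prod_sub_prod {ι κ : Type*} [Finite ι] (s : Finset κ)
    (A B : κ → Matrix ι ι ℝ) (hB : ∀ k, (B k).PosSemidef) (hA : ∀ k, (A k - B k).PosSemidef) :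
    Matrix.PosSemidef
      (fun i j => ∏ k ∈ s, A k i j - ∏ k ∈ s, B k i j : Matrix ι ι ℝ) := by
  classical
  have := Fintype.ofFinite ι
  induction s using Finset.induction_on with
  | empty =>
    have e : (fun i j => ∏ k ∈ (∅ : Finset κ), A k i j - ∏ k ∈ (∅ : Finset κ), B k i j :
        Matrix ι ι ℝ) = 0 := by
      ext i j
      simp
    rw [e]
    exact .zero
  | insert a s ha ih =>
    simp only [Finset.prod_insert ha]
    exact posSemidef_mul_sub_mul (A' := fun i j => ∏ k ∈ s, A k i j) (hB a)
      (posSemidef_prod s B hB) (hA a) ih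

theorem exists_bound_of_tendsto {n : ℕ} {h : Eucl n → ℝ} (hc : Continuous h) {a : ℝ}
    (ht : Tendsto h (cobounded (Eucl n)) (𝓝 a)) : ∃ C : ℝ, 0 ≤ C ∧ ∀ p, |h p| ≤ C := by
  have h1 : ∀ᶠ p in cobounded (Eucl n), |h p| < |a| + 1 :=
    ht.abs.eventually (gt_mem_nhds (lt_add_one _))
  rw [Metric.cobounded_eq_cocompact] at h1
  obtain ⟨K, hK, hKs⟩ := mem_cocompact.1 h1
  obtain ⟨C, hC⟩ := hK.exists_bound_of_continuousOn hc.continuousOn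
  refine ⟨max C (|a| + 1), le_max_of_le_right (by positivity), fun p => ?_⟩
  by_cases hp : p ∈ K
  · exact (hC p hp).trans (le_max_left _ _)
  · exact (show |h p| < |a| + 1 from hKs hp).le.trans (le_max_right _ _)

theorem Tame.exists_bound {n : ℕ} {Ω K : Set (Eucl n)} {f : Eucl n → ℝ} (hf : Tame Ω f)
    (hK : IsCompact K) (hKΩ : K ⊆ Ω) : ∃ C : ℝ, 0 ≤ C ∧ ∀ q ∈ K, |f q| ≤ C := by
  refine hK.induction_on (p := fun s => ∃ C : ℝ, 0 ≤ C ∧ ∀ q ∈ s, |f q| ≤ C) ⟨0, le_rfl, by simp⟩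
    (fun s t hst ⟨C, hC0, hC⟩ => ⟨C, hC0, fun q hq => hC q (hst hq)⟩)
    (fun s t ⟨C, hC0, hC⟩ ⟨C', _, hC'⟩ => ⟨max C C', le_max_of_le_left hC0, ?_⟩) fun p hp => ?_
  · rintro q (hq | hq)
    · exact (hC q hq).trans (le_max_left _ _)
    · exact (hC' q hq).trans (le_max_right _ _)
  · obtain ⟨C, hC⟩ := hf.2 p (hKΩ hp)
    refine ⟨_, mem_nhdsWithin_of_mem_nhds hC, |C|, abs_nonneg _, fun q hq => ?_⟩
    exact (show |f q| ≤ C from hq).trans (le_abs_self C)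

namespace AEMetric

variable {n : ℕ} (G : AEMetric n)

theorem tendsto_g : Tendsto G.g (cobounded (Eucl n)) (𝓝 1) :=
  tendsto_pi_nhds.2 fun i => tendsto_pi_nhds.2 fun j => G.tendsto_euclidean i j

theorem tendsto_det : Tendsto (fun p => (G.g p).det) (cobounded (Eucl n)) (𝓝 1) := by
  have h := ((continuous_id (X := Matrix (Fin n) (Fin n) ℝ)).matrix_det.tendsto 1).comp G.tendsto_g
  simpa [Function.comp_def] using h

theorem tendsto_inv (i j : Fin n) : Tendsto (fun p => (G.g p)⁻¹ i j) (cobounded (Eucl n))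
    (𝓝 ((1 : Matrix (Fin n) (Fin n) ℝ) i j)) := by
  have h := ((continuous_id (X := Matrix (Fin n) (Fin n) ℝ)).matrix_adjugate.tendsto 1).comp
    G.tendsto_g
  have h1 := (G.tendsto_det.inv₀ one_ne_zero).smul h
  have h2 := tendsto_pi_nhds.1 (tendsto_pi_nhds.1 h1 i) j
  simpa [Matrix.inv_def, Ring.inverse_eq_inv'] using h2

theorem exists_entry_bound : ∃ C : ℝ, 0 ≤ C ∧ ∀ p i j, |G.g p i j| ≤ C ∧ |(G.g p)⁻¹ i j| ≤ C := by
  choose C hC0 hC using fun i j => exists_bound_of_tendsto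
    (G.continuous_g.matrix_elem i j) (G.tendsto_euclidean i j)
  choose C' hC'0 hC' using fun i j => exists_bound_of_tendsto
    (G.continuous_inv.matrix_elem i j) (G.tendsto_inv i j)
  have hle : ∀ i j, C i j + C' i j ≤ ∑ i, ∑ j, (C i j + C' i j) := fun i j =>
    (Finset.single_le_sum (f := fun j => C i j + C' i j)
      (fun j _ => add_nonneg (hC0 i j) (hC'0 i j)) (Finset.mem_univ j)).trans
    (Finset.single_le_sum (f := fun i => ∑ j, (C i j + C' i j)) (fun i _ => Finset.sum_nonneg
      fun j _ => add_nonneg (hC0 i j) (hC'0 i j)) (Finset.mem_univ i))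
  refine ⟨∑ i, ∑ j, (C i j + C' i j), Finset.sum_nonneg fun i _ => Finset.sum_nonneg
    fun j _ => add_nonneg (hC0 i j) (hC'0 i j), fun p i j => ⟨?_, ?_⟩⟩
  · linarith [hC i j p, hC'0 i j, hle i j]
  · linarith [hC' i j p, hC0 i j, hle i j]

theorem sqrt_det_pos (p : Eucl n) : 0 < √(G.g p).det := Real.sqrt_pos.2 (G.posDef p).det_pos

theorem exists_sqrt_det_bounds :
    ∃ c C : ℝ, 0 < c ∧ 0 < C ∧ ∀ p, c ≤ √(G.g p).det ∧ √(G.g p).det ≤ C := by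
  have hc : Continuous fun p => √(G.g p).det := G.continuous_g.matrix_det.sqrt
  have ht : Tendsto (fun p => √(G.g p).det) (cobounded (Eucl n)) (𝓝 1) := by
    simpa using G.tendsto_det.sqrt
  obtain ⟨C, hC0, hC⟩ := exists_bound_of_tendsto hc ht
  obtain ⟨C', hC'0, hC'⟩ := exists_bound_of_tendsto
    (hc.inv₀ fun p => (G.sqrt_det_pos p).ne') (ht.inv₀ one_ne_zero)
  refine ⟨(C' + 1)⁻¹, C + 1, by positivity, by positivity, fun p => ⟨?_, ?_⟩⟩
  · have h : (√(G.g p).det)⁻¹ ≤ C' := (le_abs_self _).trans (hC' p)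
    exact inv_le_of_inv_le₀ (G.sqrt_det_pos p) (by linarith)
  · linarith [(le_abs_self _).trans (hC p)]

/-- The Gram matrix on tensors is an entrywise product of pullbacks of `g` and `g⁻¹`. Each factor
dominates `c` times the pulled-back identity, and this survives products by
`posSemidef_prod_sub_prod`. The upper bound only needs bounded entries. -/
theorem exists_tensorInner_bounds (k l : ℕ) : ∃ c C : ℝ, 0 < c ∧ 0 < C ∧
    ∀ (p : Eucl n) (S : Tensor n k l), c * ∑ I, S I ^ 2 ≤ G.tensorInner p S S ∧
      G.tensorInner p S S ≤ C * ∑ I, S I ^ 2 := by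
  obtain ⟨M, hM0, hM⟩ := G.exists_entry_bound
  set c : ℝ := (M * Fintype.card (Fin n) + 1)⁻¹ with hc
  have hc0 : 0 < c := by positivity
  refine ⟨c ^ k * c ^ l, M ^ k * M ^ l * Fintype.card (TIdx n k l) + 1, by positivity,
    by positivity, fun p S => ⟨?_, ?_⟩⟩
  · have h1 := posSemidef_sub_smul_one (G.posDef p) hM0 fun i j => (hM p i j).2
    have h2 := posSemidef_sub_smul_one (G.posDef p).inv hM0 fun i j => by
      rw [Matrix.nonsing_inv_nonsing_inv _ (G.posDef p).det_pos.ne'.isUnit]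
      exact (hM p i j).1
    have hone : (c • (1 : Matrix (Fin n) (Fin n) ℝ)).PosSemidef := Matrix.PosSemidef.one.smul hc0.le
    have h3 := posSemidef_mul_sub_mul
      (posSemidef_prod Finset.univ (fun s : Fin k => (c • (1 : Matrix (Fin n) (Fin n) ℝ)).submatrix
        (fun I : TIdx n k l => I.1 s) fun J => J.1 s) fun _ => hone.submatrix _)
      (posSemidef_prod Finset.univ (fun t : Fin l => (c • (1 : Matrix (Fin n) (Fin n) ℝ)).submatrix
        (fun I : TIdx n k l => I.2 t) fun J => J.2 t) fun _ => hone.submatrix _)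
      (posSemidef_prod_sub_prod Finset.univ
        (fun s : Fin k => (G.g p).submatrix (fun I : TIdx n k l => I.1 s) fun J => J.1 s) _
        (fun _ => hone.submatrix _) fun _ => h1.submatrix _)
      (posSemidef_prod_sub_prod Finset.univ
        (fun t : Fin l => (G.g p)⁻¹.submatrix (fun I : TIdx n k l => I.2 t) fun J => J.2 t) _
        (fun _ => hone.submatrix _) fun _ => h2.submatrix _)
    have h4 := h3.dotProduct_mulVec_nonneg S
    rw [star_trivial] at h4
    replace h4 := h4.trans_eq (dotProduct_mulVec_eq _ S)
    -- A single pulled-back identity is degenerate on multi-indices; the product over all slots is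
    -- the identity.
    have h5 : ∀ I J : TIdx n k l, (∏ s, (c • (1 : Matrix (Fin n) (Fin n) ℝ)) (I.1 s) (J.1 s)) *
        ∏ t, (c • (1 : Matrix (Fin n) (Fin n) ℝ)) (I.2 t) (J.2 t) =
        if I = J then c ^ k * c ^ l else 0 := fun I J => by
      split_ifs with hIJ
      · subst hIJ
        simp
      · rw [Prod.ext_iff, not_and_or] at hIJ
        rcases hIJ with h | h
        · obtain ⟨s, hs⟩ := Function.ne_iff.1 h
          rw [Finset.prod_eq_zero (Finset.mem_univ s) (by simp [hs]), zero_mul]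
        · obtain ⟨t, ht⟩ := Function.ne_iff.1 h
          rw [Finset.prod_eq_zero (i := t) (Finset.mem_univ t) (by simp [ht]), mul_zero]
    simp only [Matrix.submatrix_apply, h5, sub_mul, Finset.sum_sub_distrib, ite_mul, zero_mul,
      Finset.sum_ite_eq, Finset.mem_univ, if_true] at h4
    rw [sub_nonneg] at h4
    refine le_trans (le_of_eq ?_) h4
    rw [Finset.mul_sum]
    exact Finset.sum_congr rfl fun I _ => by ring
  · have hg : ∀ I J : TIdx n k l, |G.gram k l p I J| ≤ M ^ k * M ^ l := fun I J => by
      rw [gram, abs_mul, Finset.abs_prod, Finset.abs_prod]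
      refine mul_le_mul ?_ ?_ (Finset.prod_nonneg fun _ _ => abs_nonneg _) (by positivity)
      · refine (Finset.prod_le_prod (fun _ _ => abs_nonneg _) fun s _ =>
          (hM p (I.1 s) (J.1 s)).1).trans (le_of_eq ?_)
        simp
      · refine (Finset.prod_le_prod (fun _ _ => abs_nonneg _) fun t _ =>
          (hM p (I.2 t) (J.2 t)).2).trans (le_of_eq ?_)
        simp
    refine ((le_abs_self _).trans (abs_sum_sum_mul_le hg S)).trans ?_
    exact mul_le_mul_of_nonneg_right (by linarith) (Finset.sum_nonneg fun _ _ => sq_nonneg _)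

/-- The sum of the squares of the Christoffel symbols. -/
noncomputable def christoffelSq (p : Eucl n) : ℝ := ∑ a, ∑ i, ∑ j, G.christoffel a i j p ^ 2

theorem christoffelSq_nonneg (p : Eucl n) : 0 ≤ G.christoffelSq p :=
  Finset.sum_nonneg fun _ _ => Finset.sum_nonneg fun _ _ => Finset.sum_nonneg fun _ _ =>
    sq_nonneg _

theorem sq_christoffel_le (a i j : Fin n) (p : Eucl n) :
    G.christoffel a i j p ^ 2 ≤ G.christoffelSq p :=
  ((Finset.single_le_sum (f := fun j => G.christoffel a i j p ^ 2) (fun _ _ => sq_nonneg _)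
    (Finset.mem_univ j)).trans (Finset.single_le_sum (f := fun i => ∑ j,
      G.christoffel a i j p ^ 2) (fun _ _ => Finset.sum_nonneg fun _ _ => sq_nonneg _)
    (Finset.mem_univ i))).trans (Finset.single_le_sum (f := fun a => ∑ i, ∑ j,
      G.christoffel a i j p ^ 2) (fun _ _ => Finset.sum_nonneg fun _ _ => Finset.sum_nonneg
    fun _ _ => sq_nonneg _) (Finset.mem_univ a))

theorem tame_christoffelSq {Ω : Set (Eucl n)} (hΩ : IsOpen Ω) : Tame Ω G.christoffelSq := by
  refine .sum _ fun a => .sum _ fun i => .sum _ fun j => ?_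
  simpa only [pow_two] using (G.tame_christoffel hΩ a i j).mul (G.tame_christoffel hΩ a i j)

theorem tendsto_norm_mul_christoffel (a i j : Fin n) :
    Tendsto (fun p => ‖p‖ * G.christoffel a i j p) (cobounded (Eucl n)) (𝓝 0) := by
  have hd : ∀ i j k, Tendsto (fun p => ‖p‖ * pderiv k (fun q => G.g q i j) p)
      (cobounded (Eucl n)) (𝓝 0) := fun i j k => by
    have := (G.deriv_isLittleO i j k).tendsto_div_nhds_zero
    simpa only [div_inv_eq_mul, mul_comm] using this
  have h : Tendsto (fun p => (1 / 2) * ∑ c, (G.g p)⁻¹ a c *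
      (‖p‖ * pderiv i (fun q => G.g q j c) p + ‖p‖ * pderiv j (fun q => G.g q i c) p -
        ‖p‖ * pderiv c (fun q => G.g q i j) p)) (cobounded (Eucl n))
      (𝓝 ((1 / 2) * ∑ c, (1 : Matrix (Fin n) (Fin n) ℝ) a c * (0 + 0 - 0))) :=
    (tendsto_finsetSum _ fun c _ => (G.tendsto_inv a c).mul
      (((hd j c i).add (hd i c j)).sub (hd i j c))).const_mul _
  simp only [add_zero, sub_zero, mul_zero, Finset.sum_const_zero] at h
  refine h.congr fun p => ?_
  simp only [christoffel, Finset.mul_sum]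
  exact Finset.sum_congr rfl fun c _ => by ring

theorem tendsto_norm_sq_mul_christoffelSq :
    Tendsto (fun p => ‖p‖ ^ 2 * G.christoffelSq p) (cobounded (Eucl n)) (𝓝 0) := by
  have h : Tendsto (fun p => ∑ a, ∑ i, ∑ j, (‖p‖ * G.christoffel a i j p) ^ 2)
      (cobounded (Eucl n)) (𝓝 (∑ _a : Fin n, ∑ _i : Fin n, ∑ _j : Fin n, (0 : ℝ) ^ 2)) :=
    tendsto_finsetSum _ fun a _ => tendsto_finsetSum _ fun i _ => tendsto_finsetSum _ fun j _ =>
      (G.tendsto_norm_mul_christoffel a i j).pow 2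
  have e : (∑ _a : Fin n, ∑ _i : Fin n, ∑ _j : Fin n, (0 : ℝ) ^ 2) = 0 := by simp
  rw [e] at h
  refine h.congr fun p => ?_
  simp only [christoffelSq, Finset.mul_sum, mul_pow]

/-! ### Christoffel symbols against the weight `x` -/

variable (D : ScaleInvariantDomain n)

/-- At infinity `x ≤ C |p|` while `|p|² |Γ|² → 0`. At bounded distance `Γ` is bounded up to and
across the boundary, because `g` is locally Lipschitz on all of `ℝⁿ`, and `x` is small off the core.
-/
theorem exists_core_christoffel_le {ε : ℝ} (hε : 0 < ε) : ∃ ρ δ : ℝ, 0 < δ ∧ ∀ p ∈ D.Ω,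
    p ∉ D.core ρ δ → D.x p ^ 2 * G.christoffelSq p ≤ ε := by
  obtain ⟨C, hC0, hC⟩ := D.x_div_r_bounded
  have hxr : ∀ p ∈ D.Ω, D.x p = D.x p / D.r p * D.r p := fun p hp =>
    (div_mul_cancel₀ _ (D.r_pos hp).ne').symm
  have h1 : ∀ᶠ p in cobounded (Eucl n), ‖p‖ ^ 2 * G.christoffelSq p < ε / (C ^ 2 + 1) :=
    G.tendsto_norm_sq_mul_christoffelSq.eventually (gt_mem_nhds (by positivity))
  obtain ⟨ρ₁, -, hρ₁⟩ := hasBasis_cobounded_norm.eventually_iff.1 h1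
  set ρ := max ρ₁ D.R₀ with hρ
  obtain ⟨Cr, hCr⟩ := (D.isCompact_near ρ).exists_bound_of_continuousOn
    (D.r_smooth.continuousOn.mono inter_subset_left)
  obtain ⟨CΓ, hCΓ0, hCΓ⟩ := (G.tame_christoffelSq isOpen_univ).exists_bound
    (isCompact_closedBall (0 : Eucl n) ρ) (subset_univ _)
  set A : ℝ := Cr ^ 2 * CΓ + 1 with hA
  have hA0 : 0 < A := by positivity
  -- Off the core at bounded distance, `(x / r)² ≤ ε / A`, while `A` exceeds `r² |Γ|²` there.
  refine ⟨ρ, √(ε / A), by positivity, fun p hp hpc => ?_⟩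
  have hs := D.x_div_r_pos hp
  have hr := D.r_pos hp
  have hΓ := G.christoffelSq_nonneg p
  rcases le_or_gt ‖p‖ ρ with h | h
  · have hs' : D.x p / D.r p < √(ε / A) := by
      by_contra hcon
      exact hpc ⟨hp, h, not_lt.1 hcon⟩
    have hs2 : (D.x p / D.r p) ^ 2 ≤ ε / A := by
      rw [← Real.sq_sqrt (by positivity : 0 ≤ ε / A)]
      gcongr
    have hr2 : D.r p ^ 2 ≤ Cr ^ 2 := by
      have := (le_abs_self _).trans (hCr p ⟨subset_closure hp, by simpa using h⟩)
      gcongr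
    have hΓ2 : G.christoffelSq p ≤ CΓ := (le_abs_self _).trans (hCΓ p (by simpa using h))
    calc D.x p ^ 2 * G.christoffelSq p
        = (D.x p / D.r p) ^ 2 * (D.r p ^ 2 * G.christoffelSq p) := by
          rw [← mul_assoc, ← mul_pow, ← hxr p hp]
      _ ≤ ε / A * (Cr ^ 2 * CΓ) := by gcongr
      _ ≤ ε / A * A := by gcongr; linarith
      _ = ε := div_mul_cancel₀ _ hA0.ne'
  · have hpR : D.R₀ ≤ ‖p‖ := (le_max_right _ _).trans h.le
    have h2 := hρ₁ (show p ∈ {x | ρ₁ ≤ ‖x‖} from (le_max_left _ _).trans h.le)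
    have h3 : (D.x p / D.r p) ^ 2 ≤ C ^ 2 := by
      have := (le_abs_self _).trans (hC p hp)
      gcongr
    calc D.x p ^ 2 * G.christoffelSq p
        = (D.x p / D.r p) ^ 2 * (‖p‖ ^ 2 * G.christoffelSq p) := by
          rw [← mul_assoc, ← mul_pow, ← D.r_eq hp hpR, ← hxr p hp]
      _ ≤ C ^ 2 * (ε / (C ^ 2 + 1)) := by gcongr
      _ ≤ (C ^ 2 + 1) * (ε / (C ^ 2 + 1)) := by gcongr; linarith
      _ = ε := mul_div_cancel₀ _ (by positivity)

theorem exists_christoffel_le :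
    ∃ C : ℝ, 0 ≤ C ∧ ∀ p ∈ D.Ω, D.x p ^ 2 * G.christoffelSq p ≤ C := by
  obtain ⟨ρ, δ, hδ, h⟩ := G.exists_core_christoffel_le D one_pos
  have hx : Tame D.Ω fun p => D.x p * D.x p :=
    .of_continuousOn D.isOpen (D.contDiffOn_x.continuousOn.mul D.contDiffOn_x.continuousOn)
  obtain ⟨C, hC0, hC⟩ := (hx.mul (G.tame_christoffelSq D.isOpen)).exists_bound
    (D.isCompact_core ρ hδ) (D.core_subset ρ δ)
  refine ⟨max C 1, by positivity, fun p hp => ?_⟩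
  by_cases hpc : p ∈ D.core ρ δ
  · rw [pow_two]
    exact (le_abs_self _).trans ((hC p hpc).trans (le_max_left _ _))
  · exact (h p hp hpc).trans (le_max_right _ _)

/-- The partial derivative is a component of `∇u` minus `(k + l) n` products of a Christoffel symbol
with a component of `u`, each bounded by `m`; then `(a - b)² ≤ 2a² + 2b²`. -/
theorem sq_pderiv_le {k l : ℕ} (u : TensorField n k l) (i : Fin n) (I : TIdx n k l)
    (p : Eucl n) : pderiv i (fun q => u q I) p ^ 2 ≤ 2 * ∑ J, G.nabla u p J ^ 2 +
      2 * ((k + l) * n) ^ 2 * (G.christoffelSq p * ∑ J, u p J ^ 2) := by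
  have hU : 0 ≤ ∑ J, u p J ^ 2 := Finset.sum_nonneg fun _ _ => sq_nonneg _
  have hΓ := G.christoffelSq_nonneg p
  set m : ℝ := √(G.christoffelSq p * ∑ J, u p J ^ 2) with hm
  have hm2 : m ^ 2 = G.christoffelSq p * ∑ J, u p J ^ 2 := Real.sq_sqrt (mul_nonneg hΓ hU)
  have hle : ∀ a b c J, |G.christoffel a b c p * u p J| ≤ m := fun a b c J => by
    refine Real.abs_le_sqrt ?_
    rw [mul_pow]
    exact mul_le_mul (G.sq_christoffel_le a b c p) (Finset.single_le_sum
      (f := fun J => u p J ^ 2) (fun _ _ => sq_nonneg _) (Finset.mem_univ J)) (sq_nonneg _) hΓ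
  have hsum : ∀ {q : ℕ} (F : Fin q → Fin n → ℝ), (∀ s c, |F s c| ≤ m) →
      |∑ s, ∑ c, F s c| ≤ q * n * m := fun {q} F hF => by
    refine ((Finset.abs_sum_le_sum_abs _ _).trans (Finset.sum_le_sum fun s _ =>
      (Finset.abs_sum_le_sum_abs _ _).trans (Finset.sum_le_sum fun c _ => hF s c))).trans
      (le_of_eq ?_)
    simp
    ring
  set J₀ : TIdx n k (l + 1) := (I.1, Fin.cons i I.2) with hJ₀
  set S₁ : ℝ := ∑ s, ∑ c, G.christoffel (I.1 s) i c p * u p (Function.update I.1 s c, I.2) with hS₁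
  set S₂ : ℝ := ∑ t, ∑ c, G.christoffel c i (I.2 t) p * u p (I.1, Function.update I.2 t c) with hS₂
  have h1 : G.nabla u p J₀ = pderiv i (fun q => u q I) p + S₁ - S₂ := by
    simp only [nabla, hJ₀, Fin.cons_zero, Fin.tail_cons, hS₁, hS₂]
  have h2 : G.nabla u p J₀ ^ 2 ≤ ∑ J, G.nabla u p J ^ 2 := Finset.single_le_sum
    (f := fun J => G.nabla u p J ^ 2) (fun _ _ => sq_nonneg _) (Finset.mem_univ J₀)
  have h3 : |S₁| ≤ k * n * m := hsum _ fun s c => hle _ _ _ _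
  have h4 : |S₂| ≤ l * n * m := hsum _ fun s c => hle _ _ _ _
  have h5 : |S₁ - S₂| ≤ (k + l) * n * m := (abs_sub _ _).trans (by linarith)
  have h6 : (S₁ - S₂) ^ 2 ≤ ((k + l) * n) ^ 2 * m ^ 2 := by
    rw [← sq_abs, ← mul_pow]
    gcongr
  rw [← hm2]
  have h7 : pderiv i (fun q => u q I) p = G.nabla u p J₀ - (S₁ - S₂) := by rw [h1]; ring
  rw [h7]
  nlinarith [sq_nonneg (G.nabla u p J₀ + (S₁ - S₂))]

end AEMetric

/-! ### Interior compactness -/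

theorem sq_integral_le {α : Type*} [MeasurableSpace α] (ν : Measure α) [IsFiniteMeasure ν]
    {h : α → ℝ} (hi : Integrable h ν) (hi2 : Integrable (fun x => h x ^ 2) ν) :
    (∫ x, h x ∂ν) ^ 2 ≤ ν.real univ * ∫ x, h x ^ 2 ∂ν := by
  set V := ν.real univ with hV
  set m := ∫ x, h x ∂ν with hm
  have h1 : ∀ c : ℝ, 0 ≤ ∫ x, h x ^ 2 ∂ν - 2 * c * m + c ^ 2 * V := fun c => by
    have h2 : 0 ≤ ∫ x, (h x - c) ^ 2 ∂ν := integral_nonneg fun x => sq_nonneg _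
    have h3 : (fun x => (h x - c) ^ 2) = fun x => (h x ^ 2 - 2 * c * h x) + c ^ 2 := by
      funext x; ring
    have h4 : Integrable (fun x => h x ^ 2 - 2 * c * h x) ν := hi2.sub (hi.const_mul _)
    rw [h3, integral_add h4 (integrable_const _), integral_sub hi2 (hi.const_mul _), integral_const_mul, integral_const, smul_eq_mul] at h2
    linarith
  rcases (measureReal_nonneg (μ := ν) (s := univ)).eq_or_lt' with h0 | h0
  · have h4 : ν = 0 := by
      rw [measureReal_def, ENNReal.toReal_eq_zero_iff] at h0
      exact Measure.measure_univ_eq_zero.1 (h0.resolve_right (measure_ne_top _ _))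
    simp [hm, h4]
  -- The mean value minimises `∫ (h - c)²`, and its nonnegativity there is the Cauchy–Schwarz
  -- inequality.
  · have h5 := h1 (m / V)
    have h6 := mul_nonneg h0.le h5
    have h7 : V * (∫ x, h x ^ 2 ∂ν - 2 * (m / V) * m + (m / V) ^ 2 * V) =
        V * ∫ x, h x ^ 2 ∂ν - m ^ 2 := by
      field_simp [show V ≠ 0 from h0.ne']
      ring
    rw [← hV, h7] at h6
    linarith

/-! ### A Poincaré inequality on small balls -/

section Translation

variable {n : ℕ} {w : Eucl n → ℝ}

theorem sq_sub_le (hw : ContDiff ℝ 1 w) (x v : Eucl n) : (w (x + v) - w x) ^ 2 ≤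
    ‖v‖ ^ 2 * ∫ t in Ioc (0 : ℝ) 1, ‖fderiv ℝ w (x + t • v)‖ ^ 2 := by
  have hw' : Continuous (fderiv ℝ w) := hw.continuous_fderiv (by simp)
  have hc : Continuous fun t : ℝ => fderiv ℝ w (x + t • v) v := by fun_prop
  have hc2 : Continuous fun t : ℝ => ‖fderiv ℝ w (x + t • v)‖ ^ 2 := by fun_prop
  have h1 : ∀ t : ℝ, HasDerivAt (fun t : ℝ => w (x + t • v)) (fderiv ℝ w (x + t • v) v) t := by
    intro t
    have hl : HasDerivAt (fun t : ℝ => x + t • v) v t := by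
      simpa using ((hasDerivAt_id t).smul_const v).const_add x
    exact (hw.differentiable (by simp) _).hasFDerivAt.comp_hasDerivAt t hl
  have h2 := intervalIntegral.integral_eq_sub_of_hasDerivAt (a := 0) (b := 1)
    (fun t _ => h1 t) (hc.intervalIntegrable _ _)
  rw [intervalIntegral.integral_of_le zero_le_one] at h2
  simp only [one_smul, zero_smul, add_zero] at h2
  rw [← h2]
  have hi : IntegrableOn (fun t : ℝ => fderiv ℝ w (x + t • v) v) (Ioc 0 1) :=
    hc.integrableOn_Ioc
  have hi2 : IntegrableOn (fun t : ℝ => (fderiv ℝ w (x + t • v) v) ^ 2) (Ioc 0 1) :=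
    (hc.pow 2).integrableOn_Ioc
  refine (sq_integral_le _ hi hi2).trans ?_
  simp only [measureReal_restrict_apply_univ, Real.volume_real_Ioc, sub_zero, zero_le_one,
    sup_of_le_left, one_mul]
  rw [← integral_const_mul]
  refine integral_mono hi2 (hc2.integrableOn_Ioc.const_mul _) fun t => ?_
  have h3 := (fderiv ℝ w (x + t • v)).le_opNorm v
  rw [Real.norm_eq_abs] at h3
  calc (fderiv ℝ w (x + t • v) v) ^ 2 = |fderiv ℝ w (x + t • v) v| ^ 2 := (sq_abs _).symm
    _ ≤ (‖fderiv ℝ w (x + t • v)‖ * ‖v‖) ^ 2 := by gcongr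
    _ = ‖v‖ ^ 2 * ‖fderiv ℝ w (x + t • v)‖ ^ 2 := by ring

/-- Integrate `sq_sub_le` in `x` and exchange the integrals: by translation invariance the inner one
does not depend on `t`. Working with values in `[0, ∞]` avoids integrability questions. -/
theorem lintegral_translate_sub_sq_le (hw : ContDiff ℝ 1 w) (v : Eucl n) :
    ∫⁻ x, ENNReal.ofReal ((w (x + v) - w x) ^ 2) ≤
      ENNReal.ofReal (‖v‖ ^ 2) * ∫⁻ x, ENNReal.ofReal (‖fderiv ℝ w x‖ ^ 2) := by
  have hw' : Continuous (fderiv ℝ w) := hw.continuous_fderiv (by simp)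
  have h1 : ∀ x, ENNReal.ofReal ((w (x + v) - w x) ^ 2) ≤ ENNReal.ofReal (‖v‖ ^ 2) *
      ∫⁻ t in Ioc (0 : ℝ) 1, ENNReal.ofReal (‖fderiv ℝ w (x + t • v)‖ ^ 2) := fun x => by
    have hc2 : Continuous fun t : ℝ => ‖fderiv ℝ w (x + t • v)‖ ^ 2 := by fun_prop
    rw [← ofReal_integral_eq_lintegral_ofReal hc2.integrableOn_Ioc
      (Eventually.of_forall fun t => by positivity), ← ENNReal.ofReal_mul (by positivity)]
    exact ENNReal.ofReal_le_ofReal (sq_sub_le hw x v)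
  refine (lintegral_mono h1).trans ?_
  rw [lintegral_const_mul' _ _ ENNReal.ofReal_ne_top]
  refine mul_le_mul_right ?_ _
  rw [lintegral_lintegral_swap]
  · have h2 : ∀ t : ℝ, ∫⁻ x, ENNReal.ofReal (‖fderiv ℝ w (x + t • v)‖ ^ 2) =
        ∫⁻ x, ENNReal.ofReal (‖fderiv ℝ w x‖ ^ 2) := fun t =>
      lintegral_add_right_eq_self (fun x => ENNReal.ofReal (‖fderiv ℝ w x‖ ^ 2)) (t • v)
    simp only [h2, setLIntegral_const, Real.volume_Ioc, sub_zero, ENNReal.ofReal_one, mul_one,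
      le_refl]
  · have : Continuous fun z : Eucl n × ℝ =>
        ENNReal.ofReal (‖fderiv ℝ w (z.1 + z.2 • v)‖ ^ 2) :=
      ENNReal.continuous_ofReal.comp (by fun_prop)
    exact this.measurable.aemeasurable

/-- The value `w x` is compared with the mean of `w` over a ball containing `x`. That ball lies in
the ball of radius `2h` about `x`, so the oscillation becomes an integral over translations `v` from
a set independent of `x`, ready for Fubini. -/
theorem ofReal_sq_le_ball (hw : Continuous w) {h : ℝ} (hh : 0 < h) {x z : Eucl n}
    (hz : x ∈ Metric.ball z h) :
    ENNReal.ofReal (w x ^ 2) ≤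
      ENNReal.ofReal (2 / volume.real (Metric.ball (0 : Eucl n) h) ^ 2 *
        (∫ y in Metric.ball z h, w y) ^ 2) +
      ENNReal.ofReal (2 / volume.real (Metric.ball (0 : Eucl n) h)) *
        ∫⁻ v in Metric.ball (0 : Eucl n) (2 * h), ENNReal.ofReal ((w (x + v) - w x) ^ 2) := by
  set b := volume.real (Metric.ball (0 : Eucl n) h) with hb
  have hbz : volume.real (Metric.ball z h) = b := by
    rw [hb, measureReal_def, measureReal_def, Measure.addHaar_ball_center]
  have hb0 : 0 < b := ENNReal.toReal_pos (Metric.measure_ball_pos _ _ hh).ne'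
    measure_ball_lt_top.ne
  have hint : ∀ {f : Eucl n → ℝ} (_ : Continuous f), IntegrableOn f (Metric.ball z h) :=
    fun hf => (hf.continuousOn.integrableOn_compact (isCompact_closedBall z h)).mono_set
      Metric.ball_subset_closedBall
  have : IsFiniteMeasure (volume.restrict (Metric.ball z h)) :=
    ⟨by simpa using measure_ball_lt_top⟩
  have hi1 : IntegrableOn (fun y => w y - w x) (Metric.ball z h) := hint (by fun_prop)
  have hi2 : IntegrableOn (fun y => (w y - w x) ^ 2) (Metric.ball z h) := hint (by fun_prop)
  have hreal : w x ^ 2 ≤ 2 / b ^ 2 * (∫ y in Metric.ball z h, w y) ^ 2 +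
      2 / b * ∫ y in Metric.ball z h, (w y - w x) ^ 2 := by
    have h1 := sq_integral_le (volume.restrict (Metric.ball z h)) hi1 hi2
    rw [integral_sub (hint hw) (integrable_const _), integral_const, smul_eq_mul,
      measureReal_restrict_apply_univ, hbz] at h1
    set P := ∫ y in Metric.ball z h, w y with hP
    set Q := ∫ y in Metric.ball z h, (w y - w x) ^ 2 with hQ
    have h2 : (b * w x) ^ 2 ≤ 2 * P ^ 2 + 2 * (b * Q) := by
      -- From `(P - b w x)² ≤ b Q`; the hint is the square completing `(b w x)² ≤ 2 P² + 2 (P - b w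
      -- x)²`.
      nlinarith [sq_nonneg (P + (P - b * w x))]
    have h3 : 2 / b ^ 2 * P ^ 2 + 2 / b * Q = (2 * P ^ 2 + 2 * (b * Q)) / b ^ 2 := by
      field_simp
    rw [h3, le_div_iff₀ (by positivity)]
    nlinarith
  refine (ENNReal.ofReal_le_ofReal hreal).trans (ENNReal.ofReal_add_le.trans ?_)
  gcongr
  rw [ENNReal.ofReal_mul (by positivity)]
  gcongr
  rw [ofReal_integral_eq_lintegral_ofReal hi2 (Eventually.of_forall fun y => sq_nonneg _)]
  have h4 := (measurePreserving_add_left (volume : Measure (Eucl n)) x).setLIntegral_comp_preimage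
    (s := Metric.ball x (2 * h)) Metric.isOpen_ball.measurableSet
    (f := fun y => ENNReal.ofReal ((w y - w x) ^ 2))
    (((hw.sub continuous_const).pow 2).measurable.ennreal_ofReal)
  have h5 : (x + ·) ⁻¹' Metric.ball x (2 * h) = Metric.ball (0 : Eucl n) (2 * h) := by
    ext v
    simp
  rw [h5] at h4
  rw [h4]
  refine lintegral_mono_set (Metric.ball_subset_ball' ?_)
  rw [dist_comm]
  linarith [Metric.mem_ball.1 hz]

/-- Each point of `K` lies in some ball of the cover, whose mean is bounded by the sum over all of
them. The oscillation term is integrated once over translations, so its constant does not see how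
many balls are used, and it tends to zero with `h`. -/
theorem lintegral_sq_le_of_cover (hw : ContDiff ℝ 1 w) {K : Set (Eucl n)} (hK : MeasurableSet K)
    (hwK : ∀ x ∉ K, w x = 0) {h : ℝ} (hh : 0 < h) {t : Finset (Eucl n)}
    (ht : K ⊆ ⋃ z ∈ t, Metric.ball z h) :
    ∫⁻ x, ENNReal.ofReal (w x ^ 2) ≤
      ENNReal.ofReal (2 / volume.real (Metric.ball (0 : Eucl n) h) ^ 2 *
        ∑ z ∈ t, (∫ y in Metric.ball z h, w y) ^ 2) * volume K +
      ENNReal.ofReal (2 ^ (n + 3) * h ^ 2) * ∫⁻ x, ENNReal.ofReal (‖fderiv ℝ w x‖ ^ 2) := by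
  set b := volume.real (Metric.ball (0 : Eucl n) h) with hb
  have hb0 : 0 < b := ENNReal.toReal_pos (Metric.measure_ball_pos _ _ hh).ne'
    measure_ball_lt_top.ne
  set I := ∫⁻ x, ENNReal.ofReal (‖fderiv ℝ w x‖ ^ 2) with hI
  set S := 2 / b ^ 2 * ∑ z ∈ t, (∫ y in Metric.ball z h, w y) ^ 2 with hS
  have h1 : ∀ x ∈ K, ENNReal.ofReal (w x ^ 2) ≤ ENNReal.ofReal S + ENNReal.ofReal (2 / b) *
      ∫⁻ v in Metric.ball (0 : Eucl n) (2 * h), ENNReal.ofReal ((w (x + v) - w x) ^ 2) := by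
    intro x hx
    obtain ⟨z, hz, hxz⟩ := mem_iUnion₂.1 (ht hx)
    refine (ofReal_sq_le_ball hw.continuous hh hxz).trans ?_
    gcongr
    exact mul_le_mul_of_nonneg_left (Finset.single_le_sum
      (f := fun z => (∫ y in Metric.ball z h, w y) ^ 2) (fun _ _ => sq_nonneg _) hz)
      (by positivity)
  have h2 : ∫⁻ x, ENNReal.ofReal (w x ^ 2) = ∫⁻ x in K, ENNReal.ofReal (w x ^ 2) := by
    refine (setLIntegral_eq_of_support_subset ?_).symm
    intro x hx
    by_contra hxK
    simp [hwK x hxK] at hx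
  have hcw : Continuous fun z : Eucl n × Eucl n =>
      ENNReal.ofReal ((w (z.1 + z.2) - w z.1) ^ 2) := by
    have := hw.continuous
    exact ENNReal.continuous_ofReal.comp (by fun_prop)
  have h3 : ∫⁻ x, ∫⁻ v in Metric.ball (0 : Eucl n) (2 * h),
      ENNReal.ofReal ((w (x + v) - w x) ^ 2) ≤
      ENNReal.ofReal ((2 * h) ^ 2) * I * volume (Metric.ball (0 : Eucl n) (2 * h)) := by
    rw [lintegral_lintegral_swap hcw.measurable.aemeasurable, ← setLIntegral_const]
    refine setLIntegral_mono measurable_const fun v hv => ?_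
    refine (lintegral_translate_sub_sq_le hw v).trans ?_
    have hv' : ‖v‖ ≤ 2 * h := by simpa using (mem_ball_zero_iff.1 hv).le
    gcongr
  -- The factor `2 ^ (n + 3) h²` is `(2 / b) · (2h)² · 2 ^ n b`.
  have hvol : volume (Metric.ball (0 : Eucl n) (2 * h)) = ENNReal.ofReal (2 ^ n * b) := by
    rw [Measure.addHaar_ball_mul_of_pos _ _ two_pos, ENNReal.ofReal_mul (by positivity), hb,
      ofReal_measureReal measure_ball_lt_top.ne]
    simp
  calc ∫⁻ x, ENNReal.ofReal (w x ^ 2) = ∫⁻ x in K, ENNReal.ofReal (w x ^ 2) := h2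
    _ ≤ ∫⁻ x in K, (ENNReal.ofReal S + ENNReal.ofReal (2 / b) *
        ∫⁻ v in Metric.ball (0 : Eucl n) (2 * h), ENNReal.ofReal ((w (x + v) - w x) ^ 2)) :=
        setLIntegral_mono' hK h1
    _ = ENNReal.ofReal S * volume K + ENNReal.ofReal (2 / b) * ∫⁻ x in K,
        ∫⁻ v in Metric.ball (0 : Eucl n) (2 * h), ENNReal.ofReal ((w (x + v) - w x) ^ 2) := by
        rw [lintegral_add_left measurable_const, setLIntegral_const,
          lintegral_const_mul' _ _ ENNReal.ofReal_ne_top]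
    _ ≤ ENNReal.ofReal S * volume K + ENNReal.ofReal (2 / b) *
        (ENNReal.ofReal ((2 * h) ^ 2) * I * volume (Metric.ball (0 : Eucl n) (2 * h))) := by
        gcongr
        exact (setLIntegral_le_lintegral _ _).trans h3
    _ = ENNReal.ofReal S * volume K + ENNReal.ofReal (2 ^ (n + 3) * h ^ 2) * I := by
        congr 1
        rw [hvol, mul_comm (ENNReal.ofReal ((2 * h) ^ 2)) I, mul_assoc I, mul_left_comm,
          ← ENNReal.ofReal_mul (by positivity), ← ENNReal.ofReal_mul (by positivity), mul_comm I]
        congr 2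
        field_simp
        ring

theorem integral_sq_le_of_cover (hw : ContDiff ℝ 1 w) {K : Set (Eucl n)} (hK : IsCompact K)
    (hwK : tsupport w ⊆ K) {h : ℝ} (hh : 0 < h) {t : Finset (Eucl n)}
    (ht : K ⊆ ⋃ z ∈ t, Metric.ball z h) :
    ∫ x, w x ^ 2 ≤ 2 / volume.real (Metric.ball (0 : Eucl n) h) ^ 2 *
        (∑ z ∈ t, (∫ y in Metric.ball z h, w y) ^ 2) * volume.real K +
      2 ^ (n + 3) * h ^ 2 * ∫ x, ‖fderiv ℝ w x‖ ^ 2 := by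
  have hcs : HasCompactSupport w := hK.of_isClosed_subset (isClosed_tsupport w) hwK
  have h1 := lintegral_sq_le_of_cover hw hK.measurableSet
    (fun x hx => image_eq_zero_of_notMem_tsupport fun hx' => hx (hwK hx')) hh ht
  have hs1 : HasCompactSupport fun x => w x ^ 2 :=
    hcs.mono fun x hx hx0 => hx (by simp [hx0])
  have hs2 : HasCompactSupport fun x => ‖fderiv ℝ w x‖ ^ 2 :=
    (hcs.fderiv ℝ).mono fun x hx hx0 => hx (by simp [hx0])
  have hc1 : Continuous fun x => w x ^ 2 := hw.continuous.pow 2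
  have hc2 : Continuous fun x => ‖fderiv ℝ w x‖ ^ 2 := (hw.continuous_fderiv (by simp)).norm.pow 2
  have hi1 := hc1.integrable_of_hasCompactSupport (μ := volume) hs1
  have hi2 := hc2.integrable_of_hasCompactSupport (μ := volume) hs2
  have hS : 0 ≤ 2 / volume.real (Metric.ball (0 : Eucl n) h) ^ 2 *
      ∑ z ∈ t, (∫ y in Metric.ball z h, w y) ^ 2 :=
    mul_nonneg (by positivity) (Finset.sum_nonneg fun _ _ => sq_nonneg _)
  have hI : 0 ≤ ∫ x, ‖fderiv ℝ w x‖ ^ 2 := integral_nonneg fun x => sq_nonneg _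
  have hc : (0 : ℝ) ≤ 2 ^ (n + 3) * h ^ 2 := by positivity
  have hK0 : 0 ≤ volume.real K := measureReal_nonneg
  rw [← ofReal_integral_eq_lintegral_ofReal hi1 (Eventually.of_forall fun _ => sq_nonneg _),
    ← ofReal_integral_eq_lintegral_ofReal hi2 (Eventually.of_forall fun _ => sq_nonneg _),
    ← ofReal_measureReal hK.measure_lt_top.ne, ← ENNReal.ofReal_mul hS,
    ← ENNReal.ofReal_mul hc, ← ENNReal.ofReal_add (mul_nonneg hS hK0) (mul_nonneg hc hI)] at h1
  exact (ENNReal.ofReal_le_ofReal_iff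
    (add_nonneg (mul_nonneg hS hK0) (mul_nonneg hc hI))).1 h1

/-- The quantitative form of Rellich's theorem: the radius is fixed by `ε`, and compactness of `K`
makes the number of balls finite. -/
theorem exists_finset_integral_sq_le {K : Set (Eucl n)} (hK : IsCompact K) {ε : ℝ} (hε : 0 < ε) :
    ∃ (t : Finset (Eucl n)) (h A : ℝ), 0 ≤ A ∧ ∀ w : Eucl n → ℝ, ContDiff ℝ 1 w →
      tsupport w ⊆ K → ∫ x, w x ^ 2 ≤ ε * (∫ x, ‖fderiv ℝ w x‖ ^ 2) +
        A * ∑ z ∈ t, (∫ y in Metric.ball z h, w y) ^ 2 := by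
  obtain ⟨h, hh0, hhε⟩ : ∃ h : ℝ, 0 < h ∧ 2 ^ (n + 3) * h ^ 2 = ε := by
    refine ⟨√(ε / 2 ^ (n + 3)), Real.sqrt_pos.2 (by positivity), ?_⟩
    rw [Real.sq_sqrt (by positivity)]
    field_simp
  obtain ⟨t, -, htf, ht⟩ := hK.finite_cover_balls hh0
  refine ⟨htf.toFinset, h, 2 / volume.real (Metric.ball (0 : Eucl n) h) ^ 2 * volume.real K,
    by positivity, fun w hw hwK => ?_⟩
  have h1 := integral_sq_le_of_cover hw hK hwK hh0 (t := htf.toFinset) (by simpa using ht)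
  rw [hhε] at h1
  linarith

end Translation

theorem norm_fderiv_sq_le {n : ℕ} (f : Eucl n → ℝ) (p : Eucl n) :
    ‖fderiv ℝ f p‖ ^ 2 ≤ ∑ i, pderiv i f p ^ 2 := by
  have hS : 0 ≤ ∑ i, pderiv i f p ^ 2 := Finset.sum_nonneg fun _ _ => sq_nonneg _
  have h : ‖fderiv ℝ f p‖ ≤ √(∑ i, pderiv i f p ^ 2) := by
    refine ContinuousLinearMap.opNorm_le_bound _ (Real.sqrt_nonneg _) fun v => ?_
    rw [← sum_mul_apply_single, EuclideanSpace.norm_eq, ← Real.sqrt_mul hS]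
    refine Real.abs_le_sqrt ?_
    rw [mul_comm]
    simpa [pderiv] using Finset.sum_mul_sq_le_sq_mul_sq Finset.univ (fun i => v i)
      fun i => fderiv ℝ f p (EuclideanSpace.single i 1)
  calc ‖fderiv ℝ f p‖ ^ 2 ≤ √(∑ i, pderiv i f p ^ 2) ^ 2 := by gcongr
    _ = _ := Real.sq_sqrt hS

/-! ### Finitely many functionals controlling a function on a compact set -/

theorem IsTest.mul {n : ℕ} {Ω : Set (Eucl n)} {f χ : Eucl n → ℝ} (hχ : ContDiff ℝ 2 χ)
    (hf : IsTest Ω f) : IsTest Ω fun p => χ p * f p :=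
  ⟨hχ.mul hf.contDiff, hf.hasCompactSupport.mul_left,
    (tsupport_mul_subset_right (f := χ) (g := f)).trans hf.tsupport_subset⟩

theorem exists_isTest_one {n : ℕ} {Ω K : Set (Eucl n)} (hΩ : IsOpen Ω) (hK : IsCompact K)
    (hKΩ : K ⊆ Ω) : ∃ χ, IsTest Ω χ ∧ ∀ p ∈ K, χ p = 1 := by
  obtain ⟨L, hL, hKL, hLΩ⟩ := exists_compact_between hK hΩ hKΩ
  obtain ⟨f, hf1, hf0, -⟩ := exists_contMDiffMap_one_nhds_of_subset_interior
    (modelWithCornersSelf ℝ (Eucl n)) (n := 2) hK.isClosed hKL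
  have hsub : tsupport f ⊆ L := closure_minimal (fun p hp => by
    by_contra hpL
    exact hp (hf0 p hpL)) hL.isClosed
  exact ⟨f, ⟨f.contMDiff.contDiff, hL.of_isClosed_subset (isClosed_tsupport _) hsub,
    hsub.trans hLΩ⟩, fun p hp => hf1.self_of_nhdsSet p hp⟩

theorem exists_le_mul_of_continuousOn {n : ℕ} {Ω L : Set (Eucl n)} {φ v : Eucl n → ℝ}
    (hL : IsCompact L) (hLΩ : L ⊆ Ω) (hφ : Continuous φ) (h0 : ∀ p ∉ L, φ p = 0)
    (hv : ContinuousOn v Ω) (hpos : ∀ p ∈ Ω, 0 < v p) :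
    ∃ C : ℝ, 0 ≤ C ∧ ∀ p ∈ Ω, φ p ≤ C * v p := by
  obtain ⟨C, hC⟩ := hL.exists_bound_of_continuousOn
    ((hφ.continuousOn.div hv fun p hp => (hpos p hp).ne').mono hLΩ)
  refine ⟨max C 0, le_max_right _ _, fun p hp => ?_⟩
  by_cases hpL : p ∈ L
  · rw [← div_le_iff₀ (hpos p hp)]
    exact (le_abs_self _).trans ((hC p hpL).trans (le_max_left _ _))
  · rw [h0 p hpL]
    exact mul_nonneg (le_max_right _ _) (hpos p hp).le

namespace ScaleInvariantDomain

variable {n : ℕ} (D : ScaleInvariantDomain n)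

theorem integral_sq_mul_le {χ : Eucl n → ℝ} (hχ : IsTest D.Ω χ) (a b : ℝ) :
    ∃ C : ℝ, 0 ≤ C ∧ ∀ f, IsTest D.Ω f →
      ∫ p, (χ p * f p) ^ 2 ≤ C * ∫ p in D.Ω, D.powWeight a b p * f p ^ 2 := by
  obtain ⟨C, hC0, hC⟩ := exists_le_mul_of_continuousOn (φ := fun p => χ p ^ 2)
    hχ.hasCompactSupport hχ.tsupport_subset (hχ.contDiff.continuous.pow 2)
    (fun p hp => by simp [IsTest.eq_zero hp]) (D.continuousOn_powWeight a b)
    fun p hp => D.powWeight_pos a b hp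
  refine ⟨C, hC0, fun f hf => ?_⟩
  have hw := hf.mul hχ.contDiff
  rw [← setIntegral_eq_integral_of_forall_compl_eq_zero (s := D.Ω), ← integral_const_mul]
  · refine setIntegral_mono_on ?_ ((hf.integrableOn_sq D.isOpen
      (D.tame_powWeight a b)).const_mul C) D.isOpen.measurableSet fun p hp => ?_
    · simpa only [one_mul] using hw.integrableOn_sq D.isOpen (Tame.const 1)
    · rw [mul_pow, ← mul_assoc]
      exact mul_le_mul_of_nonneg_right (hC p hp) (sq_nonneg _)
  · intro p hp
    simp [IsTest.eq_zero fun h => hp (hf.tsupport_subset h)]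

/-- This makes the ball integrals continuous for the weighted norm, so that they extend to the
completion. -/
theorem sq_integral_ball_le {χ : Eucl n → ℝ} (hχ : IsTest D.Ω χ) (a b : ℝ) (z : Eucl n)
    (h : ℝ) : ∃ C : ℝ, 0 ≤ C ∧ ∀ f, IsTest D.Ω f →
      (∫ p in Metric.ball z h, χ p * f p) ^ 2 ≤
        C * ∫ p in D.Ω, D.powWeight a b p * f p ^ 2 := by
  obtain ⟨C, hC0, hC⟩ := D.integral_sq_mul_le hχ a b
  refine ⟨volume.real (Metric.ball z h) * C, mul_nonneg measureReal_nonneg hC0, fun f hf => ?_⟩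
  have hw := hf.mul hχ.contDiff
  have hc := hw.contDiff.continuous
  have : IsFiniteMeasure (volume.restrict (Metric.ball z h)) :=
    ⟨by simpa using measure_ball_lt_top⟩
  have hi2 : Integrable fun p => (χ p * f p) ^ 2 := by
    simp only [pow_two]
    exact hw.integrable ((hw.tame D.isOpen).mul (hw.tame D.isOpen)) fun p hp => by
      rw [IsTest.eq_zero hp, zero_mul]
  have hi : Integrable fun p => χ p * f p :=
    hw.integrable (hw.tame D.isOpen) fun p hp => IsTest.eq_zero hp
  refine (sq_integral_le _ hi.integrableOn hi2.integrableOn).trans ?_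
  rw [measureReal_restrict_apply_univ, mul_assoc]
  refine mul_le_mul_of_nonneg_left ?_ measureReal_nonneg
  exact (setIntegral_le_integral hi2 (Eventually.of_forall fun _ => sq_nonneg _)).trans (hC f hf)

theorem integral_norm_fderiv_mul_sq_le {χ : Eucl n → ℝ} (hχ : IsTest D.Ω χ) (a b a' b' : ℝ) :
    ∃ C : ℝ, 0 ≤ C ∧ ∀ f, IsTest D.Ω f →
      ∫ p, ‖fderiv ℝ (fun q => χ q * f q) p‖ ^ 2 ≤
        C * ((∫ p in D.Ω, D.powWeight a b p * f p ^ 2) +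
          ∑ i, (∫ p in D.Ω, D.powWeight a' b' p * pderiv i f p ^ 2)) := by
  obtain ⟨C, hC0, hC⟩ := exists_le_mul_of_continuousOn (φ := fun p => χ p ^ 2)
    hχ.hasCompactSupport hχ.tsupport_subset (hχ.contDiff.continuous.pow 2)
    (fun p hp => by simp [IsTest.eq_zero hp]) (D.continuousOn_powWeight a' b')
    fun p hp => D.powWeight_pos a' b' hp
  choose C' hC'0 hC' using fun i => exists_le_mul_of_continuousOn
    (φ := fun p => pderiv i χ p ^ 2) hχ.hasCompactSupport hχ.tsupport_subset ((hχ.continuous_pderiv i).pow 2)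
    (fun p hp => by simp [IsTest.pderiv_eq_zero i hp]) (D.continuousOn_powWeight a b)
    fun p hp => D.powWeight_pos a b hp
  refine ⟨2 * C + 2 * ∑ i, C' i, add_nonneg (by positivity) (mul_nonneg two_pos.le
    (Finset.sum_nonneg fun i _ => hC'0 i)), fun f hf => ?_⟩
  have hw := hf.mul hχ.contDiff
  have hpw : ∀ i p, pderiv i (fun q => χ q * f q) p = χ p * pderiv i f p + f p * pderiv i χ p :=
    fun i p => by
      rw [pderiv, fderiv_fun_mul (hχ.contDiff.differentiable (by simp) p)
        (hf.contDiff.differentiable (by simp) p)]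
      simp [pderiv]
  have hfI := hf.integrableOn_sq D.isOpen (D.tame_powWeight a b)
  have hfJ := hf.integrableOn_pderiv_sq D.isOpen (D.tame_powWeight a' b')
  have hwJ : ∀ i, Integrable fun p => pderiv i (fun q => χ q * f q) p ^ 2 := fun i => by
    simp only [pow_two]
    exact hw.integrable ((hw.tame_pderiv D.isOpen i).mul (hw.tame_pderiv D.isOpen i))
      fun p hp => by rw [IsTest.pderiv_eq_zero i hp, zero_mul]
  have h1 : ∫ p, ‖fderiv ℝ (fun q => χ q * f q) p‖ ^ 2 ≤
      ∑ i, ∫ p, pderiv i (fun q => χ q * f q) p ^ 2 := by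
    rw [← integral_finsetSum _ fun i _ => hwJ i]
    refine integral_mono_of_nonneg (Eventually.of_forall fun p => sq_nonneg _)
      (integrable_finsetSum _ fun i _ => hwJ i)
      (Eventually.of_forall fun p => norm_fderiv_sq_le _ p)
  set I := ∫ p in D.Ω, D.powWeight a b p * f p ^ 2 with hI
  set J : Fin n → ℝ := fun i => ∫ p in D.Ω, D.powWeight a' b' p * pderiv i f p ^ 2 with hJ
  have hI0 : 0 ≤ I := setIntegral_nonneg D.isOpen.measurableSet fun p hp =>
    mul_nonneg (D.powWeight_pos _ _ hp).le (sq_nonneg _)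
  have hJ0 : ∀ i, 0 ≤ J i := fun i => setIntegral_nonneg D.isOpen.measurableSet fun p hp =>
    mul_nonneg (D.powWeight_pos _ _ hp).le (sq_nonneg _)
  have h2 : ∀ i, ∫ p, pderiv i (fun q => χ q * f q) p ^ 2 ≤ 2 * C' i * I + 2 * C * J i := by
    intro i
    rw [← setIntegral_eq_integral_of_forall_compl_eq_zero (s := D.Ω), ← integral_const_mul,
      ← integral_const_mul, ← integral_add (hfI.const_mul _) ((hfJ i).const_mul _)]
    · refine setIntegral_mono_on (hwJ i).integrableOn
        ((hfI.const_mul _).add ((hfJ i).const_mul _)) D.isOpen.measurableSet fun p hp => ?_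
      rw [hpw]
      have h3 := mul_le_mul_of_nonneg_right (hC p hp) (sq_nonneg (pderiv i f p))
      have h4 := mul_le_mul_of_nonneg_right (hC' i p hp) (sq_nonneg (f p))
      nlinarith [sq_nonneg (χ p * pderiv i f p - f p * pderiv i χ p)]
    · intro p hp
      rw [IsTest.pderiv_eq_zero i fun h => hp (hw.tsupport_subset h)]
      simp
  refine h1.trans ((Finset.sum_le_sum fun i _ => h2 i).trans ?_)
  rw [Finset.sum_add_distrib, ← Finset.sum_mul, ← Finset.mul_sum, ← Finset.mul_sum]
  have h5 : 0 ≤ ∑ i, J i := Finset.sum_nonneg fun i _ => hJ0 i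
  have h6 : 0 ≤ ∑ i, C' i := Finset.sum_nonneg fun i _ => hC'0 i
  nlinarith [mul_nonneg hC0 hI0, mul_nonneg h6 h5]

/-- The small-ball inequality is applied to `χ f`, with `χ = 1` on `K`. On the support of `χ` all
weights are comparable to constants, so its Dirichlet energy is bounded by the weighted norms of `f`
and `∂f`, whatever the exponents. -/
theorem exists_functionals {K : Set (Eucl n)} (hK : IsCompact K) (hKΩ : K ⊆ D.Ω)
    (a b a' b' : ℝ) : ∃ χ, IsTest D.Ω χ ∧ ∀ ε : ℝ, 0 < ε →
      ∃ (t : Finset (Eucl n)) (h A : ℝ), 0 ≤ A ∧ ∀ f, IsTest D.Ω f →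
        ∫ p in K, f p ^ 2 ≤ ε * ((∫ p in D.Ω, D.powWeight a b p * f p ^ 2) +
          ∑ i, (∫ p in D.Ω, D.powWeight a' b' p * pderiv i f p ^ 2)) +
          A * ∑ z ∈ t, (∫ p in Metric.ball z h, χ p * f p) ^ 2 := by
  obtain ⟨χ, hχ, hχ1⟩ := exists_isTest_one D.isOpen hK hKΩ
  refine ⟨χ, hχ, fun ε hε => ?_⟩
  obtain ⟨C, hC0, hC⟩ := D.integral_norm_fderiv_mul_sq_le hχ a b a' b'
  obtain ⟨t, h, A, hA, ht⟩ := exists_finset_integral_sq_le (K := tsupport χ)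
    hχ.hasCompactSupport (ε := ε / (C + 1)) (by positivity)
  refine ⟨t, h, A, hA, fun f hf => ?_⟩
  have hw := hf.mul hχ.contDiff
  have hi2 : Integrable fun p => (χ p * f p) ^ 2 := by
    simp only [pow_two]
    exact hw.integrable ((hw.tame D.isOpen).mul (hw.tame D.isOpen)) fun p hp => by
      rw [IsTest.eq_zero hp, zero_mul]
  have h1 := ht _ (hw.contDiff.of_le (by norm_num)) (tsupport_mul_subset_left (f := χ) (g := f))
  have h2 := hC f hf
  set Q := (∫ p in D.Ω, D.powWeight a b p * f p ^ 2) +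
    ∑ i, (∫ p in D.Ω, D.powWeight a' b' p * pderiv i f p ^ 2) with hQ
  have hQ0 : 0 ≤ Q := add_nonneg
    (setIntegral_nonneg D.isOpen.measurableSet fun p hp =>
      mul_nonneg (D.powWeight_pos _ _ hp).le (sq_nonneg _))
    (Finset.sum_nonneg fun i _ => setIntegral_nonneg D.isOpen.measurableSet fun p hp =>
      mul_nonneg (D.powWeight_pos _ _ hp).le (sq_nonneg _))
  have h3 : ε / (C + 1) * (∫ p, ‖fderiv ℝ (fun q => χ q * f q) p‖ ^ 2) ≤ ε * Q := by
    calc ε / (C + 1) * (∫ p, ‖fderiv ℝ (fun q => χ q * f q) p‖ ^ 2)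
        ≤ ε / (C + 1) * ((C + 1) * Q) := by
          refine mul_le_mul_of_nonneg_left (h2.trans ?_) (by positivity)
          exact mul_le_mul_of_nonneg_right (by linarith) hQ0
      _ = ε * Q := by field_simp
  calc ∫ p in K, f p ^ 2 = ∫ p in K, (χ p * f p) ^ 2 :=
        setIntegral_congr_fun hK.measurableSet fun p hp => by simp [hχ1 p hp]
    _ ≤ ∫ p, (χ p * f p) ^ 2 :=
        setIntegral_le_integral hi2 (Eventually.of_forall fun _ => sq_nonneg _)
    _ ≤ _ := h1.trans (by linarith)

end ScaleInvariantDomain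

/-! ### The a priori estimate for tensor fields -/

section TensorEstimate

variable {n : ℕ} {D : ScaleInvariantDomain n} {G : AEMetric n} {k l : ℕ}

theorem weight_eq (D : ScaleInvariantDomain n) (G : AEMetric n) (a b : ℝ) (p : Eucl n) :
    weight D G a b p = D.powWeight a b p * √(G.g p).det := rfl

/-- The weighted `L²` norm of the components of a tensor field. -/
noncomputable def compNormSq (D : ScaleInvariantDomain n) (a b : ℝ) (u : TensorField n k l) : ℝ :=
  ∑ I, ∫ p in D.Ω, D.powWeight a b p * u p I ^ 2

theorem integral_powWeight_nonneg (D : ScaleInvariantDomain n) (a b : ℝ) (f : Eucl n → ℝ) :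
    0 ≤ ∫ p in D.Ω, D.powWeight a b p * f p ^ 2 :=
  setIntegral_nonneg D.isOpen.measurableSet fun _ hp =>
    mul_nonneg (D.powWeight_pos _ _ hp).le (sq_nonneg _)

theorem compNormSq_nonneg (D : ScaleInvariantDomain n) (a b : ℝ) (u : TensorField n k l) :
    0 ≤ compNormSq D a b u :=
  Finset.sum_nonneg fun _ _ => integral_powWeight_nonneg D a b _

theorem exists_weight_bounds (D : ScaleInvariantDomain n) (G : AEMetric n) (k l : ℕ) (a b : ℝ) :
    ∃ c C : ℝ, 0 < c ∧ 0 < C ∧ ∀ p ∈ D.Ω, ∀ S : Tensor n k l,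
      D.powWeight a b p * ∑ I, S I ^ 2 ≤ c * (weight D G a b p * G.tensorInner p S S) ∧
        weight D G a b p * G.tensorInner p S S ≤ C * (D.powWeight a b p * ∑ I, S I ^ 2) := by
  obtain ⟨c, C, hc, hC, h⟩ := G.exists_tensorInner_bounds k l
  obtain ⟨c', C', hc', hC', h'⟩ := G.exists_sqrt_det_bounds
  refine ⟨(c' * c)⁻¹, C' * C, by positivity, by positivity, fun p hp S => ⟨?_, ?_⟩⟩
  · rw [le_inv_mul_iff₀ (by positivity), weight_eq]
    have hw := (D.powWeight_pos a b hp).le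
    have hS : 0 ≤ ∑ I, S I ^ 2 := Finset.sum_nonneg fun _ _ => sq_nonneg _
    calc c' * c * (D.powWeight a b p * ∑ I, S I ^ 2)
        = D.powWeight a b p * c' * (c * ∑ I, S I ^ 2) := by ring
      _ ≤ D.powWeight a b p * √(G.g p).det * G.tensorInner p S S := by
        refine mul_le_mul (mul_le_mul_of_nonneg_left (h' p).1 hw) (h p S).1 (by positivity)
          (mul_nonneg hw (Real.sqrt_nonneg _))
  · rw [weight_eq]
    have hw := (D.powWeight_pos a b hp).le
    calc D.powWeight a b p * √(G.g p).det * G.tensorInner p S S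
        ≤ D.powWeight a b p * C' * (C * ∑ I, S I ^ 2) :=
          mul_le_mul (mul_le_mul_of_nonneg_left (h' p).2 hw) (h p S).2
            (G.tensorInner_self_nonneg p S) (mul_nonneg hw hC'.le)
      _ = C' * C * (D.powWeight a b p * ∑ I, S I ^ 2) := by ring

theorem IsL2.integrableOn_component {a b : ℝ} {u : TensorField n k l} (hu : IsL2 D G a b u)
    (I : TIdx n k l) : IntegrableOn (fun p => D.powWeight a b p * u p I ^ 2) D.Ω := by
  obtain ⟨c, C, hc, hC, h⟩ := exists_weight_bounds D G k l a b
  refine Integrable.mono' (hu.2.const_mul c) ((D.tame_powWeight a b).1.mul ((hu.1 I).pow 2)) ?_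
  refine (ae_restrict_iff' D.isOpen.measurableSet).2 (Eventually.of_forall fun p hp => ?_)
  have hw := (D.powWeight_pos a b hp).le
  rw [Real.norm_of_nonneg (mul_nonneg hw (sq_nonneg _))]
  refine le_trans ?_ (h p hp (u p)).1
  exact mul_le_mul_of_nonneg_left (Finset.single_le_sum (f := fun J => u p J ^ 2)
    (fun _ _ => sq_nonneg _) (Finset.mem_univ I)) hw

theorem IsL2.compNormSq_eq {a b : ℝ} {u : TensorField n k l} (hu : IsL2 D G a b u) :
    compNormSq D a b u = ∫ p in D.Ω, D.powWeight a b p * ∑ I, u p I ^ 2 := by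
  simp only [Finset.mul_sum]
  exact (integral_finsetSum _ fun I _ => hu.integrableOn_component I).symm

theorem IsL2.integrableOn_sum {a b : ℝ} {u : TensorField n k l} (hu : IsL2 D G a b u) :
    IntegrableOn (fun p => D.powWeight a b p * ∑ I, u p I ^ 2) D.Ω := by
  simp only [Finset.mul_sum]
  exact integrable_finsetSum _ fun I _ => hu.integrableOn_component I

theorem exists_compNormSq_bounds (D : ScaleInvariantDomain n) (G : AEMetric n) (k l : ℕ)
    (a b : ℝ) : ∃ c C : ℝ, 0 < c ∧ 0 < C ∧ ∀ u : TensorField n k l, IsL2 D G a b u →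
      compNormSq D a b u ≤ c * (∫ p in D.Ω, weight D G a b p * G.tensorInner p (u p) (u p)) ∧
        (∫ p in D.Ω, weight D G a b p * G.tensorInner p (u p) (u p)) ≤
          C * compNormSq D a b u := by
  obtain ⟨c, C, hc, hC, h⟩ := exists_weight_bounds D G k l a b
  refine ⟨c, C, hc, hC, fun u hu => ⟨?_, ?_⟩⟩
  · rw [hu.compNormSq_eq, ← integral_const_mul]
    exact setIntegral_mono_on hu.integrableOn_sum (hu.2.const_mul c) D.isOpen.measurableSet
      fun p hp => (h p hp (u p)).1
  · rw [hu.compNormSq_eq, ← integral_const_mul]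
    exact setIntegral_mono_on hu.2 (hu.integrableOn_sum.const_mul C) D.isOpen.measurableSet
      fun p hp => (h p hp (u p)).2

theorem isTest_component {u : TensorField n k l} (hu : u ∈ testFields D k l) (I : TIdx n k l) :
    IsTest D.Ω fun p => u p I := by
  have hs : Function.support (fun p => u p I) ⊆ Function.support u :=
    fun p hp h0 => hp (by simp [h0])
  exact ⟨contDiff_component hu I, hu.2.1.mono hs, (closure_mono hs).trans hu.2.2⟩

/-- The hypothesis on `K`, `ε`, `M` serves two regimes: a small `ε` with a core as `K`, and a large
`ε` with empty `K`. -/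
theorem integral_pderiv_sq_le (D : ScaleInvariantDomain n) (G : AEMetric n) {σ μ : ℝ}
    {K : Set (Eucl n)} (hK : IsCompact K) (hKΩ : K ⊆ D.Ω) {ε M : ℝ}
    (hKεM : ∀ p ∈ D.Ω, D.powWeight (σ + 1) μ p * G.christoffelSq p ≤
      ε * D.powWeight σ μ p + K.indicator (fun _ => M) p)
    {u : TensorField n k l} (hu : u ∈ testFields D k l) (i : Fin n) (I : TIdx n k l) :
    ∫ p in D.Ω, D.powWeight (σ + 1) μ p * pderiv i (fun q => u q I) p ^ 2 ≤
      2 * compNormSq D (σ + 1) μ (G.nabla u) + 2 * ((k + l) * n) ^ 2 *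
        (ε * compNormSq D σ μ u + M * ∑ J, ∫ p in K, u p J ^ 2) := by
  have h1 := isL2_of_mem (G := G) hu σ μ
  have h2 := isL2_nabla_of_mem (G := G) hu (σ + 1) μ
  have hKm := hK.measurableSet
  have hindJ : ∀ J : TIdx n k l, IntegrableOn (fun p => u p J ^ 2) D.Ω := fun J => by
    simpa only [one_mul] using (isTest_component hu J).integrableOn_sq D.isOpen (Tame.const 1)
  have hind : IntegrableOn (K.indicator fun p => ∑ J, u p J ^ 2) D.Ω :=
    Integrable.indicator (integrable_finsetSum _ fun J _ => hindJ J) hKm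
  have hindeq : ∑ J, ∫ p in K, u p J ^ 2 = ∫ p in D.Ω, K.indicator (fun p => ∑ J, u p J ^ 2) p := by
    rw [setIntegral_indicator hKm, inter_eq_self_of_subset_right hKΩ, integral_finsetSum]
    exact fun J _ => (hindJ J).mono_set hKΩ
  have hint : IntegrableOn (fun p => 2 * ((k + l) * n : ℝ) ^ 2 * (ε * (D.powWeight σ μ p *
      ∑ J, u p J ^ 2) + M * K.indicator (fun p => ∑ J, u p J ^ 2) p)) D.Ω :=
    ((h1.integrableOn_sum.const_mul ε).add (hind.const_mul M)).const_mul _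
  rw [h1.compNormSq_eq, h2.compNormSq_eq, hindeq, ← integral_const_mul, ← integral_const_mul,
    ← integral_const_mul, ← integral_add (h1.integrableOn_sum.const_mul ε) (hind.const_mul M),
    ← integral_const_mul, ← integral_add (h2.integrableOn_sum.const_mul 2) hint]
  refine setIntegral_mono_on ((isTest_component hu I).integrableOn_pderiv_sq D.isOpen
    (D.tame_powWeight _ _) i) ((h2.integrableOn_sum.const_mul 2).add hint)
    D.isOpen.measurableSet fun p hp => ?_
  have hw := (D.powWeight_pos (σ + 1) μ hp).le
  have hU : 0 ≤ ∑ J, u p J ^ 2 := Finset.sum_nonneg fun _ _ => sq_nonneg _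
  have h3 := mul_le_mul_of_nonneg_left (G.sq_pderiv_le u i I p) hw
  have h4 := mul_le_mul_of_nonneg_right (hKεM p hp) hU
  have h5 : K.indicator (fun _ => M) p * ∑ J, u p J ^ 2 =
      M * K.indicator (fun p => ∑ J, u p J ^ 2) p := by
    by_cases hpK : p ∈ K <;> simp [hpK]
  have h6 : (0 : ℝ) ≤ 2 * ((k + l) * n) ^ 2 := by positivity
  rw [add_mul, h5] at h4
  have h7 := mul_le_mul_of_nonneg_left h4 h6
  linarith

theorem exists_pderiv_le (D : ScaleInvariantDomain n) (G : AEMetric n) (k l : ℕ) (σ μ : ℝ)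
    {ε : ℝ} (hε : 0 < ε) : ∃ K ⊆ D.Ω, IsCompact K ∧ ∃ M : ℝ, 0 ≤ M ∧
      ∀ u ∈ testFields D k l,
        ∑ I, ∑ i, (∫ p in D.Ω, D.powWeight (σ + 1) μ p * pderiv i (fun q => u q I) p ^ 2) ≤
          M * compNormSq D (σ + 1) μ (G.nabla u) + ε * compNormSq D σ μ u +
            M * ∑ J, ∫ p in K, u p J ^ 2 := by
  set c : ℝ := 2 * ((k + l) * n) ^ 2 with hc
  have hc0 : 0 ≤ c := by positivity
  set N : ℝ := Fintype.card (TIdx n k l) * n with hN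
  have hN0 : 0 ≤ N := by positivity
  -- The sum over components and directions has `N` terms, each with an error `c ε'` times the norm
  -- of `u`.
  set ε' : ℝ := ε / (N * c + 1) with hε'
  have hε'0 : 0 < ε' := by positivity
  obtain ⟨ρ, δ, hδ, hcore⟩ := G.exists_core_christoffel_le D hε'0
  have hK := D.isCompact_core ρ hδ
  obtain ⟨M, hM0, hM⟩ := ((D.tame_powWeight (σ + 1) μ).mul
    (G.tame_christoffelSq D.isOpen)).exists_bound hK (D.core_subset ρ δ)
  refine ⟨_, D.core_subset ρ δ, hK, N * 2 + N * (c * M), by positivity, fun u hu => ?_⟩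
  have h1 := fun (I : TIdx n k l) (i : Fin n) => integral_pderiv_sq_le D G (σ := σ) (μ := μ)
    (ε := ε') (M := M) hK (D.core_subset ρ δ) (fun p hp => by
      by_cases hpK : p ∈ D.core ρ δ
      · rw [indicator_of_mem hpK]
        have h2 := (le_abs_self _).trans (hM p hpK)
        have h3 := mul_pos hε'0 (D.powWeight_pos σ μ hp)
        linarith
      · rw [indicator_of_notMem hpK, add_zero, D.powWeight_add_one σ μ hp]
        have h2 := mul_le_mul_of_nonneg_right (hcore p hp hpK) (D.powWeight_pos σ μ hp).le
        linarith) hu i I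
  refine (Finset.sum_le_sum fun I _ => Finset.sum_le_sum fun i _ => h1 I i).trans ?_
  simp only [Finset.sum_const, Finset.card_univ, Fintype.card_fin, nsmul_eq_mul]
  set P := compNormSq D (σ + 1) μ (G.nabla u) with hP
  set U := compNormSq D σ μ u with hU
  set Q := ∑ J, ∫ p in D.core ρ δ, u p J ^ 2 with hQ
  have hP0 : 0 ≤ P := compNormSq_nonneg _ _ _ _
  have hU0 : 0 ≤ U := compNormSq_nonneg _ _ _ _
  have hQ0 : 0 ≤ Q := Finset.sum_nonneg fun J _ => integral_nonneg fun p => sq_nonneg _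
  have h2 : N * c * ε' ≤ ε := by
    rw [hε', mul_div_assoc', div_le_iff₀ (by positivity)]
    nlinarith
  have h3 := mul_le_mul_of_nonneg_right h2 hU0
  have h4 : 0 ≤ N * (c * M) * P := by positivity
  have h5 : 0 ≤ N * 2 * Q := by positivity
  have h6 : (Fintype.card (TIdx n k l) : ℝ) * (n * (2 * P + c * (ε' * U + M * Q))) =
      N * 2 * P + N * c * ε' * U + N * (c * M) * Q := by rw [hN]; ring
  refine h6.le.trans ?_
  nlinarith

/-- The Hardy inequality for the components involves partial derivatives; replacing them by
covariant ones costs a multiple of the left side, chosen small enough that half of it remains after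
absorption. -/
theorem exists_local_estimate (D : ScaleInvariantDomain n) (G : AEMetric n) (k l : ℕ) {σ μ : ℝ}
    (hσ : σ ≠ -1 / 2) (hσμ : σ + μ + (n : ℝ) / 2 ≠ 0) :
    ∃ K ⊆ D.Ω, IsCompact K ∧ ∃ C : ℝ, 0 ≤ C ∧ ∀ u ∈ testFields D k l,
      compNormSq D σ μ u ≤
        C * (compNormSq D (σ + 1) μ (G.nabla u) + ∑ J, ∫ p in K, u p J ^ 2) := by
  obtain ⟨C, hC0, K₁, hK₁Ω, hK₁, hC⟩ := D.hardy_inequality hσ hσμ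
  obtain ⟨K₂, hK₂Ω, hK₂, M, hM0, hM⟩ := exists_pderiv_le D G k l σ μ
    (ε := 1 / (2 * (C + 1))) (by positivity)
  refine ⟨K₁ ∪ K₂, union_subset hK₁Ω hK₂Ω, hK₁.union hK₂, 2 * (C * (M + 1)), by positivity,
    fun u hu => ?_⟩
  have h1 : compNormSq D σ μ u ≤ C * (∑ I, ∑ i, (∫ p in D.Ω, D.powWeight (σ + 1) μ p *
      pderiv i (fun q => u q I) p ^ 2) + ∑ I, ∫ p in K₁, u p I ^ 2) := by
    rw [← Finset.sum_add_distrib, Finset.mul_sum]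
    exact Finset.sum_le_sum fun I _ => hC _ (isTest_component hu I)
  have h2 := hM u hu
  have hmono : ∀ K' ⊆ K₁ ∪ K₂,
      ∑ J, ∫ p in K', u p J ^ 2 ≤ ∑ J, ∫ p in K₁ ∪ K₂, u p J ^ 2 := fun K' hK' => by
    refine Finset.sum_le_sum fun J _ => setIntegral_mono_set ?_
      (Eventually.of_forall fun p => sq_nonneg _) hK'.eventuallyLE
    exact (((contDiff_component hu J).continuous.pow 2).continuousOn).integrableOn_compact
      (hK₁.union hK₂)
  have h3 := hmono K₁ subset_union_left
  have h4 := hmono K₂ subset_union_right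
  set P := compNormSq D (σ + 1) μ (G.nabla u) with hP
  set U := compNormSq D σ μ u with hU
  set Q := ∑ J, ∫ p in K₁ ∪ K₂, u p J ^ 2 with hQ
  have hP0 : 0 ≤ P := compNormSq_nonneg _ _ _ _
  have hU0 : 0 ≤ U := compNormSq_nonneg _ _ _ _
  have h5 : C * (1 / (2 * (C + 1)) * U) ≤ U / 2 := by
    have : C * (1 / (2 * (C + 1)) * U) = U / 2 * (C / (C + 1)) := by field_simp
    rw [this]
    exact mul_le_of_le_one_right (by positivity) ((div_le_one (by positivity)).2 (by linarith))
  have h6 := mul_le_mul_of_nonneg_left (add_le_add h2 h3) hC0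
  have h7 := mul_le_mul_of_nonneg_left (mul_le_mul_of_nonneg_left h4 hM0) hC0
  have h8 : 0 ≤ C * P := mul_nonneg hC0 hP0
  linarith

/-- The weighted norm of a test field is controlled by that of its covariant derivative and by
finitely many functionals. -/
theorem exists_finite_estimate (D : ScaleInvariantDomain n) (G : AEMetric n) (k l : ℕ) {σ μ : ℝ}
    (hσ : σ ≠ -1 / 2) (hσμ : σ + μ + (n : ℝ) / 2 ≠ 0) :
    ∃ χ, IsTest D.Ω χ ∧ ∃ (t : Finset (Eucl n)) (h C : ℝ), 0 ≤ C ∧ ∀ u ∈ testFields D k l,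
      compNormSq D σ μ u ≤ C * (compNormSq D (σ + 1) μ (G.nabla u) +
        ∑ I, ∑ z ∈ t, (∫ p in Metric.ball z h, χ p * u p I) ^ 2) := by
  obtain ⟨K, hKΩ, hK, C, hC0, hC⟩ := exists_local_estimate D G k l hσ hσμ
  obtain ⟨χ, hχ, hχε⟩ := D.exists_functionals hK hKΩ σ μ (σ + 1) μ
  -- Here the crude bound `x² |Γ|² ≤ B` suffices and leaves no compact remainder, since smallness
  -- will come from the `ε` of `exists_functionals`.
  obtain ⟨C', hC'0, hC'⟩ : ∃ C' : ℝ, 0 ≤ C' ∧ ∀ u ∈ testFields D k l,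
      ∑ I, ∑ i, (∫ p in D.Ω, D.powWeight (σ + 1) μ p * pderiv i (fun q => u q I) p ^ 2) ≤
        C' * (compNormSq D (σ + 1) μ (G.nabla u) + compNormSq D σ μ u) := by
    obtain ⟨B, hB0, hB⟩ := G.exists_christoffel_le D
    refine ⟨Fintype.card (TIdx n k l) * n * (2 + 2 * ((k + l) * n) ^ 2 * B), by positivity,
      fun u hu => ?_⟩
    have h1 := fun (I : TIdx n k l) (i : Fin n) => integral_pderiv_sq_le D G (σ := σ) (μ := μ)
      (ε := B) (M := 0) (K := (∅ : Set (Eucl n))) isCompact_empty (empty_subset _) (fun p hp => by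
        rw [indicator_empty, add_zero, D.powWeight_add_one σ μ hp]
        have h2 := mul_le_mul_of_nonneg_right (hB p hp) (D.powWeight_pos σ μ hp).le
        linarith) hu i I
    refine (Finset.sum_le_sum fun I _ => Finset.sum_le_sum fun i _ => h1 I i).trans ?_
    simp only [Finset.sum_const, Finset.card_univ, Fintype.card_fin, nsmul_eq_mul, zero_mul,
      add_zero]
    have hP0 := compNormSq_nonneg D (σ + 1) μ (G.nabla u)
    have hU0 := compNormSq_nonneg D σ μ u
    have h3 : (0 : ℝ) ≤ 2 * ((k + l) * n) ^ 2 * B := by positivity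
    rw [← mul_assoc, mul_assoc _ _ (compNormSq D (σ + 1) μ (G.nabla u) + _)]
    refine mul_le_mul_of_nonneg_left ?_ (by positivity)
    nlinarith [mul_nonneg h3 hP0]
  -- This value gives `C ε (1 + C') ≤ 1 / 2`, so the norm of `u` on the right can be absorbed.
  obtain ⟨t, h, A, hA0, hA⟩ := hχε (1 / (2 * (C * (1 + C') + 1))) (by positivity)
  refine ⟨χ, hχ, t, h, 2 * (C + 1 + C * A), by positivity, fun u hu => ?_⟩
  have h1 := hC u hu
  have h2 := hC' u hu
  have h3 : ∑ J, ∫ p in K, u p J ^ 2 ≤ 1 / (2 * (C * (1 + C') + 1)) *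
      (compNormSq D σ μ u + ∑ I, ∑ i, (∫ p in D.Ω, D.powWeight (σ + 1) μ p *
        pderiv i (fun q => u q I) p ^ 2)) +
      A * ∑ I, ∑ z ∈ t, (∫ p in Metric.ball z h, χ p * u p I) ^ 2 := by
    rw [compNormSq, ← Finset.sum_add_distrib, Finset.mul_sum, Finset.mul_sum,
      ← Finset.sum_add_distrib]
    exact Finset.sum_le_sum fun I _ => hA _ (isTest_component hu I)
  have hP0 := compNormSq_nonneg D (σ + 1) μ (G.nabla u)
  have hU0 := compNormSq_nonneg D σ μ u
  have hS0 : 0 ≤ ∑ I, ∑ z ∈ t, (∫ p in Metric.ball z h, χ p * u p I) ^ 2 :=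
    Finset.sum_nonneg fun _ _ => Finset.sum_nonneg fun _ _ => sq_nonneg _
  generalize (∑ I, ∑ z ∈ t, (∫ p in Metric.ball z h, χ p * u p I) ^ 2) = S at *
  generalize (∑ I, ∑ i, (∫ p in D.Ω, D.powWeight (σ + 1) μ p *
        pderiv i (fun q => u q I) p ^ 2)) = T at *
  generalize (∑ J, ∫ p in K, u p J ^ 2) = Q at *
  generalize compNormSq D (σ + 1) μ (G.nabla u) = P at *
  generalize compNormSq D σ μ u = U at *
  set ε := 1 / (2 * (C * (1 + C') + 1)) with hε
  have hε0 : 0 < ε := by positivity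
  have hεC : C * (ε * (1 + C')) ≤ 1 / 2 := by
    have : C * (ε * (1 + C')) = 1 / 2 * (C * (1 + C') / (C * (1 + C') + 1)) := by
      rw [hε]; field_simp
    rw [this]
    exact mul_le_of_le_one_right (by norm_num) ((div_le_one (by positivity)).2 (by linarith))
  have h4 : ε * (U + T) ≤ ε * (1 + C') * (U + P) := by
    have h5 : U + T ≤ (1 + C') * (U + P) := by nlinarith
    have h6 := mul_le_mul_of_nonneg_left h5 hε0.le
    linarith
  have h5 : C * Q ≤ C * (ε * (1 + C')) * (U + P) + C * (A * S) := by
    have h6 := mul_le_mul_of_nonneg_left (h3.trans (add_le_add_left h4 _)) hC0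
    linarith
  have h6 := mul_le_mul_of_nonneg_right hεC (add_nonneg hU0 hP0)
  have h7 : 0 ≤ C * A * P := by positivity
  have h8 : 0 ≤ (C + 1) * S := by positivity
  nlinarith

end TensorEstimate

/-! ### Passage to the completion -/

/-- If `A` is controlled by `B` and by a map `L` of finite rank, then it is controlled by `B` alone
on every closed subspace on which `B` is injective. -/
theorem exists_bound_of_finite_rank {H E₁ E₂ F : Type*} [NormedAddCommGroup H] [NormedSpace ℝ H]
    [CompleteSpace H] [NormedAddCommGroup E₁] [NormedSpace ℝ E₁] [NormedAddCommGroup E₂]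
    [NormedSpace ℝ E₂] [NormedAddCommGroup F] [NormedSpace ℝ F] [ProperSpace F]
    (A : H →L[ℝ] E₁) (B : H →L[ℝ] E₂) (L : H →L[ℝ] F)
    (hnorm : ∀ u, ‖u‖ ^ 2 ≤ ‖A u‖ ^ 2 + ‖B u‖ ^ 2) {C : ℝ} (hC0 : 0 ≤ C)
    (hC : ∀ u, ‖A u‖ ^ 2 ≤ C * (‖B u‖ ^ 2 + ‖L u‖ ^ 2)) (X : Submodule ℝ H)
    (hX : IsClosed (X : Set H)) (hinj : ∀ u ∈ X, B u = 0 → u = 0) :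
    ∃ C' : ℝ, ∀ u ∈ X, ‖A u‖ ^ 2 ≤ C' * ‖B u‖ ^ 2 := by
  by_contra! hcon
  set T : H →L[ℝ] E₂ × F := B.prod L with hT
  -- The two hypotheses together bound `u` by `(B u, L u)`; as `H` is complete, `T` is a closed
  -- embedding.
  have hbound : ∀ u, ‖u‖ ≤ (⟨√(2 * (C + 1)), Real.sqrt_nonneg _⟩ : NNReal) * ‖T u‖ := fun u => by
    have h1 : ‖B u‖ ≤ ‖T u‖ := le_max_left _ _
    have h2 : ‖L u‖ ≤ ‖T u‖ := le_max_right _ _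
    have h3 : ‖B u‖ ^ 2 ≤ ‖T u‖ ^ 2 := by gcongr
    have h4 : ‖L u‖ ^ 2 ≤ ‖T u‖ ^ 2 := by gcongr
    have h5 : ‖u‖ ^ 2 ≤ 2 * (C + 1) * ‖T u‖ ^ 2 := by
      have := mul_le_mul_of_nonneg_left (add_le_add h3 h4) hC0
      nlinarith [hnorm u, hC u, sq_nonneg ‖T u‖]
    calc ‖u‖ ≤ √(2 * (C + 1) * ‖T u‖ ^ 2) := Real.le_sqrt_of_sq_le h5
      _ = √(2 * (C + 1)) * ‖T u‖ := by
        rw [Real.sqrt_mul (by positivity), Real.sqrt_sq (norm_nonneg _)]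
  have hemb := (T.antilipschitz_of_bound hbound).isClosedEmbedding T.uniformContinuous
  choose u huX hu using fun m : ℕ => hcon m
  have hu0 : ∀ m, u m ≠ 0 := fun m h0 => by
    have := hu m
    simp [h0] at this
  have hun : ∀ m, ‖u m‖ ≠ 0 := fun m => norm_ne_zero_iff.2 (hu0 m)
  set v : ℕ → H := fun m => ‖u m‖⁻¹ • u m with hv
  have hvX : ∀ m, v m ∈ X := fun m => X.smul_mem _ (huX m)
  have hv1 : ∀ m, ‖v m‖ = 1 := fun m => by
    simp only [hv, norm_smul, norm_inv, norm_norm]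
    exact inv_mul_cancel₀ (hun m)
  -- The inequality with constant `m` fails at `u m`, so on unit vectors `‖B (v m)‖²` is at most
  -- `‖A‖² / m`.
  have hAB : ∀ m : ℕ, m * ‖B (v m)‖ ^ 2 ≤ ‖A‖ ^ 2 := fun m => by
    have h1 : m * ‖B (v m)‖ ^ 2 ≤ ‖A (v m)‖ ^ 2 := by
      simp only [hv, map_smul, norm_smul, norm_inv, norm_norm, mul_pow]
      rw [mul_left_comm]
      exact mul_le_mul_of_nonneg_left (hu m).le (by positivity)
    have h2 : ‖A (v m)‖ ≤ ‖A‖ := by simpa [hv1] using A.le_opNorm (v m)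
    exact h1.trans (by gcongr)
  have hB0 : Tendsto (fun m => B (v m)) atTop (𝓝 0) := by
    have h1 : Tendsto (fun m : ℕ => ‖A‖ ^ 2 / (m : ℝ)) atTop (𝓝 0) :=
      tendsto_const_div_atTop_nhds_zero_nat _
    have h2 : Tendsto (fun m => ‖B (v m)‖ ^ 2) atTop (𝓝 0) := by
      refine squeeze_zero' (Eventually.of_forall fun m => by positivity) ?_ h1
      filter_upwards [eventually_gt_atTop 0] with m hm
      rw [le_div_iff₀ (by exact_mod_cast hm), mul_comm]
      exact hAB m
    have h3 := h2.sqrt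
    simp only [Real.sqrt_sq (norm_nonneg _), Real.sqrt_zero] at h3
    exact tendsto_zero_iff_norm_tendsto_zero.2 h3
  -- The only use of finite rank: bounded sequences in `F` have convergent subsequences, so `T (v (φ
  -- m))` converges and the embedding returns a limit of `v (φ m)`.
  obtain ⟨y, -, φ, hφ, hy⟩ := tendsto_subseq_of_bounded (x := fun m => L (v m))
    (Metric.isBounded_closedBall (x := (0 : F)) (r := ‖L‖)) fun m => by
      simpa [hv1] using L.le_opNorm (v m)
  have hTv : Tendsto (fun m => T (v (φ m))) atTop (𝓝 ((0 : E₂), y)) :=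
    (hB0.comp hφ.tendsto_atTop).prodMk_nhds hy
  obtain ⟨z, hz⟩ : ((0 : E₂), y) ∈ range T :=
    hemb.isClosed_range.mem_of_tendsto hTv (Eventually.of_forall fun m => mem_range_self _)
  rw [← hz] at hTv
  have hvz : Tendsto (fun m => v (φ m)) atTop (𝓝 z) :=
    hemb.isInducing.tendsto_nhds_iff.2 hTv
  have hzX : z ∈ X := hX.mem_of_tendsto hvz (Eventually.of_forall fun m => hvX _)
  have hz0 : z = 0 := hinj z hzX (congrArg Prod.fst hz)
  have h1 := hvz.norm
  simp only [hv1, hz0, norm_zero] at h1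
  exact one_ne_zero (tendsto_nhds_unique tendsto_const_nhds h1)

/-! ### Density and continuity on the completed space -/

section H

variable {n : ℕ} (D : ScaleInvariantDomain n) (G : AEMetric n) (k l : ℕ) (σ μ : ℝ)

theorem norm_toL2_coe_sq (u : TestField D G k l σ μ) :
    ‖toL2 D G k l σ μ (u : H D G k l σ μ)‖ ^ 2 =
      ∫ p in D.Ω, weight D G σ μ p * G.tensorInner p (u.1 p) (u.1 p) := by
  have h : toL2 D G k l σ μ (u : H D G k l σ μ) =
      ((graphMap D G k l σ μ u).fst : L2 D G k l σ μ) :=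
    UniformSpace.Completion.map_coe (ContinuousLinearMap.uniformContinuous _) u
  rw [h, UniformSpace.Completion.norm_coe]
  exact PreL2.norm_sq_eq D G k l σ μ _

theorem norm_nablaH_coe_sq (u : TestField D G k l σ μ) :
    ‖nablaH D G k l σ μ (u : H D G k l σ μ)‖ ^ 2 =
      ∫ p in D.Ω, weight D G (σ + 1) μ p *
        G.tensorInner p (G.nabla u.1 p) (G.nabla u.1 p) := by
  have h : nablaH D G k l σ μ (u : H D G k l σ μ) =
      ((graphMap D G k l σ μ u).snd : L2 D G k (l + 1) (σ + 1) μ) :=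
    UniformSpace.Completion.map_coe (ContinuousLinearMap.uniformContinuous _) u
  rw [h, UniformSpace.Completion.norm_coe]
  exact PreL2.norm_sq_eq D G k (l + 1) (σ + 1) μ _

theorem norm_sq_eq_add (u : H D G k l σ μ) :
    ‖u‖ ^ 2 = ‖toL2 D G k l σ μ u‖ ^ 2 + ‖nablaH D G k l σ μ u‖ ^ 2 := by
  induction u using UniformSpace.Completion.induction_on with
  | hp => exact isClosed_eq (by fun_prop) (by fun_prop)
  | ih u =>
    rw [norm_toL2_coe_sq, norm_nablaH_coe_sq, UniformSpace.Completion.norm_coe,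
      TestField.norm_sq_eq]

/-- The integrals over balls of the components of `χ u`. -/
noncomputable def ballIntegrals {χ : Eucl n → ℝ} (hχ : IsTest D.Ω χ) (t : Finset (Eucl n))
    (h : ℝ) : TestField D G k l σ μ →ₗ[ℝ] (TIdx n k l × t → ℝ) where
  toFun u J := ∫ p in Metric.ball J.2.1 h, χ p * u.1 p J.1
  map_add' u v := by
    funext J
    have hi : ∀ u : TestField D G k l σ μ, Integrable fun p => χ p * u.1 p J.1 := fun u =>
      have hw := (isTest_component u.2 J.1).mul hχ.contDiff
      hw.integrable (hw.tame D.isOpen) fun p hp => IsTest.eq_zero hp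
    change ∫ p in Metric.ball J.2.1 h, χ p * (u.1 p J.1 + v.1 p J.1) = _
    simp only [mul_add]
    exact integral_add (hi u).integrableOn (hi v).integrableOn
  map_smul' c u := by
    funext J
    change ∫ p in Metric.ball J.2.1 h, χ p * (c * u.1 p J.1) = c * _
    simp only [mul_left_comm _ c]
    exact integral_const_mul c _

theorem compNormSq_le_norm_sq : ∃ c : ℝ, 0 ≤ c ∧ ∀ u : TestField D G k l σ μ,
    compNormSq D σ μ u.1 ≤ c * ‖u‖ ^ 2 := by
  obtain ⟨c, C, hc, hC, h⟩ := exists_compNormSq_bounds D G k l σ μ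
  refine ⟨c, hc.le, fun u => (h u.1 (isL2_of_mem u.2 _ _)).1.trans ?_⟩
  rw [← UniformSpace.Completion.norm_coe, norm_sq_eq_add, norm_toL2_coe_sq]
  exact mul_le_mul_of_nonneg_left (by linarith [sq_nonneg ‖nablaH D G k l σ μ u‖]) hc.le

theorem ballIntegrals_bound {χ : Eucl n → ℝ} (hχ : IsTest D.Ω χ) (t : Finset (Eucl n)) (h : ℝ) :
    ∃ C : ℝ, ∀ u, ‖ballIntegrals D G k l σ μ hχ t h u‖ ≤ C * ‖u‖ := by
  obtain ⟨c, hc0, hc⟩ := compNormSq_le_norm_sq D G k l σ μ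
  choose C hC0 hC using fun z => D.sq_integral_ball_le hχ σ μ z h
  have hS : 0 ≤ ∑ z ∈ t, C z := Finset.sum_nonneg fun z _ => hC0 z
  refine ⟨√((∑ z ∈ t, C z) * c), fun u => ?_⟩
  refine (pi_norm_le_iff_of_nonneg (by positivity)).2 fun J => ?_
  rw [← Real.sqrt_sq (norm_nonneg u), ← Real.sqrt_mul (by positivity)]
  refine Real.abs_le_sqrt ?_
  have h1 := hC J.2.1 _ (isTest_component u.2 J.1)
  have h2 : ∫ p in D.Ω, D.powWeight σ μ p * u.1 p J.1 ^ 2 ≤ compNormSq D σ μ u.1 :=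
    Finset.single_le_sum (f := fun I => ∫ p in D.Ω, D.powWeight σ μ p * u.1 p I ^ 2)
      (fun I _ => integral_powWeight_nonneg D σ μ _) (Finset.mem_univ J.1)
  have h3 : C J.2.1 ≤ ∑ z ∈ t, C z :=
    Finset.single_le_sum (fun z _ => hC0 z) J.2.2
  calc _ ≤ C J.2.1 * ∫ p in D.Ω, D.powWeight σ μ p * u.1 p J.1 ^ 2 := h1
    _ ≤ (∑ z ∈ t, C z) * (c * ‖u‖ ^ 2) :=
        mul_le_mul h3 (h2.trans (hc u)) (integral_powWeight_nonneg D σ μ _) hS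
    _ = _ := by ring

/-- Both sides are continuous on the completion once the ball integrals are extended by their bound,
so the estimate for test fields passes to the limit. -/
theorem exists_finite_rank_estimate {σ μ : ℝ} (hσ : σ ≠ -1 / 2)
    (hσμ : σ + μ + (n : ℝ) / 2 ≠ 0) :
    ∃ (t : Finset (Eucl n)) (L : H D G k l σ μ →L[ℝ] (TIdx n k l × t → ℝ)) (C : ℝ), 0 ≤ C ∧
      ∀ u, ‖toL2 D G k l σ μ u‖ ^ 2 ≤ C * (‖nablaH D G k l σ μ u‖ ^ 2 + ‖L u‖ ^ 2) := by
  obtain ⟨χ, hχ, t, h, C, hC0, hC⟩ := exists_finite_estimate D G k l hσ hσμ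
  obtain ⟨_, C₁, _, hC₁, h₁⟩ := exists_compNormSq_bounds D G k l σ μ
  obtain ⟨c₂, _, hc₂, _, h₂⟩ := exists_compNormSq_bounds D G k (l + 1) (σ + 1) μ
  set Λ := ballIntegrals D G k l σ μ hχ t h with hΛ
  set e : TestField D G k l σ μ →ₗ[ℝ] H D G k l σ μ :=
    (UniformSpace.Completion.toComplL : _ →L[ℝ] H D G k l σ μ).toLinearMap with he
  have hdense : DenseRange e := UniformSpace.Completion.denseRange_coe
  have hext : ∀ u : TestField D G k l σ μ, Λ.extendOfNorm e (u : H D G k l σ μ) = Λ u := fun u => by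
    refine LinearMap.extendOfNorm_eq hdense ?_ u
    obtain ⟨B, hB⟩ := ballIntegrals_bound D G k l σ μ hχ t h
    exact ⟨B, fun v => (hB v).trans_eq
      (congrArg (B * ·) (UniformSpace.Completion.norm_coe v).symm)⟩
  set N : ℝ := (Fintype.card (TIdx n k l × t) : ℝ) with hN
  refine ⟨t, Λ.extendOfNorm e, C₁ * C * (c₂ + N), by positivity, fun u => ?_⟩
  induction u using UniformSpace.Completion.induction_on with
  | hp => exact isClosed_le (by fun_prop) (by fun_prop)
  | ih u =>
    rw [hext, norm_toL2_coe_sq, norm_nablaH_coe_sq]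
    have h3 := (h₁ u.1 (isL2_of_mem u.2 _ _)).2
    have h4 := (h₂ (G.nabla u.1) (isL2_nabla_of_mem u.2 _ _)).1
    have h5 := hC u.1 u.2
    -- The target of `L` carries the sup norm, whence the number `N` of functionals.
    have h6 : ∑ I, ∑ z ∈ t, (∫ p in Metric.ball z h, χ p * u.1 p I) ^ 2 ≤ N * ‖Λ u‖ ^ 2 := by
      have h7 : ∑ I, ∑ z ∈ t, (∫ p in Metric.ball z h, χ p * u.1 p I) ^ 2 =
          ∑ J : TIdx n k l × t, Λ u J ^ 2 := by
        refine Eq.trans ?_ (Fintype.sum_prod_type fun J : TIdx n k l × t => Λ u J ^ 2).symm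
        refine Finset.sum_congr rfl fun I _ => ?_
        exact (Finset.sum_coe_sort t
          fun z => (∫ p in Metric.ball z h, χ p * u.1 p I) ^ 2).symm
      rw [h7]
      refine (Finset.sum_le_card_nsmul _ _ (‖Λ u‖ ^ 2) fun J _ => ?_).trans (le_of_eq ?_)
      · rw [← sq_abs]
        have := norm_le_pi_norm (Λ u) J
        rw [Real.norm_eq_abs] at this
        gcongr
      · rw [nsmul_eq_mul, Finset.card_univ]
    have h8 : 0 ≤ ∫ p in D.Ω, weight D G (σ + 1) μ p *
        G.tensorInner p (G.nabla u.1 p) (G.nabla u.1 p) :=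
      setIntegral_nonneg D.isOpen.measurableSet fun p hp =>
        mul_nonneg (weight_nonneg D G _ _ hp) (G.tensorInner_self_nonneg p _)
    have h9 := mul_le_mul_of_nonneg_left (h5.trans
      (mul_le_mul_of_nonneg_left (add_le_add h4 h6) hC0)) hC₁.le
    refine (h3.trans h9).trans ?_
    have h10 : 0 ≤ C₁ * C := mul_nonneg hC₁.le hC0
    have h11 : 0 ≤ N := Nat.cast_nonneg _
    rw [← mul_assoc, mul_assoc (C₁ * C)]
    refine mul_le_mul_of_nonneg_left ?_ h10
    nlinarith [mul_nonneg h11 h8, mul_nonneg hc₂.le (sq_nonneg ‖Λ u‖)]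

end H

end WeightedPoincare

/-! ### The weighted Poincaré inequality -/

theorem mainTheorem7 {n : ℕ} (D : WeightedPoincare.ScaleInvariantDomain n)
    (G : WeightedPoincare.AEMetric n) (k l : ℕ) (σ μ : ℝ)
    (hσ : σ ≠ -1 / 2) (hσμ : σ + μ + (n : ℝ) / 2 ≠ 0)
    (X : Submodule ℝ (WeightedPoincare.H D G k l σ μ))
    (hX_closed : IsClosed (X : Set (WeightedPoincare.H D G k l σ μ)))
    (hX_transversal : Disjoint X (WeightedPoincare.parallelFields D G k l σ μ)) :
    ∃ C : ℝ, ∀ u ∈ X,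
      ‖WeightedPoincare.toL2 D G k l σ μ u‖ ^ 2 ≤
        C * ‖WeightedPoincare.nablaH D G k l σ μ u‖ ^ 2 := by
  obtain ⟨t, L, C, hC0, hC⟩ := WeightedPoincare.exists_finite_rank_estimate D G k l hσ hσμ
  exact WeightedPoincare.exists_bound_of_finite_rank _ _ L
    (fun u => (WeightedPoincare.norm_sq_eq_add D G k l σ μ u).le) hC0 hC X hX_closed
    fun u hu hu0 => Submodule.disjoint_def.1 hX_transversal u hu hu0
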